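/- **Setting.** Let $n\ge 3$, $0\le k\le n-2$; subscripts $1,\dots,n$ of $\alpha,A$ are read modulo $n$. Let $s_0,\dots,s_{n-1}$ be the generators of the affine symmetric group $\hat S_n$, $\rho(s_i)=s_{i+1}$, $u=s_1s_2\cdots s_{n-1}$ and $v=s_ks_{k-1}\cdots s_0s_{n-1}\cdots s_{k+2}$. Attach parameters $z=(z_1,\dots,z_{n-1})$ to the letters of $v$ and $y=(y_1,\dots,y_{n-1})$ to those of $u$. The map $\phi(n,k):(z,y)\mapsto(y',z')$ is defined by $v(z)\,u(y)=\rho^{-1}(u)(y')\,\rho^{-1}(v)(z')$, using the relations $s_i(a)s_{i\pm1}(b)s_i(c)=s_{i\pm1}(\tfrac{bc}{a+c})s_i(a+c)s_{i\pm1}(\tfrac{ab}{a+c})$ and $s_i(a)s_j(b)=s_j(b)s_i(a)$ for $i-j\not\equiv0,\pm1$. $\Phi(n,k)$ is the same map with $(+,\times,\div)$ replaced by $(\min,+,-)$. Vectors in $y$-position are called states, those in $z$-position carriers; a family $(y_i^t,z_i^t)_{i,t\in\mathbb Z}$ is a solution if $(z_i^t,y_i^t)\mapsto(y_i^{t+1},z_{i+1}^t)$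 for all $i,t$. Let $A_1,\dots,A_n\in\mathbb R$ with $A_n<A_i<A_{k+1}$ for $i\in I:=\{1,\dots,n-1\}\setminus\{k+1\}$, and put $A=\min_{i\in I}A_i$. The vacuum state is $\mathbf W=(A_n,\dots,A_n)$ and the initial carrier is $\mathbf Z=(A_k,\dots,A_1,A_n,A_{n-1},\dots,A_{k+2})$. One time step of $\Phi(n,k)$ sends $(\mathbf Y_i)_{i\ge0}$ to $(\mathbf Y'_i)_{i\ge0}$, where $\mathbf Z_0=\mathbf Z$ and $(\mathbf Z_i,\mathbf Y_i)\mapsto(\mathbf Y_i',\mathbf Z_{i+1})$. A one-soliton is a nonempty finite sequence $X_1,\dots,X_M$ of non-vacuum states such that (i) for some $a,b\ge1$ the input $X_1,\dots,X_M,\mathbf W,\mathbf W,\dots$ is carried by $a$ time steps to the same sequence preceded by $b$ copies of $\mathbf W$, and (ii) at every time $\mathbf Z_i=\mathbf Z$ for $i\gg0$. Its velocity is $b/a$ with $a$ the least positive number of steps after which the sequence recurs (shifted). It is positive if every $X_j$ is $\ge\mathbf W$ entrywise and $\neq\mathbf W$; it is in minimal form if it is positive and $M$ is the least length of a window of consecutive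 places that contains all non-vacuum states at some time. Let $K=\bigcup_N\mathbb C((t^{1/N}))$ be the field of Puiseux series with valuation $\mathrm{val}$. A *geometric one-soliton* consists of $\alpha_1,\dots,\alpha_n,b,c,\ell\in K$ with $\mathrm{val}(\alpha_i)=A_i$, $\ell\ne0$, $\prod_i(b-\alpha_i)=\prod_i(c-\alpha_i)$, $A_n\le\mathrm{val}(b)<\mathrm{val}(c)<A_{k+1}$ and no $A_i$ in the interval $(\mathrm{val}(b),\mathrm{val}(c)]$. With $B_j=\frac{b-\alpha_j}{c-\alpha_j}$ its tau function is $\tau(S)=1+\ell\prod_jB_j^{s_j}$ for $S\in\mathbb Z^n$; the tropicalized tau function is $T(S)=\min\bigl[0,\mathrm{val}(\ell)+\sum_js_j\,\mathrm{val}(B_j)\bigr]$. With $e_{[1,p]}=e_1+\dots+e_p$, $\tau^{i,t}(S)=\tau(S-i\,e_n-t\,e_{k+1})$ and likewise $T^{i,t}$, put for $1\le p\le n-1$ $$y_{i,p}^t=(\alpha_n-\alpha_p)\frac{\tau^{i,t}(e_{k+1}+e_{[1,p]})\,\tau^{i,t}(e_{k+1}-e_n+e_{[1,p-1]})}{\tau^{i,t}(e_{k+1}+e_{[1,p-1]})\,\tau^{i,t}(e_{k+1}-e_n+e_{[1,p]})},\qquad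 z_{i,p}^t=(\alpha_q-\alpha_{k+1})\frac{\tau^{i,t}(e_{k+1}+e_{[1,q]})\,\tau^{i,t}(e_{[1,q-1]})}{\tau^{i,t}(e_{[1,q]})\,\tau^{i,t}(e_{k+1}+e_{[1,q-1]})},$$ where $q=k+1-p$ if $p\le k$ and $q=n+k+1-p$ if $p>k$. The tropicalization $Y_{i,p}^t,Z_{i,p}^t$ is obtained by replacing $\tau,\times,\div$ by $T,+,-$ and the factors $\alpha_n-\alpha_p$, $\alpha_q-\alpha_{k+1}$ by their valuations $A_n$, $A_q$. **Theorem 5.1.** 1. For every geometric one-soliton: if $\tau$ has no zero, then $(y_i^t,z_i^t)$ is a solution of $\phi(n,k)$ with all entries nonzero; if $\mathrm{val}(\tau(S))=T(S)$ for all $S$, then $Y$ and $Z$ are the entrywise valuations of $y$ and $z$; and $(Y_i^t,Z_i^t)$ is always a solution of $\Phi(n,k)$. - *If $x:=\mathrm{val}(c)<A$:* if $\tau$ has no zero, then for each $t$ and $p$ the valuations of $y_{i,p}^t-(\alpha_n-\alpha_p)$ and $z_{i,p}^t-(\alpha_{k+1-p}-\alpha_{k+1})$ tend to $\infty$ as $i\to\pm\infty$.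 For each $t$ the set of $i$ with $Y_i^t\ne\mathbf W$ is finite and nonempty, and $Z_i^t=\mathbf Z$ for all but finitely many $i$. One has $Y_{i+1}^{t+n-1}=Y_i^t$ for all $i,t$, and for no $t$ and no $0<a<n-1$ is $(Y_i^{t+a})_i$ a translate of $(Y_i^t)_i$: the velocity is $1/(n-1)$, independent of $x$. If $\mathrm{val}(\ell)=m(x-A_n)$ with $m\in\mathbb Z$, then $Y^{n-m}_i=\mathbf W$ for $i<0$ and $(Y_i^{n-m+t})_{i\ge0}$ is, for all $t\ge0$, the result of $t$ time steps of $\Phi(n,k)$ on the input $(x,\dots,x),\mathbf W,\mathbf W,\dots$. - *If instead $A_i\le\mathrm{val}(b)$ for some $i\ne n$:* $Y_i^t=\mathbf W$ for all $i,t$, so no soliton is obtained. 2. For all $\alpha_i\in K$ with $\mathrm{val}(\alpha_i)=A_i$ and every rational $x$ with $A_n<x<A$ there are $b,c,\ell\in K$ that form with the $\alpha_i$ a geometric one-soliton, such that $\mathrm{val}(c)=x$, $\mathrm{val}(\tau(S))=T(S)$ for all $S$, $\mathrm{val}(y_{i,p}^0)=A_n$ for $i<0$, and for all $i,t\ge0$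 the vector $(\mathrm{val}(y_{i,p}^t))_p$ is the $i$-th state after $t$ time steps of $\Phi(n,k)$ on the input $(x,\dots,x),\mathbf W,\mathbf W,\dots$. 3. For every real $x$ with $A_n<x<A$ the single state $(x,\dots,x)$ is a one-soliton of $\Phi(n,k)$ in minimal form with velocity $1/(n-1)$. For all $i,t\ge 0$ its $i$-th state after $t$ time steps equals $Y_i^t$ computed from $T(S)=\min[0,\,n(x-A_n)+\sum_js_jW_j]$ with $W_n=(n-1)(x-A_n)$ and $W_j=-(x-A_n)$ for $j\ne n$. -/

import Mathlib

open Filter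

namespace SolitonCA

/-! ### Lusztig moves and the dynamical step -/

section Dynamics

variable {R : Type*}

/-- The parameter change `(a, b, c) ↦ (bc/(a+c), a+c, ab/(a+c))` of the Lusztig relation. -/
def geomMove {K : Type*} [Field K] (a b c : K) : K × K × K :=
  (b * c / (a + c), a + c, a * b / (a + c))

/-- Its tropicalization `(A, B, C) ↦ (B+C-min(A,C), min(A,C), A+B-min(A,C))`. -/
def tropMove (A B C : ℝ) : ℝ × ℝ × ℝ :=
  (B + C - min A C, min A C, A + B - min A C)

/-- Words in the generators `s_i` (`i` modulo `n`) of the affine symmetric group whose letters carry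
parameters, and the Lusztig relations between them.  The parameter change is an involution, so
the braid relation is used in both directions with the same formula. -/
inductive LusztigMove {n : ℕ} (mv : R → R → R → R × R × R) :
    List (ZMod n × R) → List (ZMod n × R) → Prop
  | up (l r : List (ZMod n × R)) (i : ZMod n) (a b c : R) :
      LusztigMove mv (l ++ [(i, a), (i + 1, b), (i, c)] ++ r)
        (l ++ [(i + 1, (mv a b c).1), (i, (mv a b c).2.1), (i + 1, (mv a b c).2.2)] ++ r)
  | down (l r : List (ZMod n × R)) (i : ZMod n) (a b c : R) :
      LusztigMove mv (l ++ [(i + 1, a), (i, b), (i + 1, c)] ++ r)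
        (l ++ [(i, (mv a b c).1), (i + 1, (mv a b c).2.1), (i, (mv a b c).2.2)] ++ r)
  | comm (l r : List (ZMod n × R)) (i j : ZMod n) (a b : R)
      (h0 : j ≠ i) (h1 : j ≠ i + 1) (h2 : i ≠ j + 1) :
      LusztigMove mv (l ++ [(i, a), (j, b)] ++ r) (l ++ [(j, b), (i, a)] ++ r)

/-- States and carriers: vectors `(y_1, …, y_{n-1})`; the `p`-th entry has index `p - 1`. -/
abbrev State (n : ℕ) (R : Type*) := Fin (n - 1) → R

/-- The entry `y_p` for `1 ≤ p ≤ n - 1` (and `0` for the other, never used, values of `p`). -/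
def entry [Zero R] {n : ℕ} (y : State n R) (p : ℕ) : R :=
  if h : 1 ≤ p ∧ p ≤ n - 1 then y ⟨p - 1, by omega⟩ else 0

/-- The parameter of the middle letter after `j` successive braid moves, started from the parameter
`m`; the `j`-th move is applied to the parameters `(a j, middle, c j)`. -/
def mid (mv : R → R → R → R × R × R) (m : R) (a c : ℕ → R) : ℕ → R
  | 0 => m
  | j + 1 => (mv (a j) (mid mv m a c j) (c j)).2.1

/-- The three parameters produced by the `j`-th move of such a chain. -/
def triple (mv : R → R → R → R × R × R) (m : R) (a c : ℕ → R) (j : ℕ) : R × R × R :=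
  mv (a j) (mid mv m a c j) (c j)

variable {n : ℕ}

theorem LusztigMove.context {mv : R → R → R → R × R × R} {x y : List (ZMod n × R)}
    (h : Relation.ReflTransGen (LusztigMove mv) x y) (l r : List (ZMod n × R)) :
    Relation.ReflTransGen (LusztigMove mv) (l ++ x ++ r) (l ++ y ++ r) := by
  refine Relation.ReflTransGen.lift (p := LusztigMove mv) (fun w => l ++ w ++ r) ?_ _ _ h
  intro p q hpq
  change LusztigMove mv (l ++ p ++ r) (l ++ q ++ r)
  cases hpq with
  | up l' r' i a b c =>
    have := LusztigMove.up (mv := mv) (l ++ l') (r' ++ r) i a b c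
    simpa [List.append_assoc] using this
  | down l' r' i a b c =>
    have := LusztigMove.down (mv := mv) (l ++ l') (r' ++ r) i a b c
    simpa [List.append_assoc] using this
  | comm l' r' i j a b h0 h1 h2 =>
    have := LusztigMove.comm (mv := mv) (l ++ l') (r' ++ r) i j a b h0 h1 h2
    simpa [List.append_assoc] using this

theorem LusztigMove.commOne {mv : R → R → R → R × R × R} (x : ZMod n × R)
    (ys : List (ZMod n × R))
    (h : ∀ y ∈ ys, y.1 ≠ x.1 ∧ y.1 ≠ x.1 + 1 ∧ x.1 ≠ y.1 + 1) :
    Relation.ReflTransGen (LusztigMove mv) (x :: ys) (ys ++ [x]) := by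
  induction ys with
  | nil => exact .refl
  | cons y ys ih =>
    have hy := h y (by simp)
    have h1 : LusztigMove mv (x :: y :: ys) (y :: x :: ys) := by
      simpa using LusztigMove.comm (mv := mv) [] ys x.1 y.1 x.2 y.2 hy.1 hy.2.1 hy.2.2
    refine Relation.ReflTransGen.head h1 ?_
    simpa using LusztigMove.context (ih fun y' hy' => h y' (by simp [hy'])) [y] []

theorem LusztigMove.commLists {mv : R → R → R → R × R × R} (xs ys : List (ZMod n × R))
    (h : ∀ x ∈ xs, ∀ y ∈ ys, y.1 ≠ x.1 ∧ y.1 ≠ x.1 + 1 ∧ x.1 ≠ y.1 + 1) :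
    Relation.ReflTransGen (LusztigMove mv) (xs ++ ys) (ys ++ xs) := by
  induction xs with
  | nil => simpa using Relation.ReflTransGen.refl
  | cons x xs ih =>
    have h1 := LusztigMove.context (ih fun x' hx' => h x' (by simp [hx'])) [x] []
    have h2 := LusztigMove.context (LusztigMove.commOne (mv := mv) x ys (h x (by simp))) [] xs
    simp only [List.append_nil, List.nil_append, List.append_assoc, List.cons_append] at h1 h2 ⊢
    exact h1.trans h2

theorem far_aux (r : ZMod n) (i j : ℕ) (h1 : i + 2 ≤ j) (h2 : j + 2 ≤ n + i) :
    r + (j : ZMod n) ≠ r + i ∧ r + (j : ZMod n) ≠ r + i + 1 ∧ r + (i : ZMod n) ≠ r + j + 1 := by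
  have key : ∀ a b : ℕ, a < b → b < a + n → (a : ZMod n) ≠ b := by
    intro a b hab hb heq
    rw [ZMod.natCast_eq_natCast_iff] at heq
    have := (Nat.modEq_iff_dvd' hab.le).1 heq
    have := Nat.le_of_dvd (by omega) this
    omega
  refine ⟨fun h => key i j (by omega) (by omega) (add_left_cancel h).symm, fun h => ?_, fun h => ?_⟩
  · apply key (i + 1) j (by omega) (by omega)
    push_cast
    rw [add_assoc] at h
    exact (add_left_cancel h).symm
  · apply key i (j + 1) (by omega) (by omega)
    push_cast
    rw [add_assoc] at h
    exact add_left_cancel h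

theorem LusztigMove.chain {mv : R → R → R → R × R × R} (r : ZMod n) (m : R) (a c : ℕ → R) (K : ℕ)
    (hK : K + 2 ≤ n) :
    Relation.ReflTransGen (LusztigMove mv)
      (((List.range K).map fun (j : ℕ) => (r + (j : ZMod n) + 1, a j)).reverse ++ [(r, m)] ++
        (List.range K).map fun (j : ℕ) => (r + (j : ZMod n) + 1, c j))
      (((List.range K).map fun (j : ℕ) => (r + (j : ZMod n), (triple mv m a c j).1)) ++
        [(r + (K : ZMod n), mid mv m a c K)] ++
        ((List.range K).map fun (j : ℕ) => (r + (j : ZMod n), (triple mv m a c j).2.2)).reverse) := by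
  induction K with
  | zero => simpa [mid] using Relation.ReflTransGen.refl
  | succ K ih =>
    have h1 := LusztigMove.context (ih (by omega)) [(r + (K : ZMod n) + 1, a K)]
      [(r + (K : ZMod n) + 1, c K)]
    set P := (List.range K).map fun (j : ℕ) => (r + (j : ZMod n), (triple mv m a c j).1)
    set Q := ((List.range K).map fun (j : ℕ) =>
      (r + (j : ZMod n), (triple mv m a c j).2.2)).reverse with hQ
    have h2 : Relation.ReflTransGen (LusztigMove mv) ([(r + (K : ZMod n) + 1, a K)] ++ P)
        (P ++ [(r + (K : ZMod n) + 1, a K)]) := by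
      apply LusztigMove.commLists
      intro x hx y hy
      simp only [P, List.mem_map, List.mem_range, List.mem_singleton] at hx hy
      obtain ⟨j, hj, rfl⟩ := hy
      subst hx
      have := far_aux r j (K + 1) (by omega) (by omega)
      push_cast at this
      rw [← add_assoc] at this
      exact ⟨this.1.symm, this.2.2, this.2.1⟩
    have h3 : Relation.ReflTransGen (LusztigMove mv) (Q ++ [(r + (K : ZMod n) + 1, c K)])
        ([(r + (K : ZMod n) + 1, c K)] ++ Q) := by
      apply LusztigMove.commLists
      intro x hx y hy
      simp only [Q, List.mem_reverse, List.mem_map, List.mem_range, List.mem_singleton] at hx hy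
      obtain ⟨j, hj, rfl⟩ := hx
      subst hy
      have := far_aux r j (K + 1) (by omega) (by omega)
      push_cast at this
      rw [← add_assoc] at this
      exact this
    have h2' := LusztigMove.context h2 [] ([(r + (K : ZMod n), mid mv m a c K)] ++ Q ++
      [(r + (K : ZMod n) + 1, c K)])
    have h3' := LusztigMove.context h3 (P ++ [(r + (K : ZMod n) + 1, a K)] ++
      [(r + (K : ZMod n), mid mv m a c K)]) []
    have h4 := LusztigMove.down (mv := mv) P Q (r + (K : ZMod n)) (a K) (mid mv m a c K) (c K)
    simp only [List.range_succ, List.map_append, List.map_cons, List.map_nil,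
      List.reverse_append, List.reverse_cons, List.reverse_nil, List.nil_append,
      List.append_nil, List.append_assoc, List.cons_append, ← hQ]
      at h1 h2' h3' h4 ⊢
    refine h1.trans (h2'.trans (h3'.trans (Relation.ReflTransGen.single ?_)))
    simpa [P, triple, mid, Nat.cast_add, add_assoc] using h4

variable [Zero R]

/-- The chain of braid moves in `s_k(z_1) ⋯ s_1(z_k) s_0(z_{k+1}) s_1(y_1) ⋯ s_k(y_k)`:
the `j`-th move is applied to `s_{j+1}(z_{k-j}) s_j(middle) s_{j+1}(y_{j+1})`, `j = 0, …, k-1`. -/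
def lowTriple (mv : R → R → R → R × R × R) (k : ℕ) (z y : State n R) : ℕ → R × R × R :=
  triple mv (entry z (k + 1)) (fun j => entry z (k - j)) (fun j => entry y (j + 1))

/-- The middle letters of the previous chain. -/
def lowMid (mv : R → R → R → R × R × R) (k : ℕ) (z y : State n R) : ℕ → R :=
  mid mv (entry z (k + 1)) (fun j => entry z (k - j)) (fun j => entry y (j + 1))

/-- The chain of braid moves in
`s_{n-1}(z_{k+2}) ⋯ s_{k+2}(z_{n-1}) s_{k+1}(y_{k+1}) s_{k+2}(y_{k+2}) ⋯ s_{n-1}(y_{n-1})`: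
the `j`-th move is applied to `s_{k+2+j}(z_{n-1-j}) s_{k+1+j}(middle) s_{k+2+j}(y_{k+2+j})`,
`j = 0, …, n-k-3`. -/
def upTriple (mv : R → R → R → R × R × R) (k : ℕ) (z y : State n R) : ℕ → R × R × R :=
  triple mv (entry y (k + 1)) (fun j => entry z (n - 1 - j)) (fun j => entry y (k + 2 + j))

/-- The middle letters of the previous chain. -/
def upMid (mv : R → R → R → R × R × R) (k : ℕ) (z y : State n R) : ℕ → R :=
  mid mv (entry y (k + 1)) (fun j => entry z (n - 1 - j)) (fun j => entry y (k + 2 + j))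

/-- The map `(z, y) ↦ (y', z')` induced by moving `v = s_k s_{k-1} ⋯ s_0 s_{n-1} ⋯ s_{k+2}`
through `u = s_1 s_2 ⋯ s_{n-1}` by Lusztig moves (see `step_lusztig`). With `mv = geomMove` it is
`φ(n,k)`, with `mv = tropMove` it is `Φ(n,k)`. -/
def step (mv : R → R → R → R × R × R) (k : ℕ) (z y : State n R) : State n R × State n R :=
  (fun i =>
    let p := (i : ℕ) + 1
    if p ≤ k then (lowTriple mv k z y (p - 1)).1
    else if p = k + 1 then lowMid mv k z y k
    else (upTriple mv k z y (p - k - 2)).1,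
   fun i =>
    let p := (i : ℕ) + 1
    if p ≤ k then (lowTriple mv k z y (k - p)).2.2
    else if p = k + 1 then upMid mv k z y (n - 2 - k)
    else (upTriple mv k z y (n - 1 - p)).2.2)

/-- The word `ρ^r(u)`, i.e. `s_{1+r}(y_1) s_{2+r}(y_2) ⋯ s_{n-1+r}(y_{n-1})`. -/
def uWord (r : ZMod n) (y : State n R) : List (ZMod n × R) :=
  (List.range (n - 1)).map fun (j : ℕ) => ((j : ZMod n) + 1 + r, entry y (j + 1))

/-- The word `ρ^r(v)` with parameters `z`; the letter carrying `z_p` is `s_{k+1-p+r}`. -/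
def vWord (k : ℕ) (r : ZMod n) (z : State n R) : List (ZMod n × R) :=
  (List.range (n - 1)).map fun (j : ℕ) => ((k : ZMod n) - j + r, entry z (j + 1))

theorem entry_step_fst (mv : R → R → R → R × R × R) (k : ℕ) (z y : State n R) (p : ℕ)
    (hp : 1 ≤ p) (hp' : p ≤ n - 1) :
    entry (step mv k z y).1 p =
      if p ≤ k then (lowTriple mv k z y (p - 1)).1
      else if p = k + 1 then lowMid mv k z y k
      else (upTriple mv k z y (p - k - 2)).1 := by
  obtain ⟨q, rfl⟩ : ∃ q, p = q + 1 := ⟨p - 1, by omega⟩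
  rw [entry, dif_pos ⟨hp, hp'⟩]
  rfl

theorem entry_step_snd (mv : R → R → R → R × R × R) (k : ℕ) (z y : State n R) (p : ℕ)
    (hp : 1 ≤ p) (hp' : p ≤ n - 1) :
    entry (step mv k z y).2 p =
      if p ≤ k then (lowTriple mv k z y (k - p)).2.2
      else if p = k + 1 then upMid mv k z y (n - 2 - k)
      else (upTriple mv k z y (n - 1 - p)).2.2 := by
  obtain ⟨q, rfl⟩ : ∃ q, p = q + 1 := ⟨p - 1, by omega⟩
  rw [entry, dif_pos ⟨hp, hp'⟩]
  rfl

/-- The map `step` is the one given by the Lusztig relations: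
`v(z) · u(y) = ρ^{-1}(u)(y') · ρ^{-1}(v)(z')`. -/
theorem step_lusztig (mv : R → R → R → R × R × R) (k : ℕ) (hk : k + 2 ≤ n) (z y : State n R) :
    Relation.ReflTransGen (LusztigMove mv) (vWord k 0 z ++ uWord 0 y)
      (uWord (-1) (step mv k z y).1 ++ vWord k (-1) (step mv k z y).2) := by
  have low := LusztigMove.chain (n := n) (mv := mv) 0 (entry z (k + 1))
    (fun j => entry z (k - j)) (fun j => entry y (j + 1)) k (by omega)
  have up := LusztigMove.chain (n := n) (mv := mv) (0 + ((k : ZMod n) + 1)) (entry y (k + 1))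
    (fun j => entry z (n - 1 - j)) (fun j => entry y (k + 2 + j)) (n - 2 - k) (by omega)
  have hn0 : ((n : ℕ) : ZMod n) = 0 := ZMod.natCast_self n
  have hv : vWord k 0 z =
      ((List.range k).map fun (j : ℕ) => ((0 : ZMod n) + (j : ZMod n) + 1, entry z (k - j))).reverse
      ++ [((0 : ZMod n), entry z (k + 1))] ++
      ((List.range (n - 2 - k)).map fun (j : ℕ) =>
        ((0 : ZMod n) + ((k : ZMod n) + 1) + (j : ZMod n) + 1, entry z (n - 1 - j))).reverse := by
    apply List.ext_getElem
    · simp [vWord]; omega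
    · intro i h1 h2
      simp only [vWord, List.length_map, List.length_range] at h1
      rcases lt_trichotomy i k with hi | hi | hi
      · rw [List.getElem_append_left (by simp; omega), List.getElem_append_left (by simpa using hi)]
        simp only [vWord, List.getElem_map, List.getElem_range, List.getElem_reverse,
          List.length_map, List.length_range, Prod.mk.injEq]
        refine ⟨?_, by congr 1; omega⟩
        obtain ⟨d, rfl⟩ : ∃ d, k = i + 1 + d := ⟨k - i - 1, by omega⟩
        rw [show i + 1 + d - 1 - i = d by omega]
        push_cast; ring
      · subst hi
        rw [List.getElem_append_left (by simp), List.getElem_append_right (by simp)]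
        simp [vWord]
      · rw [List.getElem_append_right (by simp; omega)]
        simp only [vWord, List.getElem_map, List.getElem_range, List.getElem_reverse,
          List.length_map, List.length_range, List.length_append, List.length_reverse,
          List.length_singleton, Prod.mk.injEq]
        refine ⟨?_, by congr 1; omega⟩
        obtain ⟨d, hd⟩ : ∃ d, n = i + 2 + d := ⟨n - i - 2, by omega⟩
        rw [show n - 2 - k - 1 - (i - (k + 1)) = d by omega]
        have : (d : ZMod n) = - i - 2 := by
          have h := hn0
          rw [show ((n : ℕ) : ZMod n) = ((i + 2 + d : ℕ) : ZMod n) from congrArg _ hd] at h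
          push_cast at h
          linear_combination h
        rw [this]; ring
  have hu : uWord 0 y =
      ((List.range k).map fun (j : ℕ) => ((0 : ZMod n) + (j : ZMod n) + 1, entry y (j + 1)))
      ++ [((0 : ZMod n) + ((k : ZMod n) + 1), entry y (k + 1))] ++
      ((List.range (n - 2 - k)).map fun (j : ℕ) =>
        ((0 : ZMod n) + ((k : ZMod n) + 1) + (j : ZMod n) + 1, entry y (k + 2 + j))) := by
    apply List.ext_getElem
    · simp [uWord]; omega
    · intro i h1 h2
      simp only [uWord, List.length_map, List.length_range] at h1
      rcases lt_trichotomy i k with hi | hi | hi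
      · rw [List.getElem_append_left (by simp; omega), List.getElem_append_left (by simpa using hi)]
        simp [uWord]
      · subst hi
        rw [List.getElem_append_left (by simp), List.getElem_append_right (by simp)]
        simp [uWord]
      · rw [List.getElem_append_right (by simp; omega)]
        obtain ⟨d, rfl⟩ : ∃ d, i = k + 1 + d := ⟨i - k - 1, by omega⟩
        simp only [uWord, List.getElem_map, List.getElem_range, List.length_map, List.length_range,
          List.length_append, List.length_singleton, Prod.mk.injEq]
        rw [show k + 1 + d - (k + 1) = d by omega]
        refine ⟨?_, by congr 1; omega⟩
        push_cast; ring
  have hu' : uWord (-1) (step mv k z y).1 =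
      ((List.range k).map fun (j : ℕ) =>
        ((0 : ZMod n) + (j : ZMod n), (lowTriple mv k z y j).1))
      ++ [((0 : ZMod n) + (k : ZMod n), lowMid mv k z y k)] ++
      ((List.range (n - 2 - k)).map fun (j : ℕ) =>
        ((0 : ZMod n) + ((k : ZMod n) + 1) + (j : ZMod n), (upTriple mv k z y j).1)) := by
    apply List.ext_getElem
    · simp [uWord]; omega
    · intro i h1 h2
      simp only [uWord, List.length_map, List.length_range] at h1
      rcases lt_trichotomy i k with hi | hi | hi
      · rw [List.getElem_append_left (by simp; omega), List.getElem_append_left (by simpa using hi)]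
        simp only [uWord, List.getElem_map, List.getElem_range, Prod.mk.injEq]
        rw [entry_step_fst _ _ _ _ _ (by omega) (by omega), if_pos (by omega)]
        exact ⟨by ring, rfl⟩
      · subst hi
        rw [List.getElem_append_left (by simp), List.getElem_append_right (by simp)]
        simp only [uWord, List.getElem_map, List.getElem_range, Prod.mk.injEq,
          List.getElem_singleton]
        rw [entry_step_fst _ _ _ _ _ (by omega) (by omega), if_neg (by omega), if_pos rfl]
        exact ⟨by ring, rfl⟩
      · rw [List.getElem_append_right (by simp; omega)]
        obtain ⟨d, rfl⟩ : ∃ d, i = k + 1 + d := ⟨i - k - 1, by omega⟩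
        simp only [uWord, List.getElem_map, List.getElem_range, List.length_map, List.length_range,
          List.length_append, List.length_singleton, Prod.mk.injEq]
        rw [entry_step_fst _ _ _ _ _ (by omega) (by omega), if_neg (by omega), if_neg (by omega),
          show k + 1 + d - (k + 1) = d by omega, show k + 1 + d + 1 - k - 2 = d by omega]
        refine ⟨?_, rfl⟩
        push_cast; ring
  have hv' : vWord k (-1) (step mv k z y).2 =
      ((List.range k).map fun (j : ℕ) =>
        ((0 : ZMod n) + (j : ZMod n), (lowTriple mv k z y j).2.2)).reverse
      ++ [((0 : ZMod n) + ((k : ZMod n) + 1) + ((n - 2 - k : ℕ) : ZMod n),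
        upMid mv k z y (n - 2 - k))] ++
      ((List.range (n - 2 - k)).map fun (j : ℕ) =>
        ((0 : ZMod n) + ((k : ZMod n) + 1) + (j : ZMod n), (upTriple mv k z y j).2.2)).reverse := by
    apply List.ext_getElem
    · simp [vWord]; omega
    · intro i h1 h2
      simp only [vWord, List.length_map, List.length_range] at h1
      rcases lt_trichotomy i k with hi | hi | hi
      · rw [List.getElem_append_left (by simp; omega), List.getElem_append_left (by simpa using hi)]
        simp only [vWord, List.getElem_map, List.getElem_range, List.getElem_reverse,
          List.length_map, List.length_range, Prod.mk.injEq]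
        rw [entry_step_snd _ _ _ _ _ (by omega) (by omega), if_pos (by omega)]
        obtain ⟨d, rfl⟩ : ∃ d, k = i + 1 + d := ⟨k - i - 1, by omega⟩
        rw [show i + 1 + d - 1 - i = d by omega, show i + 1 + d - (i + 1) = d by omega]
        refine ⟨?_, rfl⟩
        push_cast; ring
      · subst hi
        rw [List.getElem_append_left (by simp), List.getElem_append_right (by simp)]
        simp only [vWord, List.getElem_map, List.getElem_range, Prod.mk.injEq,
          List.getElem_singleton]
        rw [entry_step_snd _ _ _ _ _ (by omega) (by omega), if_neg (by omega), if_pos rfl]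
        refine ⟨?_, rfl⟩
        obtain ⟨d, hd⟩ : ∃ d, n = i + 2 + d := ⟨n - i - 2, by omega⟩
        rw [show n - 2 - i = d by omega]
        have h := hn0
        rw [show ((n : ℕ) : ZMod n) = ((i + 2 + d : ℕ) : ZMod n) from congrArg _ hd] at h
        push_cast at h
        linear_combination -h
      · rw [List.getElem_append_right (by simp; omega)]
        obtain ⟨d, hd⟩ : ∃ d, n = i + 2 + d := ⟨n - i - 2, by omega⟩
        simp only [vWord, List.getElem_map, List.getElem_range, List.getElem_reverse,
          List.length_map, List.length_range, List.length_append, List.length_reverse,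
          List.length_singleton, Prod.mk.injEq]
        rw [entry_step_snd _ _ _ _ _ (by omega) (by omega), if_neg (by omega), if_neg (by omega),
          show n - 1 - (i + 1) = d by omega,
          show n - 2 - k - 1 - (i - (k + 1)) = d by omega]
        refine ⟨?_, rfl⟩
        have h := hn0
        rw [show ((n : ℕ) : ZMod n) = ((i + 2 + d : ℕ) : ZMod n) from congrArg _ hd] at h
        push_cast at h
        linear_combination -h
  rw [hv, hu, hu', hv']
  change Relation.ReflTransGen _ _
    (((List.range k).map fun (j : ℕ) => ((0 : ZMod n) + (j : ZMod n), (lowTriple mv k z y j).1))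
      ++ [((0 : ZMod n) + (k : ZMod n), lowMid mv k z y k)] ++
      ((List.range (n - 2 - k)).map fun (j : ℕ) => _) ++ _)
  change Relation.ReflTransGen _ _ (((List.range k).map fun (j : ℕ) =>
        ((0 : ZMod n) + (j : ZMod n), (lowTriple mv k z y j).1))
      ++ [((0 : ZMod n) + (k : ZMod n), lowMid mv k z y k)] ++
      ((List.range k).map fun (j : ℕ) =>
        ((0 : ZMod n) + (j : ZMod n), (lowTriple mv k z y j).2.2)).reverse) at low
  change Relation.ReflTransGen _ _ (((List.range (n - 2 - k)).map fun (j : ℕ) =>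
        ((0 : ZMod n) + ((k : ZMod n) + 1) + (j : ZMod n), (upTriple mv k z y j).1))
      ++ [((0 : ZMod n) + ((k : ZMod n) + 1) + ((n - 2 - k : ℕ) : ZMod n),
        upMid mv k z y (n - 2 - k))] ++
      ((List.range (n - 2 - k)).map fun (j : ℕ) =>
        ((0 : ZMod n) + ((k : ZMod n) + 1) + (j : ZMod n), (upTriple mv k z y j).2.2)).reverse) at up
  generalize hD1 : ((List.range k).map fun (j : ℕ) =>
    ((0 : ZMod n) + (j : ZMod n) + 1, entry z (k - j))).reverse = D1 at *
  generalize hA1 : ((List.range k).map fun (j : ℕ) =>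
    ((0 : ZMod n) + (j : ZMod n) + 1, entry y (j + 1))) = A1 at *
  generalize hD2 : ((List.range (n - 2 - k)).map fun (j : ℕ) =>
    ((0 : ZMod n) + ((k : ZMod n) + 1) + (j : ZMod n) + 1, entry z (n - 1 - j))).reverse = D2 at *
  generalize hA2 : ((List.range (n - 2 - k)).map fun (j : ℕ) =>
    ((0 : ZMod n) + ((k : ZMod n) + 1) + (j : ZMod n) + 1, entry y (k + 2 + j))) = A2 at *
  generalize hP1 : ((List.range k).map fun (j : ℕ) =>
    ((0 : ZMod n) + (j : ZMod n), (lowTriple mv k z y j).1)) = P1 at *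
  generalize hQ1 : ((List.range k).map fun (j : ℕ) =>
    ((0 : ZMod n) + (j : ZMod n), (lowTriple mv k z y j).2.2)).reverse = Q1 at *
  generalize hP2 : ((List.range (n - 2 - k)).map fun (j : ℕ) =>
    ((0 : ZMod n) + ((k : ZMod n) + 1) + (j : ZMod n), (upTriple mv k z y j).1)) = P2 at *
  generalize hQ2 : ((List.range (n - 2 - k)).map fun (j : ℕ) =>
    ((0 : ZMod n) + ((k : ZMod n) + 1) + (j : ZMod n), (upTriple mv k z y j).2.2)).reverse = Q2 at *
  have c1 : Relation.ReflTransGen (LusztigMove mv) (D2 ++ A1) (A1 ++ D2) := by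
    apply LusztigMove.commLists
    intro x hx w hw
    rw [← hD2] at hx
    rw [← hA1] at hw
    simp only [List.mem_reverse, List.mem_map, List.mem_range] at hx hw
    obtain ⟨j, hj, rfl⟩ := hx
    obtain ⟨j', hj', rfl⟩ := hw
    have := far_aux (0 : ZMod n) (j' + 1) (k + 1 + j + 1) (by omega) (by omega)
    push_cast at this
    simp only [← add_assoc] at this ⊢
    exact ⟨this.1.symm, this.2.2, this.2.1⟩
  have c2 : Relation.ReflTransGen (LusztigMove mv) (Q1 ++ P2) (P2 ++ Q1) := by
    apply LusztigMove.commLists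
    intro x hx w hw
    rw [← hQ1] at hx
    rw [← hP2] at hw
    simp only [List.mem_reverse, List.mem_map, List.mem_range] at hx hw
    obtain ⟨j, hj, rfl⟩ := hx
    obtain ⟨j', hj', rfl⟩ := hw
    have := far_aux (0 : ZMod n) j (k + 1 + j') (by omega) (by omega)
    push_cast at this
    simp only [← add_assoc] at this ⊢
    exact this
  generalize [((0 : ZMod n), entry z (k + 1))] = S0 at *
  generalize [((0 : ZMod n) + ((k : ZMod n) + 1), entry y (k + 1))] = S1 at *
  generalize [((0 : ZMod n) + (k : ZMod n), lowMid mv k z y k)] = M1 at *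
  generalize [((0 : ZMod n) + ((k : ZMod n) + 1) + ((n - 2 - k : ℕ) : ZMod n),
        upMid mv k z y (n - 2 - k))] = M2 at *
  have t1 := LusztigMove.context c1 (D1 ++ S0) (S1 ++ A2)
  have t2 := LusztigMove.context low [] (D2 ++ S1 ++ A2)
  have t3 := LusztigMove.context up (P1 ++ M1 ++ Q1) []
  have t4 := LusztigMove.context c2 (P1 ++ M1) (M2 ++ Q2)
  simp only [List.append_assoc, List.append_nil, List.nil_append] at t1 t2 t3 t4 ⊢
  exact t1.trans (t2.trans (t3.trans t4))

end Dynamics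

/-! ### The tropical dynamical system `Φ(n,k)` and its solitons -/

section Tropical

variable {n : ℕ}

/-- The vacuum state `W = (A_n, …, A_n)`. Indices of `A` are modulo `n`, so `A_n = A 0`. -/
def vacuum (A : ZMod n → ℝ) : State n ℝ := fun _ => A 0

/-- The initial carrier `Z = (A_k, …, A_1, A_n, A_{n-1}, …, A_{k+2})`, i.e. `Z_p = A_{k+1-p}`. -/
def initialCarrier (k : ℕ) (A : ZMod n → ℝ) : State n ℝ := fun i => A ((k : ZMod n) - (i : ℕ))

/-- The carriers `Z_0 = Z, Z_1, Z_2, …` met while `Z` is moved through the states `Y_0, Y_1, …`.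
(The `i`-th step uses the words `ρ^{-i}(v)`, `ρ^{-i}(u)`; the parameters change as for `i = 0`.) -/
def carrier (k : ℕ) (A : ZMod n → ℝ) (Y : ℕ → State n ℝ) : ℕ → State n ℝ
  | 0 => initialCarrier k A
  | i + 1 => (step tropMove k (carrier k A Y i) (Y i)).2

/-- One time step of `Φ(n,k)`. -/
def evolve (k : ℕ) (A : ZMod n → ℝ) (Y : ℕ → State n ℝ) : ℕ → State n ℝ :=
  fun i => (step tropMove k (carrier k A Y i) (Y i)).1

/-- The configuration consisting of `b` vacuum states, then `X_1, …, X_M`, then vacuum states. -/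
def placed (A : ZMod n → ℝ) (b : ℕ) (X : List (State n ℝ)) : ℕ → State n ℝ :=
  fun i => if i < b then vacuum A else X.getD (i - b) (vacuum A)

/-- After `a` time steps the input `X_1, …, X_M, W, W, …` is moved `b` places to the right. -/
def Recovers (k : ℕ) (A : ZMod n → ℝ) (X : List (State n ℝ)) (a b : ℕ) : Prop :=
  (evolve k A)^[a] (placed A 0 X) = placed A b X

/-- One-solitons of `Φ(n,k)`. -/
structure IsOneSoliton (k : ℕ) (A : ZMod n → ℝ) (X : List (State n ℝ)) : Prop where
  ne_nil : X ≠ []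
  ne_vacuum : ∀ s ∈ X, s ≠ vacuum A
  moves : ∃ a b : ℕ, 0 < a ∧ 0 < b ∧ Recovers k A X a b
  final_carrier : ∀ t : ℕ, ∀ᶠ i in atTop,
    carrier k A ((evolve k A)^[t] (placed A 0 X)) i = initialCarrier k A

/-- The velocity is `b / a`, where `a` is the least positive number of time steps after which the
initial sequence reappears, and `b` is the distance travelled in that time. -/
def HasVelocity (k : ℕ) (A : ZMod n → ℝ) (X : List (State n ℝ)) (r : ℝ) : Prop :=
  ∃ a b : ℕ, 0 < a ∧ Recovers k A X a b ∧
    (∀ a' b' : ℕ, 0 < a' → Recovers k A X a' b' → a ≤ a') ∧ r = b / a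

/-- All non-vacuum states of the configuration lie in a window of `m` consecutive places. -/
def FitsIn (A : ZMod n → ℝ) (Y : ℕ → State n ℝ) (m : ℕ) : Prop :=
  ∃ s : ℕ, ∀ i, Y i ≠ vacuum A → s ≤ i ∧ i < s + m

/-- The minimal lattice length occupied in propagation. -/
def HasMinimalLength (k : ℕ) (A : ZMod n → ℝ) (X : List (State n ℝ)) (m : ℕ) : Prop :=
  IsLeast {m : ℕ | ∃ t : ℕ, FitsIn A ((evolve k A)^[t] (placed A 0 X)) m} m

/-- `X` is a positive one-soliton (all of its states are bigger than the vacuum: `≥` in every entry,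
and not equal), written in its minimal form, i.e. at a time when its length is minimal. -/
structure IsMinimalForm (k : ℕ) (A : ZMod n → ℝ) (X : List (State n ℝ)) : Prop where
  soliton : IsOneSoliton k A X
  positive : ∀ s ∈ X, vacuum A < s
  minimal : HasMinimalLength k A X X.length

end Tropical

/-! ### Puiseux series -/

section Puiseux

/-- The embedding of exponents `m ↦ m / N`. -/
def rootExp (N : ℕ+) : ℤ →+ ℚ where
  toFun m := (m : ℚ) / (N : ℕ)
  map_zero' := by simp
  map_add' a b := by push_cast; ring

theorem rootExp_le_iff (N : ℕ+) (a b : ℤ) : rootExp N a ≤ rootExp N b ↔ a ≤ b := by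
  have hN : (0 : ℚ) < (N : ℕ) := by exact_mod_cast N.pos
  change (a : ℚ) / (N : ℕ) ≤ (b : ℚ) / (N : ℕ) ↔ a ≤ b
  rw [div_le_div_iff_of_pos_right hN]
  exact Int.cast_le

theorem rootExp_injective (N : ℕ+) : Function.Injective (rootExp N) := fun a b h =>
  le_antisymm ((rootExp_le_iff N a b).1 h.le) ((rootExp_le_iff N b a).1 h.ge)

/-- The field `ℂ((t^{1/N}))`, as the image of `ℂ((t))` under `t ↦ t^{1/N}`. -/
noncomputable def laurentRoot (N : ℕ+) : Subfield (HahnSeries ℚ ℂ) :=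
  (HahnSeries.embDomainRingHom (R := ℂ) (rootExp N) (rootExp_injective N)
    (rootExp_le_iff N)).fieldRange

theorem mem_laurentRoot {N : ℕ+} {x : HahnSeries ℚ ℂ} :
    x ∈ laurentRoot N ↔ ∀ q ∈ x.support, ∃ m : ℤ, q = m / (N : ℕ) := by
  constructor
  · rintro ⟨f, rfl⟩ q hq
    obtain ⟨m, -, rfl⟩ := HahnSeries.support_embDomain_subset hq
    exact ⟨m, rfl⟩
  · intro h
    have hpwo : (Function.support fun m : ℤ => x.coeff (rootExp N m)).IsPWO := by
      have h1 : (Function.support fun m : ℤ => x.coeff (rootExp N m)).IsWF := by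
        have h2 : x.support.IsWF := x.isWF_support
        rw [Set.isWF_iff_no_descending_seq] at h2 ⊢
        intro f hf hmem
        refine h2 (fun i => rootExp N (f i)) (fun a b hab => ?_) fun i => hmem i
        exact lt_of_le_not_ge ((rootExp_le_iff N _ _).2 (hf hab).le)
          fun hc => absurd ((rootExp_le_iff N _ _).1 hc) (not_le.2 (hf hab))
      exact h1.isPWO
    refine ⟨⟨fun m => x.coeff (rootExp N m), hpwo⟩, ?_⟩
    ext q
    by_cases hq : ∃ m : ℤ, q = rootExp N m
    · obtain ⟨m, rfl⟩ := hq
      exact HahnSeries.embDomain_coeff (f := ⟨⟨rootExp N, rootExp_injective N⟩, rootExp_le_iff N _ _⟩)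
    · have h0 : x.coeff q = 0 := by
        by_contra hne
        exact hq (h q hne)
      rw [h0]
      exact HahnSeries.embDomain_of_notMem_range
        (f := ⟨⟨rootExp N, rootExp_injective N⟩, rootExp_le_iff N _ _⟩)
        (by rintro ⟨m, rfl⟩; exact hq ⟨m, rfl⟩)

/-- The field `K = ⋃_N ℂ((t^{1/N}))` of Puiseux series over `ℂ`. -/
noncomputable def puiseux : Subfield (HahnSeries ℚ ℂ) := ⨆ N : ℕ+, laurentRoot N

theorem mem_puiseux {x : HahnSeries ℚ ℂ} : x ∈ puiseux ↔ ∃ N : ℕ+, x ∈ laurentRoot N := by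
  refine Subfield.mem_iSup_of_directed ?_
  intro N M
  have aux : ∀ N M : ℕ+, laurentRoot N ≤ laurentRoot (N * M) := by
    intro N M x hx
    rw [mem_laurentRoot] at hx ⊢
    intro q hq
    obtain ⟨m, rfl⟩ := hx q hq
    refine ⟨m * (M : ℕ), ?_⟩
    have hM : ((M : ℕ) : ℚ) ≠ 0 := by exact_mod_cast M.pos.ne'
    have hN : ((N : ℕ) : ℚ) ≠ 0 := by exact_mod_cast N.pos.ne'
    push_cast
    field_simp
  exact ⟨N * M, aux N M, by rw [mul_comm]; exact aux M N⟩

/-- The valuation `K → ℝ ∪ {∞}`: the least exponent, and `∞` at `0`. -/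
noncomputable def val (x : puiseux) : WithTop ℝ :=
  (x : HahnSeries ℚ ℂ).orderTop.map fun q : ℚ => (q : ℝ)

/-- The valuation as a real number; only used at nonzero arguments. -/
noncomputable def valR (x : puiseux) : ℝ := (val x).untopD 0

end Puiseux

/-! ### Tau functions and their dynamical variables -/

section Tau

variable {n : ℕ}

/-- The unit vector `e_j` of `ℤ^n`, with `j` modulo `n`. -/
def e (j : ZMod n) : ZMod n → ℤ := Pi.single j 1

/-- `e_{[1,p]} = e_1 + ⋯ + e_p`. -/
def eI (p : ℕ) : ZMod n → ℤ := ∑ j ∈ Finset.Icc 1 p, e (j : ZMod n)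

/-- `τ^{i,t}(S) = τ(S + i κ(ρ^{n-1}(u)) - t κ(v))` with `κ(ρ^{n-1}(u)) = -e_n`,
`κ(v) = e_{k+1}`. -/
def shiftTau {R : Type*} (k : ℕ) (τ : (ZMod n → ℤ) → R) (i t : ℤ) (S : ZMod n → ℤ) : R :=
  τ (S - i • e 0 - t • e ((k : ZMod n) + 1))

/-- The wire index attached to the carrier entry `z_p`: `k+1-p` for `p ≤ k`, and `n+1-(p-k)` for
`k + 1 ≤ p ≤ n - 1`. -/
def wire (n k p : ℕ) : ℕ := if p ≤ k then k + 1 - p else n + k + 1 - p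

/-- The states `y_i^t` of `φ(n,k)` given by a tau function. -/
def geomY {K : Type*} [Field K] (k : ℕ) (α : ZMod n → K) (τ : (ZMod n → ℤ) → K) (i t : ℤ) :
    State n K := fun j =>
  let p := (j : ℕ) + 1
  let T := shiftTau k τ i t
  let f : ZMod n → ℤ := e ((k : ZMod n) + 1)
  (α 0 - α p) * (T (f + eI p) * T (f - e 0 + eI (p - 1))) /
    (T (f + eI (p - 1)) * T (f - e 0 + eI p))

/-- The carriers `z_i^t` of `φ(n,k)` given by a tau function. -/
def geomZ {K : Type*} [Field K] (k : ℕ) (α : ZMod n → K) (τ : (ZMod n → ℤ) → K) (i t : ℤ) :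
    State n K := fun j =>
  let q := wire n k ((j : ℕ) + 1)
  let T := shiftTau k τ i t
  let f : ZMod n → ℤ := e ((k : ZMod n) + 1)
  (α q - α ((k : ZMod n) + 1)) * (T (f + eI q) * T (eI (q - 1))) /
    (T (eI q) * T (f + eI (q - 1)))

/-- The tropicalization of `geomY`. -/
def tropY (k : ℕ) (A : ZMod n → ℝ) (T : (ZMod n → ℤ) → ℝ) (i t : ℤ) : State n ℝ := fun j =>
  let p := (j : ℕ) + 1
  let T' := shiftTau k T i t
  let f : ZMod n → ℤ := e ((k : ZMod n) + 1)
  A 0 + T' (f + eI p) + T' (f - e 0 + eI (p - 1)) - T' (f + eI (p - 1)) - T' (f - e 0 + eI p)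

/-- The tropicalization of `geomZ`. -/
def tropZ (k : ℕ) (A : ZMod n → ℝ) (T : (ZMod n → ℤ) → ℝ) (i t : ℤ) : State n ℝ := fun j =>
  let q := wire n k ((j : ℕ) + 1)
  let T' := shiftTau k T i t
  let f : ZMod n → ℤ := e ((k : ZMod n) + 1)
  A q + T' (f + eI q) + T' (eI (q - 1)) - T' (eI q) - T' (f + eI (q - 1))

/-- A family of states `y_i^t` and carriers `z_i^t` (`i, t ∈ ℤ`) that follows the dynamics
`(z_i^t, y_i^t) ↦ (y_i^{t+1}, z_{i+1}^t)`. -/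
def IsSolution {R : Type*} [Zero R] (mv : R → R → R → R × R × R) (k : ℕ)
    (y z : ℤ → ℤ → State n R) : Prop :=
  ∀ i t : ℤ, step mv k (z i t) (y i t) = (y i (t + 1), z (i + 1) t)

/-- The vacuum state `w = (α_n - α_1, …, α_n - α_{n-1})` of `φ(n,k)`. -/
def geomVacuum {K : Type*} [Field K] (α : ZMod n → K) : State n K :=
  fun j => α 0 - α (((j : ℕ) + 1 : ℕ) : ZMod n)

/-- The initial carrier of `φ(n,k)`, with entries `z_p = α_{k+1-p} - α_{k+1}`. -/
def geomCarrier {K : Type*} [Field K] (k : ℕ) (α : ZMod n → K) : State n K :=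
  fun j => α ((k : ZMod n) - (j : ℕ)) - α ((k : ZMod n) + 1)

variable [NeZero n]

/-- `B_j = (b - α_j) / (c - α_j)`. -/
def solitonB {K : Type*} [Field K] (α : ZMod n → K) (b c : K) (j : ZMod n) : K :=
  (b - α j) / (c - α j)

/-- The geometric one-soliton tau function `τ(S) = 1 + ℓ B_1^{s_1} ⋯ B_n^{s_n}`. -/
def solitonTau {K : Type*} [Field K] (α : ZMod n → K) (b c ℓ : K) (S : ZMod n → ℤ) : K :=
  1 + ℓ * ∏ j, solitonB α b c j ^ S j

/-- The tropical tau function `T(S) = min[0, L + S · W]`. -/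
def tropTau (L : ℝ) (W : ZMod n → ℝ) (S : ZMod n → ℤ) : ℝ := min 0 (L + ∑ j, (S j : ℝ) * W j)

/-- The tropicalization of `solitonTau` through the valuation of Puiseux series. -/
noncomputable def tropSolitonTau (α : ZMod n → puiseux) (b c ℓ : puiseux) :
    (ZMod n → ℤ) → ℝ :=
  tropTau (valR ℓ) fun j => valR (solitonB α b c j)

/-- The states of the geometric one-soliton solution of `φ(n,k)`. -/
def solY {K : Type*} [Field K] (k : ℕ) (α : ZMod n → K) (b c ℓ : K) : ℤ → ℤ → State n K :=
  geomY k α (solitonTau α b c ℓ)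

/-- The carriers of the geometric one-soliton solution of `φ(n,k)`. -/
def solZ {K : Type*} [Field K] (k : ℕ) (α : ZMod n → K) (b c ℓ : K) : ℤ → ℤ → State n K :=
  geomZ k α (solitonTau α b c ℓ)

/-- The states of the tropicalized one-soliton solution. -/
noncomputable def tropSolY (k : ℕ) (A : ZMod n → ℝ) (α : ZMod n → puiseux) (b c ℓ : puiseux) :
    ℤ → ℤ → State n ℝ :=
  tropY k A (tropSolitonTau α b c ℓ)

/-- The carriers of the tropicalized one-soliton solution. -/
noncomputable def tropSolZ (k : ℕ) (A : ZMod n → ℝ) (α : ZMod n → puiseux) (b c ℓ : puiseux) :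
    ℤ → ℤ → State n ℝ :=
  tropZ k A (tropSolitonTau α b c ℓ)

/-- The data of a geometric one-soliton solution over the Puiseux field: wire parameters `α_i` with
`val(α_i) = A_i`, and `b, c, ℓ` with `∏(b - α_i) = ∏(c - α_i)`, `ℓ ≠ 0`, and
`A_{i_p} ≤ val(b) < val(c) < A_{i_{p+1}}` for two consecutive members of the increasing ordering
`A_{i_1} ≤ ⋯ ≤ A_{i_n}`, where `i_1 = n`, `i_n = k + 1`. -/
structure IsSolitonData (k : ℕ) (A : ZMod n → ℝ) (α : ZMod n → puiseux) (b c ℓ : puiseux) :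
    Prop where
  val_α : ∀ i, val (α i) = (A i : WithTop ℝ)
  curve : ∏ i, (b - α i) = ∏ i, (c - α i)
  ℓ_ne_zero : ℓ ≠ 0
  b_lt_c : val b < val c
  lower : (A 0 : WithTop ℝ) ≤ val b
  upper : val c < (A ((k : ZMod n) + 1) : WithTop ℝ)
  gap : ∀ i, (A i : WithTop ℝ) ≤ val b ∨ val c < (A i : WithTop ℝ)

end Tau

end SolitonCA

namespace SolitonCA

/-! ### A time step expressed through the middle letters of its braid moves -/

section StepOfMoves

variable {R : Type*} [Zero R] {n : ℕ}

/-! A time step is two chains of braid moves, so it is known once the parameters `M 0, …, M (n - 1)`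
of the middle letters are known. Write `f = e_{k+1}`, and let `P q, F q, E q, G q` be the values of
a tau function at `e_{[1,q]}`, `f + e_{[1,q]}`, `e_{[1,q]} - e_n`, `f - e_n + e_{[1,q]}`. With
states and carriers given by the tau function, the middle letters are `M q = (α_n - α_{k+1}) F q E q
/ (P q G q)`. Two of the three outputs of a braid move then agree by cancellation of factors; the
third, the new middle letter as a sum, is a three-term bilinear identity for `τ`. The ends of the
chains match because `τ` is invariant under `e_1 + ⋯ + e_n`.

For `τ = 1 + ℓ B^S` the bilinear identity is checked power by power in `ℓ`. Periodicity says `∏ B_j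
= 1`, which is the curve equation for `b` and `c`.

The tropical statement is not deduced from the geometric one, since `val τ` may exceed `T`. For `T =
min[0, L + S·W]` the min-plus bilinear identity is proved directly from inequalities on `W`
(`IsSolitonWeight`). There are two cases: a wire above `c` has `W_p = W_{k+1} = -δ`, where `T` is
monotone and Lipschitz; a wire below `b` forces `W_n = 0`, where `T` is concave. In the second case
the states do not see `W` at all and equal the vacuum.

If `val c` lies below every `A_i` with `i ≠ n`, all weights except `W_n` equal `-δ`. As the weights
add up to zero, `W_n = (n - 1) δ`, and this forces `val b = A_n`. Then `T` depends on one integer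
only. When the entries of all states are strung together, `y_{i,p}` at position `(n-1) i + p`, the
configuration is a fixed finitely supported profile `bump` that advances by one position per time
step. Recurrence, its minimal time and the velocity follow. If `L` is an integer multiple of `δ`,
the profile is a block of `n - 1` entries of height `δ`, which at one moment fills exactly the state
at place `0`. This needs no Puiseux series and so works for real `x`.

For existence take `c = t^x`. Hensel's lemma gives a root `b = α_n (1 + ε)` of the curve equation.
With `ℓ = (c/b)^n`, a monomial `ℓ B^S` of valuation `0` has leading coefficient `1`, so it cannot
cancel against the constant `1`. -/

theorem entry_mk {n : ℕ} (f : ℕ → R) (p : ℕ) (h1 : 1 ≤ p) (h2 : p ≤ n - 1) :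
    entry (n := n) (fun j => f ((j : ℕ) + 1)) p = f p := by
  rw [entry, dif_pos ⟨h1, h2⟩]
  simp only
  congr 1
  omega

theorem state_ext_entry {y y' : State n R}
    (h : ∀ p, 1 ≤ p → p ≤ n - 1 → entry y p = entry y' p) : y = y' := by
  funext i
  have hi := i.isLt
  have := h (i + 1) (by omega) (by omega)
  rw [entry, entry, dif_pos ⟨by omega, by omega⟩, dif_pos ⟨by omega, by omega⟩] at this
  exact this

/-- The dynamical step is determined by the successive parameters `M 0, …, M (n - 1)` of the middle
letters of the two chains of braid moves. -/
theorem step_eq_of_moves {mv : R → R → R → R × R × R} {k : ℕ} (hk : k + 2 ≤ n)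
    {z y y' z' : State n R} {M : ℕ → R}
    (h0 : entry z (k + 1) = M 0) (h1 : entry y (k + 1) = M (k + 1))
    (hm : ∀ q, 1 ≤ q → q ≤ n - 1 → q ≠ k + 1 →
      mv (entry z (wire n k q)) (M (q - 1)) (entry y q)
        = (entry y' q, M q, entry z' (wire n k q)))
    (h2 : entry y' (k + 1) = M k) (h3 : entry z' (k + 1) = M (n - 1)) :
    step mv k z y = (y', z') := by
  have wlow : ∀ q, q ≤ k → wire n k q = k + 1 - q := fun q h => if_pos h
  have wup : ∀ q, k < q → wire n k q = n + k + 1 - q := fun q h => if_neg (by omega)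
  have low : ∀ j, j ≤ k → lowMid mv k z y j = M j := by
    intro j
    induction j with
    | zero => intro _; exact h0
    | succ j ih =>
      intro hj
      change (mv (entry z (k - j)) (lowMid mv k z y j) (entry y (j + 1))).2.1 = _
      have := hm (j + 1) (by omega) (by omega) (by omega)
      rw [wlow _ hj, show k + 1 - (j + 1) = k - j by omega, Nat.add_sub_cancel] at this
      rw [ih (by omega), this]
  -- The upper chain begins with the letter `s_{k+1}(y_{k+1})` as its middle letter, hence the
  -- offset `k + 1` in `M`.
  have up : ∀ j, j ≤ n - 2 - k → upMid mv k z y j = M (k + 1 + j) := by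
    intro j
    induction j with
    | zero => intro _; exact h1
    | succ j ih =>
      intro hj
      change (mv (entry z (n - 1 - j)) (upMid mv k z y j) (entry y (k + 2 + j))).2.1 = _
      have := hm (k + 2 + j) (by omega) (by omega) (by omega)
      rw [wup _ (by omega), show n + k + 1 - (k + 2 + j) = n - 1 - j by omega,
        show k + 2 + j - 1 = k + 1 + j by omega] at this
      rw [ih (by omega), this, show k + 1 + (j + 1) = k + 2 + j by omega]
  have lowT : ∀ q, 1 ≤ q → q ≤ k →
      lowTriple mv k z y (q - 1) = (entry y' q, M q, entry z' (k + 1 - q)) := by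
    intro q hq hqk
    obtain ⟨j, rfl⟩ : ∃ j, q = j + 1 := ⟨q - 1, by omega⟩
    change mv (entry z (k - j)) (lowMid mv k z y j) (entry y (j + 1)) = _
    have := hm (j + 1) (by omega) (by omega) (by omega)
    rw [wlow _ hqk, show k + 1 - (j + 1) = k - j by omega, Nat.add_sub_cancel] at this
    rw [low _ (by omega), this, show k + 1 - (j + 1) = k - j by omega]
  have upT : ∀ j, j + k + 2 ≤ n - 1 →
      upTriple mv k z y j = (entry y' (k + 2 + j), M (k + 2 + j), entry z' (n - 1 - j)) := by
    intro j hj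
    change mv (entry z (n - 1 - j)) (upMid mv k z y j) (entry y (k + 2 + j)) = _
    have := hm (k + 2 + j) (by omega) (by omega) (by omega)
    rw [wup _ (by omega), show n + k + 1 - (k + 2 + j) = n - 1 - j by omega,
      show k + 2 + j - 1 = k + 1 + j by omega] at this
    rw [up _ (by omega), this]
  refine Prod.ext (state_ext_entry fun p hp hp' => ?_) (state_ext_entry fun p hp hp' => ?_)
  · rw [entry_step_fst _ _ _ _ _ hp hp']
    split_ifs with c1 c2
    · rw [lowT p hp c1]
    · rw [low k le_rfl, c2, h2]
    · rw [upT _ (by omega), show k + 2 + (p - k - 2) = p by omega]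
  · rw [entry_step_snd _ _ _ _ _ hp hp']
    split_ifs with c1 c2
    · rw [show k - p = (k + 1 - p) - 1 by omega, lowT _ (by omega) (by omega),
        show k + 1 - (k + 1 - p) = p by omega]
    · rw [up _ le_rfl, c2, h3, show k + 1 + (n - 2 - k) = n - 1 by omega]
    · rw [upT _ (by omega), show n - 1 - (n - 1 - p) = p by omega]

end StepOfMoves

/-! ### From bilinear identities to one time step -/

section Bilinear

variable {n k : ℕ}

/-- The values of a tau function along the two interfaces of a dynamical step, with the relations
that express its periodicity and the coincidences of lattice points. -/
structure Interface {R : Type*} (n k : ℕ) (P F E G : ℕ → R) : Prop where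
  E_top : E n = P (n - 1)
  G_top : G n = F (n - 1)
  P_mid : P (k + 1) = F k
  E_mid : E (k + 1) = G k
  P_per : P n = P 0
  F_per : F n = F 0
  E_per : E 0 = P (n - 1)
  G_per : G 0 = F (n - 1)

theorem wire_wire {q : ℕ} (hk : k + 2 ≤ n) (h1 : 1 ≤ q) (h2 : q ≤ n - 1) (hq : q ≠ k + 1) :
    wire n k (wire n k q) = q := by
  unfold wire
  split_ifs <;> omega

/-- The value `q = k + 1` is special: its wire is `n`, and `y_{k+1}`, `z_{k+1}` are the initial
middle letters, not outer letters of a move. -/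
theorem wire_mem {q : ℕ} (hk : k + 2 ≤ n) (h1 : 1 ≤ q) (h2 : q ≤ n - 1) (hq : q ≠ k + 1) :
    1 ≤ wire n k q ∧ wire n k q ≤ n - 1 := by
  unfold wire
  split_ifs <;> omega

/-- In each move the relation `a + c = M q` is the bilinear identity divided by a product of tau
values. The two other outputs, of the form `M (q-1) c / M q` and `a M (q-1) / M q`, are cross-ratios
in which everything unwanted cancels. -/
theorem step_geomMove_of_bilinear {K : Type*} [Field K] (hk : k + 2 ≤ n) {P F E G α : ℕ → K}
    {αf : K} (hI : Interface n k P F E G) (hα : α (k + 1) = αf)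
    (hP : ∀ q, P q ≠ 0) (hF : ∀ q, F q ≠ 0) (hE : ∀ q, E q ≠ 0) (hG : ∀ q, G q ≠ 0)
    (h0f : α n ≠ αf)
    (hb : ∀ q, q + 1 ≤ n - 1 → (α (q + 1) - αf) * P q * G (q + 1) +
      (α n - α (q + 1)) * G q * P (q + 1) = (α n - αf) * E (q + 1) * F q) :
    step geomMove k
      (fun j : Fin (n - 1) => (α (wire n k (j + 1)) - αf) *
        (F (wire n k (j + 1)) * P (wire n k (j + 1) - 1)) /
        (P (wire n k (j + 1)) * F (wire n k (j + 1) - 1)))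
      (fun j : Fin (n - 1) => (α n - α (j + 1)) * (F (j + 1) * G (j + 1 - 1)) /
        (F (j + 1 - 1) * G (j + 1))) =
      (fun j : Fin (n - 1) => (α n - α (j + 1)) * (P (j + 1) * E (j + 1 - 1)) /
        (P (j + 1 - 1) * E (j + 1)),
       fun j : Fin (n - 1) => (α (wire n k (j + 1)) - αf) *
        (G (wire n k (j + 1)) * E (wire n k (j + 1) - 1)) /
        (E (wire n k (j + 1)) * G (wire n k (j + 1) - 1))) := by
  have hw : wire n k (k + 1) = n := by unfold wire; rw [if_neg (by omega)]; omega
  have ez : ∀ p, 1 ≤ p → p ≤ n - 1 → _ := entry_mk (n := n) (fun p => (α (wire n k p) - αf) *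
    (F (wire n k p) * P (wire n k p - 1)) / (P (wire n k p) * F (wire n k p - 1)))
  have ey : ∀ p, 1 ≤ p → p ≤ n - 1 → _ := entry_mk (n := n) (fun p => (α n - α p) *
    (F p * G (p - 1)) / (F (p - 1) * G p))
  have ey' : ∀ p, 1 ≤ p → p ≤ n - 1 → _ := entry_mk (n := n) (fun p => (α n - α p) *
    (P p * E (p - 1)) / (P (p - 1) * E p))
  have ez' : ∀ p, 1 ≤ p → p ≤ n - 1 → _ := entry_mk (n := n) (fun p => (α (wire n k p) - αf) *
    (G (wire n k p) * E (wire n k p - 1)) / (E (wire n k p) * G (wire n k p - 1)))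
  have h0f' : α n - αf ≠ 0 := sub_ne_zero.2 h0f
  -- The cross-ratio is forced by the data: `M 0` has to be `z_{k+1}`, `M (k+1)` has to be
  -- `y_{k+1}`, and `M k`, `M (n-1)` have to be the outgoing `y'_{k+1}`, `z'_{k+1}`. The relations
  -- in `Interface` make these four agree.
  refine step_eq_of_moves hk (M := fun q => (α n - αf) * (F q * E q) / (P q * G q)) ?_ ?_ ?_ ?_ ?_
  · rw [ez _ (by omega) (by omega), hw, hI.P_per, hI.F_per, hI.E_per, hI.G_per]
  · rw [ey _ (by omega) (by omega), hI.P_mid, hI.E_mid, hα, Nat.add_sub_cancel]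
  · intro q h1 h2 hq
    obtain ⟨w1, w2⟩ := wire_mem hk h1 h2 hq
    rw [ez _ w1 w2, ey _ h1 h2, ey' _ h1 h2, ez' _ w1 w2]
    simp only [wire_wire hk h1 h2 hq]
    obtain ⟨j, rfl⟩ : ∃ j, q = j + 1 := ⟨q - 1, by omega⟩
    simp only [Nat.add_sub_cancel]
    have hs : (α (j + 1) - αf) * (F (j + 1) * P j) / (P (j + 1) * F j) +
        (α n - α (j + 1)) * (F (j + 1) * G j) / (F j * G (j + 1)) =
        (α n - αf) * (F (j + 1) * E (j + 1)) / (P (j + 1) * G (j + 1)) := by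
      rw [div_add_div _ _ (mul_ne_zero (hP _) (hF _)) (mul_ne_zero (hF _) (hG _)),
        div_eq_div_iff (mul_ne_zero (mul_ne_zero (hP _) (hF _)) (mul_ne_zero (hF _) (hG _)))
          (mul_ne_zero (hP _) (hG _))]
      linear_combination F (j + 1) * F j * P (j + 1) * G (j + 1) * hb j h2
    have := hP j; have := hP (j + 1); have := hF j; have := hF (j + 1)
    have := hE j; have := hE (j + 1); have := hG j; have := hG (j + 1)
    unfold geomMove
    rw [hs]
    refine Prod.ext ?_ (Prod.ext rfl ?_)
    · change _ / _ = _
      field_simp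
    · change _ / _ = _
      field_simp
  · rw [ey' _ (by omega) (by omega), hI.P_mid, hI.E_mid, hα, Nat.add_sub_cancel]
  · rw [ez' _ (by omega) (by omega), hw, hI.E_top, hI.G_top]

/-- The same argument in min-plus form. The index `q = k` has to be left out: geometrically the
coefficient `α_{k+1} - αf` is zero there, of valuation `∞`, while `A (k + 1)` is finite. -/
theorem step_tropMove_of_bilinear (hk : k + 2 ≤ n) {P F E G A : ℕ → ℝ}
    (hI : Interface n k P F E G)
    (hb : ∀ q, q + 1 ≤ n - 1 → q ≠ k → min (A (q + 1) + P q + G (q + 1))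
      (A n + G q + P (q + 1)) = A n + E (q + 1) + F q) :
    step tropMove k
      (fun j : Fin (n - 1) => A (wire n k (j + 1)) +
        F (wire n k (j + 1)) + P (wire n k (j + 1) - 1) -
        P (wire n k (j + 1)) - F (wire n k (j + 1) - 1))
      (fun j : Fin (n - 1) => A n + F (j + 1) + G (j + 1 - 1) -
        F (j + 1 - 1) - G (j + 1)) =
      (fun j : Fin (n - 1) => A n + P (j + 1) + E (j + 1 - 1) -
        P (j + 1 - 1) - E (j + 1),
       fun j : Fin (n - 1) => A (wire n k (j + 1)) +
        G (wire n k (j + 1)) + E (wire n k (j + 1) - 1) -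
        E (wire n k (j + 1)) - G (wire n k (j + 1) - 1)) := by
  have hw : wire n k (k + 1) = n := by unfold wire; rw [if_neg (by omega)]; omega
  have ez : ∀ p, 1 ≤ p → p ≤ n - 1 → _ := entry_mk (n := n) (fun p => A (wire n k p) +
    F (wire n k p) + P (wire n k p - 1) - P (wire n k p) - F (wire n k p - 1))
  have ey : ∀ p, 1 ≤ p → p ≤ n - 1 → _ := entry_mk (n := n) (fun p => A n +
    F p + G (p - 1) - F (p - 1) - G p)
  have ey' : ∀ p, 1 ≤ p → p ≤ n - 1 → _ := entry_mk (n := n) (fun p => A n +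
    P p + E (p - 1) - P (p - 1) - E p)
  have ez' : ∀ p, 1 ≤ p → p ≤ n - 1 → _ := entry_mk (n := n) (fun p => A (wire n k p) +
    G (wire n k p) + E (wire n k p - 1) - E (wire n k p) - G (wire n k p - 1))
  refine step_eq_of_moves hk (M := fun q => A n + F q + E q - P q - G q) ?_ ?_ ?_ ?_ ?_
  · rw [ez _ (by omega) (by omega), hw, hI.P_per, hI.F_per, hI.E_per, hI.G_per]
  · rw [ey _ (by omega) (by omega), hI.P_mid, hI.E_mid, Nat.add_sub_cancel]
  · intro q h1 h2 hq
    obtain ⟨w1, w2⟩ := wire_mem hk h1 h2 hq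
    rw [ez _ w1 w2, ey _ h1 h2, ey' _ h1 h2, ez' _ w1 w2]
    simp only [wire_wire hk h1 h2 hq]
    obtain ⟨j, rfl⟩ : ∃ j, q = j + 1 := ⟨q - 1, by omega⟩
    simp only [Nat.add_sub_cancel]
    have hs : min (A (j + 1) + F (j + 1) + P j - P (j + 1) - F j)
        (A n + F (j + 1) + G j - F j - G (j + 1)) =
        A n + F (j + 1) + E (j + 1) - P (j + 1) - G (j + 1) := by
      have h := hb j h2 (by omega)
      rw [show A (j + 1) + F (j + 1) + P j - P (j + 1) - F j =
          (A (j + 1) + P j + G (j + 1)) + (F (j + 1) - P (j + 1) - F j - G (j + 1)) by ring,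
        show A n + F (j + 1) + G j - F j - G (j + 1) =
          (A n + G j + P (j + 1)) + (F (j + 1) - P (j + 1) - F j - G (j + 1)) by ring,
        min_add_add_right, h]
      ring
    unfold tropMove
    rw [hs]
    refine Prod.ext ?_ (Prod.ext rfl ?_)
    · change _ - _ = _
      ring
    · change _ - _ = _
      ring
  · rw [ey' _ (by omega) (by omega), hI.P_mid, hI.E_mid, Nat.add_sub_cancel]
  · rw [ez' _ (by omega) (by omega), hw, hI.E_top, hI.G_top]

end Bilinear

/-! ### Tau functions on the lattice `ℤ^n` -/

section Lattice

variable {n k : ℕ}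

theorem eI_zero : (eI 0 : ZMod n → ℤ) = 0 := by simp [eI]

theorem eI_succ (p : ℕ) : (eI (p + 1) : ZMod n → ℤ) = eI p + e ((p : ZMod n) + 1) := by
  unfold eI
  rw [Finset.sum_Icc_succ_top (by omega)]
  push_cast
  rfl

theorem eI_top (hn : 1 ≤ n) : (eI n : ZMod n → ℤ) = eI (n - 1) + e 0 := by
  obtain ⟨m, rfl⟩ : ∃ m, n = m + 1 := ⟨n - 1, by omega⟩
  have : ((m : ZMod (m + 1)) + 1) = 0 := by exact_mod_cast ZMod.natCast_self (m + 1)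
  rw [Nat.add_sub_cancel, eI_succ, this]

theorem shiftTau_time_succ {R : Type*} (T : (ZMod n → ℤ) → R) (i t : ℤ) (S : ZMod n → ℤ) :
    shiftTau k T i (t + 1) S = shiftTau k T i t (S - e ((k : ZMod n) + 1)) := by
  unfold shiftTau
  congr 1
  rw [add_smul, one_smul]
  abel

theorem shiftTau_place_succ {R : Type*} (T : (ZMod n → ℤ) → R) (i t : ℤ) (S : ZMod n → ℤ) :
    shiftTau k T (i + 1) t S = shiftTau k T i t (S - e 0) := by
  unfold shiftTau
  congr 1
  rw [add_smul, one_smul]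
  abel

/-- The `top` and `mid` relations write one lattice point in two ways. The `per` relations identify
points that differ by `e_1 + ⋯ + e_n`, and only there is periodicity needed. -/
theorem Interface.of_periodic {R : Type*} (hn : 1 ≤ n) {T : (ZMod n → ℤ) → R}
    (hT : ∀ S, T (S + eI n) = T S) :
    Interface n k (fun q => T (eI q)) (fun q => T (e ((k : ZMod n) + 1) + eI q))
      (fun q => T (eI q - e 0)) (fun q => T (e ((k : ZMod n) + 1) - e 0 + eI q)) where
  E_top := by simp only [eI_top hn]; congr 1; abel
  G_top := by simp only [eI_top hn]; congr 1; abel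
  P_mid := by simp only [eI_succ]; congr 1; abel
  E_mid := by simp only [eI_succ]; congr 1; abel
  P_per := by
    have := hT (eI 0)
    rwa [eI_zero, zero_add, ← eI_zero] at this
  F_per := by
    have := hT (e ((k : ZMod n) + 1))
    simpa only [eI_zero, add_zero] using this
  E_per := by
    rw [← hT]
    simp only [eI_top hn, eI_zero]; congr 1; abel
  G_per := by
    rw [← hT]
    simp only [eI_top hn, eI_zero]; congr 1; abel

/-- The bilinear identity for `τ` at three directions implies the dynamics `φ(n,k)`. -/
theorem isSolution_geomMove {K : Type*} [Field K] (hk : k + 2 ≤ n) {α : ZMod n → K}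
    {τ : (ZMod n → ℤ) → K} (hne : ∀ S, τ S ≠ 0) (hper : ∀ S, τ (S + eI n) = τ S)
    (h0f : α 0 ≠ α ((k : ZMod n) + 1))
    (hb : ∀ (S : ZMod n → ℤ) (p : ZMod n),
      (α p - α ((k : ZMod n) + 1)) * τ (S + e 0) * τ (S + e ((k : ZMod n) + 1) + e p) +
        (α 0 - α p) * τ (S + e ((k : ZMod n) + 1)) * τ (S + e 0 + e p) =
        (α 0 - α ((k : ZMod n) + 1)) * τ (S + e p) * τ (S + e 0 + e ((k : ZMod n) + 1))) :
    IsSolution geomMove k (geomY k α τ) (geomZ k α τ) := by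
  intro i t
  have hper' : ∀ S, shiftTau k τ i t (S + eI n) = shiftTau k τ i t S := by
    intro S
    unfold shiftTau
    rw [← hper (S - i • e 0 - t • e ((k : ZMod n) + 1))]
    congr 1; abel
  have h := step_geomMove_of_bilinear (α := fun q => α (q : ZMod n)) hk
    (Interface.of_periodic (k := k) (by omega) hper')
    (αf := α ((k : ZMod n) + 1)) (by simp) (fun q => hne _) (fun q => hne _) (fun q => hne _) (fun q => hne _)
    (by simpa using h0f) (fun q _ => by
      -- With this base point the six lattice points of the identity are those of `P, G` at `q` and
      -- `q + 1`, of `E` at `q + 1` and of `F` at `q`.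
      have := hb (eI q - e 0 - i • e 0 - t • e ((k : ZMod n) + 1)) (q + 1)
      simp only [eI_succ, shiftTau, ZMod.natCast_self]
      push_cast
      convert this using 5 <;> abel)
  simp only [ZMod.natCast_self] at h
  refine h.trans (Prod.ext ?_ ?_)
  · funext j
    simp only [geomY, shiftTau_time_succ]
    simp only [add_sub_cancel_left, add_sub_right_comm, sub_sub_cancel_left, neg_add_eq_sub]
  · funext j
    simp only [geomZ, shiftTau_place_succ]
    simp only [add_sub_right_comm]

theorem isSolution_tropMove (hk : k + 2 ≤ n) {A : ZMod n → ℝ}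
    {T : (ZMod n → ℤ) → ℝ} (hper : ∀ S, T (S + eI n) = T S)
    (hb : ∀ (S : ZMod n → ℤ) (p : ZMod n), p ≠ 0 → p ≠ (k : ZMod n) + 1 →
      min (A p + T (S + e 0) + T (S + e ((k : ZMod n) + 1) + e p))
        (A 0 + T (S + e ((k : ZMod n) + 1)) + T (S + e 0 + e p)) =
        A 0 + T (S + e p) + T (S + e 0 + e ((k : ZMod n) + 1))) :
    IsSolution tropMove k (tropY k A T) (tropZ k A T) := by
  intro i t
  have hper' : ∀ S, shiftTau k T i t (S + eI n) = shiftTau k T i t S := by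
    intro S
    unfold shiftTau
    rw [← hper (S - i • e 0 - t • e ((k : ZMod n) + 1))]
    congr 1; abel
  have h := step_tropMove_of_bilinear (A := fun q => A (q : ZMod n)) hk
    (Interface.of_periodic (k := k) (by omega) hper')
    (fun q hq hqk => by
      have hne : ∀ a b : ℕ, a < n → b < n → (a : ZMod n) = b → a = b := fun a b ha hb h => by
        rwa [ZMod.natCast_eq_natCast_iff', Nat.mod_eq_of_lt ha, Nat.mod_eq_of_lt hb] at h
      have := hb (eI q - e 0 - i • e 0 - t • e ((k : ZMod n) + 1)) (q + 1)
        (fun h => by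
          have := hne (q + 1) 0 (by omega) (by omega) (by exact_mod_cast h)
          omega)
        (fun h => hqk (by
          have := hne (q + 1) (k + 1) (by omega) (by omega) (by exact_mod_cast h)
          omega))
      simp only [eI_succ, shiftTau, ZMod.natCast_self]
      push_cast
      convert this using 5 <;> abel)
  simp only [ZMod.natCast_self] at h
  refine h.trans (Prod.ext ?_ ?_)
  · funext j
    simp only [tropY, shiftTau_time_succ]
    simp only [add_sub_cancel_left, add_sub_right_comm, sub_sub_cancel_left, neg_add_eq_sub]
  · funext j
    simp only [tropZ, shiftTau_place_succ]
    simp only [add_sub_right_comm]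

end Lattice

/-! ### The min-plus bilinear identity for `min[0, L + S·W]` -/

section Pairing

variable {n k : ℕ}

theorem natCast_inj_of_lt {a b : ℕ} (ha : a < n) (hb : b < n) (h : (a : ZMod n) = b) : a = b := by
  rwa [ZMod.natCast_eq_natCast_iff', Nat.mod_eq_of_lt ha, Nat.mod_eq_of_lt hb] at h

theorem natCast_ne_zero_of_lt {p : ℕ} (h0 : 1 ≤ p) (h1 : p < n) : (p : ZMod n) ≠ 0 := by
  intro h
  have := natCast_inj_of_lt (b := 0) h1 (by omega) (by exact_mod_cast h)
  omega

theorem succ_natCast_ne_zero (hk : k + 2 ≤ n) : (k : ZMod n) + 1 ≠ 0 := by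
  have := natCast_ne_zero_of_lt (n := n) (p := k + 1) (by omega) (by omega)
  exact_mod_cast this

variable [NeZero n]

theorem sum_range_natCast {M : Type*} [AddCommMonoid M] (f : ZMod n → M) :
    ∑ j ∈ Finset.range n, f (j : ZMod n) = ∑ j, f j := by
  refine Finset.sum_bij' (fun j _ => (j : ZMod n)) (fun j _ => j.val) (fun _ _ => Finset.mem_univ _)
    (fun j _ => Finset.mem_range.2 (ZMod.val_lt j))
    (fun j hj => ZMod.val_natCast_of_lt (Finset.mem_range.1 hj))
    (fun j _ => ZMod.natCast_zmod_val j) (fun _ _ => rfl)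

theorem eI_self : (eI n : ZMod n → ℤ) = 1 := by
  have h : (eI n : ZMod n → ℤ) = ∑ j ∈ Finset.range n, e ((j : ZMod n) + 1) := by
    unfold eI
    rw [← Finset.Ico_add_one_right_eq_Icc, Finset.sum_Ico_eq_sum_range]
    simp [add_comm]
  rw [h, sum_range_natCast (fun j : ZMod n => e (j + 1)),
    Fintype.sum_equiv (Equiv.addRight (1 : ZMod n)) (fun j => e (j + 1)) e (fun _ => rfl)]
  exact Finset.univ_sum_single (1 : ZMod n → ℤ)

/-- The pairing `S ↦ S · W`. -/
def pairing (W : ZMod n → ℝ) : (ZMod n → ℤ) →+ ℝ where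
  toFun S := ∑ j, (S j : ℝ) * W j
  map_zero' := by simp
  map_add' S S' := by simp [add_mul, Finset.sum_add_distrib]

theorem tropTau_eq (L : ℝ) (W : ZMod n → ℝ) (S : ZMod n → ℤ) :
    tropTau L W S = min 0 (L + pairing W S) := rfl

theorem pairing_e (W : ZMod n → ℝ) (p : ZMod n) : pairing W (e p) = W p := by
  simp [pairing, e, Pi.single_apply, ite_mul]

theorem pairing_eI_self (W : ZMod n → ℝ) : pairing W (eI n) = ∑ j, W j := by
  simp [pairing, eI_self]

theorem tropTau_periodic (L : ℝ) {W : ZMod n → ℝ} (hW : ∑ j, W j = 0) (S : ZMod n → ℤ) :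
    tropTau L W (S + eI n) = tropTau L W S := by
  rw [tropTau_eq, tropTau_eq, map_add, pairing_eI_self, hW, add_zero]

/-- Sufficient conditions on `W` for `min[0, L + S · W]` to solve `Φ(n,k)`. -/
structure IsSolitonWeight (k : ℕ) (A W : ZMod n → ℝ) (δ : ℝ) : Prop where
  sum_eq_zero : ∑ j, W j = 0
  nonneg : 0 ≤ δ
  top : W ((k : ZMod n) + 1) = -δ
  inner : ∀ p, p ≠ 0 → p ≠ (k : ZMod n) + 1 →
    (W p = -δ ∧ 0 ≤ W 0 ∧ δ ≤ A p - A 0) ∨ (W 0 = 0 ∧ 0 ≤ W p ∧ A 0 ≤ A p)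

/-- Concavity of `min 0`: the pairs `(a + r, a - d)` and `(a, a + r - d)` have the same sum, and the
second lies inside the interval spanned by the first. -/
theorem min_zero_concave {a d r : ℝ} (hd : 0 ≤ d) (hr : 0 ≤ r) :
    min 0 (a + r) + min 0 (a - d) ≤ min 0 a + min 0 (a + r - d) := by
  rcases le_total 0 (a + r) with h1 | h1 <;> rcases le_total 0 (a - d) with h2 | h2 <;>
  rcases le_total 0 a with h3 | h3 <;> rcases le_total 0 (a + r - d) with h4 | h4 <;>
  simp only [h1, h2, h3, h4, min_eq_left, min_eq_right] <;> linarith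

/-- In both alternatives the second term of the minimum equals the right-hand side identically, so
only an inequality against the first term remains. -/
theorem IsSolitonWeight.isSolution {A W : ZMod n → ℝ} {δ : ℝ} (hW : IsSolitonWeight k A W δ)
    (hk : k + 2 ≤ n) (L : ℝ) :
    IsSolution tropMove k (tropY k A (tropTau L W)) (tropZ k A (tropTau L W)) := by
  refine isSolution_tropMove hk (tropTau_periodic L hW.sum_eq_zero) ?_
  intro S p hp0 hpf
  simp only [tropTau_eq, map_add, pairing_e, hW.top]
  have hδ := hW.nonneg
  generalize hX : L + pairing W S = X
  simp only [← add_assoc, hX]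
  rcases hW.inner p hp0 hpf with ⟨h1, h2, h3⟩ | ⟨h1, h2, h3⟩
  · rw [h1, min_eq_right]
    -- Lipschitz bound: lowering the argument by `δ` costs at most `δ`, and `A p - A 0 ≥ δ` pays for
    -- it. Monotonicity (`e2`) handles the other factor.
    have e1 : min 0 (X - δ) ≤ min 0 (X - δ - δ) + δ := by
      rcases le_total 0 (X - δ - δ) with h | h
      · rw [min_eq_left h]; linarith [min_le_left 0 (X - δ)]
      · rw [min_eq_right h]; linarith [min_le_right 0 (X - δ)]
    have e2 : min 0 (X + W 0 - δ) ≤ min 0 (X + W 0) := min_le_min_left _ (by linarith)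
    simp only [← sub_eq_add_neg]
    linarith
  · have := min_zero_concave (a := X) hδ h2
    rw [h1, min_eq_right]
    · simp only [add_zero, ← sub_eq_add_neg]; ring
    · simp only [add_zero, ← sub_eq_add_neg, sub_add_eq_add_sub]; linarith

/-- The four tau values in a state entry form two pairs of points differing by `e_n`; if `W_n = 0`,
each pair cancels. -/
theorem tropY_eq_vacuum_of_weight_eq_zero {A W : ZMod n → ℝ} (hW : W 0 = 0) (L : ℝ) (i t : ℤ) :
    tropY k A (tropTau L W) i t = vacuum A := by
  funext j
  simp only [tropY, shiftTau, tropTau_eq, map_add, map_sub, map_zsmul, pairing_e, hW, vacuum]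
  simp only [smul_zero, sub_zero]
  ring

end Pairing

/-! ### Comparing a solution on `ℤ × ℤ` with the evolution on the half-line -/

section Evolution

variable {n k : ℕ}

theorem carrier_eq_of_isSolution {A : ZMod n → ℝ} {Y Z : ℤ → ℤ → State n ℝ} {t : ℤ}
    (h : IsSolution tropMove k Y Z) (hZ : Z 0 t = initialCarrier k A) {Y₀ : ℕ → State n ℝ}
    (hY : ∀ i : ℕ, Y₀ i = Y i t) (i : ℕ) : carrier k A Y₀ i = Z i t := by
  induction i with
  | zero => exact hZ.symm
  | succ i ih =>
    change (step tropMove k (carrier k A Y₀ i) (Y₀ i)).2 = _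
    rw [ih, hY, h]
    push_cast
    rfl

/-- Each update is local, so a two-sided solution restricts to `i ≥ 0` as soon as the carrier
entering place `0` is the initial one at every later time. -/
theorem evolve_iterate_eq_of_isSolution {A : ZMod n → ℝ} {Y Z : ℤ → ℤ → State n ℝ} {t₀ : ℤ}
    (h : IsSolution tropMove k Y Z) (hZ : ∀ t : ℕ, Z 0 (t₀ + t) = initialCarrier k A)
    {Y₀ : ℕ → State n ℝ} (hY : ∀ i : ℕ, Y₀ i = Y i t₀) (t i : ℕ) :
    (evolve k A)^[t] Y₀ i = Y i (t₀ + t) := by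
  induction t generalizing i with
  | zero => simpa using hY i
  | succ t ih =>
    rw [Function.iterate_succ_apply']
    change (step tropMove k (carrier k A _ i) ((evolve k A)^[t] Y₀ i)).1 = _
    rw [carrier_eq_of_isSolution h (hZ t) ih, ih, h]
    push_cast
    rw [add_assoc]

end Evolution

/-! ### The weights of the one-soliton and its profile `bump` -/

section Flat

variable {n k : ℕ}

/-- The concave function `u ↦ min[0, L + δ u]`. -/
noncomputable def hinge (δ L : ℝ) (u : ℤ) : ℝ := min 0 (L + δ * u)

/-- The height of the soliton over the vacuum. -/
noncomputable def bump (n : ℕ) (δ L : ℝ) (u : ℤ) : ℝ :=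
  hinge δ L (u - 1) + hinge δ L (u - n + 1) - hinge δ L u - hinge δ L (u - n)

theorem hinge_of_nonneg {δ L : ℝ} {u : ℤ} (h : 0 ≤ L + δ * u) : hinge δ L u = 0 := min_eq_left h

theorem hinge_of_nonpos {δ L : ℝ} {u : ℤ} (h : L + δ * u ≤ 0) : hinge δ L u = L + δ * u :=
  min_eq_right h

theorem affine_mono {δ : ℝ} (hδ : 0 < δ) (L : ℝ) {u v : ℤ} (h : u ≤ v) :
    L + δ * u ≤ L + δ * v := by
  have : (u : ℝ) ≤ v := by exact_mod_cast h
  nlinarith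

/-- The arguments `u - 1`, `u - n + 1` and `u`, `u - n` have equal sums, so `bump` vanishes whenever
all four lie on one affine branch of `hinge`. -/
theorem bump_of_nonneg {δ L : ℝ} (hδ : 0 < δ) (hn : 1 ≤ n) {u : ℤ}
    (h : 0 ≤ L + δ * ((u - n : ℤ) : ℝ)) : bump n δ L u = 0 := by
  have key : ∀ v : ℤ, u - n ≤ v → hinge δ L v = 0 := fun v hv =>
    hinge_of_nonneg (h.trans (affine_mono hδ L hv))
  rw [bump, key _ (by omega), key _ (by omega), key _ (by omega), key _ le_rfl]
  ring

theorem bump_of_nonpos {δ L : ℝ} (hδ : 0 < δ) (hn : 1 ≤ n) {u : ℤ} (h : L + δ * u ≤ 0) :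
    bump n δ L u = 0 := by
  have key : ∀ v : ℤ, v ≤ u → hinge δ L v = L + δ * v := fun v hv =>
    hinge_of_nonpos ((affine_mono hδ L hv).trans h)
  rw [bump, key _ (by omega), key _ (by omega), key _ le_rfl, key _ (by omega)]
  push_cast
  ring

theorem finite_bump_ne_zero {δ L : ℝ} (hδ : 0 < δ) (hn : 1 ≤ n) : {u | bump n δ L u ≠ 0}.Finite := by
  refine (Set.finite_Icc ⌊-L / δ⌋ (⌈-L / δ⌉ + n)).subset ?_
  intro u hu
  by_contra hc
  refine hu ?_
  rw [Set.mem_Icc, not_and_or, not_le, not_le] at hc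
  rcases hc with hc | hc
  · apply bump_of_nonpos hδ hn
    have : (u : ℝ) ≤ -L / δ := (by exact_mod_cast hc.le : (u : ℝ) ≤ (⌊-L / δ⌋ : ℝ)).trans
      (Int.floor_le _)
    rw [le_div_iff₀ hδ] at this
    linarith
  · apply bump_of_nonneg hδ hn
    have : -L / δ ≤ ((u - n : ℤ) : ℝ) := (Int.le_ceil _).trans (by exact_mod_cast (by omega))
    rw [div_le_iff₀ hδ] at this
    linarith

theorem exists_bump_ne_zero {δ : ℝ} (L : ℝ) (hδ : 0 < δ) (hn : 2 ≤ n) : ∃ u, bump n δ L u ≠ 0 := by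
  -- Here `⌈-L/δ⌉` is the first integer on the zero branch. At the next integer `u`, both `u - 1`
  -- and `u` are on that branch and `u - n` is strictly below the kink, so `bump` is `hinge (u - n +
  -- 1) - hinge (u - n) > 0`.
  refine ⟨⌈-L / δ⌉ + 1, ?_⟩
  set c := ⌈-L / δ⌉
  have h1 : 0 ≤ L + δ * c := by
    have := Int.le_ceil (-L / δ)
    rw [div_le_iff₀ hδ] at this
    linarith
  have h2 : L + δ * ((c - 1 : ℤ) : ℝ) < 0 := by
    have := Int.ceil_lt_add_one (-L / δ)
    have h : ((c - 1 : ℤ) : ℝ) < -L / δ := by push_cast; linarith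
    rw [lt_div_iff₀ hδ] at h
    linarith
  have h3 : L + δ * ((c + 1 - n : ℤ) : ℝ) < 0 := (affine_mono hδ L (by omega)).trans_lt h2
  rw [bump, hinge_of_nonneg (u := c + 1 - 1) (by simpa using h1),
    hinge_of_nonneg (u := c + 1) (h1.trans (affine_mono hδ L (by omega))),
    hinge_of_nonpos (u := c + 1 - n) h3.le]
  have : L + δ * ((c + 1 - n : ℤ) : ℝ) < hinge δ L (c + 1 - n + 1) := by
    refine lt_min h3 ?_
    push_cast
    linarith
  linarith

/-- The kink now sits at the integer `-m`, so no intermediate heights occur: the profile is a block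
of `n - 1` entries of full height. -/
theorem bump_int_mul {δ : ℝ} (hδ : 0 < δ) (hn : 1 ≤ n) (m u : ℤ) :
    bump n δ (m * δ) u = if -m < u ∧ u ≤ n - 1 - m then δ else 0 := by
  have aux : ∀ v : ℤ, (m * δ + δ * v : ℝ) = δ * ((m + v : ℤ) : ℝ) := fun v => by push_cast; ring
  have hpos : ∀ v : ℤ, 0 ≤ m + v → 0 ≤ (m * δ + δ * v : ℝ) := fun v hv => by
    rw [aux]; exact mul_nonneg hδ.le (by exact_mod_cast hv)
  have hneg : ∀ v : ℤ, m + v ≤ 0 → (m * δ + δ * v : ℝ) ≤ 0 := fun v hv => by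
    rw [aux]; exact mul_nonpos_of_nonneg_of_nonpos hδ.le (by exact_mod_cast hv)
  split_ifs with h
  · rw [bump, hinge_of_nonneg (hpos (u - 1) (by omega)), hinge_of_nonneg (hpos u (by omega)),
      hinge_of_nonpos (hneg (u - n + 1) (by omega)), hinge_of_nonpos (hneg (u - n) (by omega))]
    push_cast
    ring
  · rw [not_and_or, not_lt, not_le] at h
    rcases h with h | h
    · exact bump_of_nonpos hδ hn (hneg _ (by omega))
    · exact bump_of_nonneg hδ hn (hpos _ (by omega))

/-- The weights `((n-1)δ)` at `n` and `-δ` elsewhere. -/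
noncomputable def flatWeight (n : ℕ) (δ : ℝ) : ZMod n → ℝ :=
  fun j => if j = 0 then (n - 1) * δ else -δ

theorem wire_le {j : ℕ} (hk : k + 2 ≤ n) (hj : j < n - 1) :
    1 ≤ wire n k (j + 1) ∧ wire n k (j + 1) ≤ n := by
  unfold wire
  split_ifs <;> omega

theorem natCast_wire {j : ℕ} (hj : j < n - 1) :
    ((wire n k (j + 1) : ℕ) : ZMod n) = (k : ZMod n) - j := by
  unfold wire
  split_ifs with h
  · rw [Nat.add_sub_add_right, Nat.cast_sub (by omega)]
  · rw [show n + k + 1 - (j + 1) = n + k - j by omega, Nat.cast_sub (by omega)]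
    simp

variable [NeZero n]

theorem sum_flatWeight (δ : ℝ) : ∑ j, flatWeight n δ j = 0 := by
  have : ∀ j, flatWeight n δ j = (if j = 0 then n * δ else 0) - δ := by
    intro j
    unfold flatWeight
    split_ifs <;> ring
  simp [this, Finset.sum_sub_distrib, ZMod.card]

theorem flatWeight_isSolitonWeight (hk : k + 2 ≤ n) {A : ZMod n → ℝ} {δ : ℝ} (hδ : 0 ≤ δ)
    (hA : ∀ p, p ≠ 0 → p ≠ (k : ZMod n) + 1 → δ ≤ A p - A 0) :
    IsSolitonWeight k A (flatWeight n δ) δ where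
  sum_eq_zero := sum_flatWeight δ
  nonneg := hδ
  top := if_neg (succ_natCast_ne_zero hk)
  inner p h0 h1 := by
    refine Or.inl ⟨if_neg h0, ?_, hA p h0 h1⟩
    rw [flatWeight, if_pos rfl]
    have : (2 : ℝ) ≤ n := by exact_mod_cast (by omega : 2 ≤ n)
    exact mul_nonneg (by linarith) hδ

theorem pairing_flatWeight_eI (δ : ℝ) {p : ℕ} (hp : p < n) :
    pairing (flatWeight n δ) (eI p) = -(p * δ) := by
  induction p with
  | zero => simp [eI_zero]
  | succ p ih =>
    rw [eI_succ, map_add, ih (by omega), pairing_e, flatWeight, if_neg]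
    · push_cast; ring
    · have := natCast_ne_zero_of_lt (n := n) (p := p + 1) (by omega) hp
      exact_mod_cast this

/-- All weights are integer multiples of `δ`, so place, time and lattice point enter through a
single integer. -/
theorem shiftTau_flatWeight (hk : k + 2 ≤ n) (δ L : ℝ) (i t s : ℤ) (S : ZMod n → ℤ)
    (hs : pairing (flatWeight n δ) S = s * δ) :
    shiftTau k (tropTau L (flatWeight n δ)) i t S = hinge δ L (t - (n - 1) * i + s) := by
  rw [shiftTau, tropTau_eq, hinge]
  simp only [map_sub, map_zsmul, pairing_e, hs]
  rw [flatWeight, flatWeight, if_pos rfl, if_neg (succ_natCast_ne_zero hk)]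
  congr 1
  simp only [zsmul_eq_mul]
  push_cast
  ring

/-- The number `(n-1) i + (j+1)` is the position of the entry when all states are concatenated; the
configuration is a travelling wave of speed one in this coordinate. -/
theorem tropY_flatWeight (hk : k + 2 ≤ n) (A : ZMod n → ℝ) (δ L : ℝ) (i t : ℤ) (j : Fin (n - 1)) :
    tropY k A (tropTau L (flatWeight n δ)) i t j
      = A 0 + bump n δ L (t - ((n - 1) * i + (j + 1))) := by
  have hj := j.isLt
  have hf : flatWeight n δ ((k : ZMod n) + 1) = -δ := if_neg (succ_natCast_ne_zero hk)
  have h0 : flatWeight n δ 0 = (n - 1) * δ := if_pos rfl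
  have e1 := pairing_flatWeight_eI (n := n) δ (p := j) (by omega)
  have e2 := pairing_flatWeight_eI (n := n) δ (p := j + 1) (by omega)
  simp only [tropY, Nat.add_sub_cancel]
  rw [shiftTau_flatWeight hk δ L i t (-j - 2), shiftTau_flatWeight hk δ L i t (-j - n),
    shiftTau_flatWeight hk δ L i t (-j - 1), shiftTau_flatWeight hk δ L i t (-j - 1 - n), bump]
  · rw [show (t - ((n - 1) * i + (j + 1)) - 1 : ℤ) = t - (n - 1) * i + (-j - 2) by ring,
      show (t - ((n - 1) * i + (j + 1)) - n + 1 : ℤ) = t - (n - 1) * i + (-j - n) by ring,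
      show (t - ((n - 1) * i + (j + 1)) - n : ℤ) = t - (n - 1) * i + (-j - 1 - n) by ring,
      show (t - ((n - 1) * i + (j + 1)) : ℤ) = t - (n - 1) * i + (-j - 1) by ring]
    ring
  all_goals
    simp only [map_add, map_sub, pairing_e, e1, e2, hf, h0]
    push_cast
    ring

theorem tropZ_flatWeight_eq {A : ZMod n → ℝ} {δ L : ℝ} (hδ : 0 < δ) (hk : k + 2 ≤ n) {i t : ℤ}
    (h : 0 ≤ L + δ * ((t - (n - 1) * i - n : ℤ) : ℝ) ∨ L + δ * ((t - (n - 1) * i : ℤ) : ℝ) ≤ 0) :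
    tropZ k A (tropTau L (flatWeight n δ)) i t = initialCarrier k A := by
  funext j
  obtain ⟨w1, w2⟩ := wire_le (k := k) hk j.isLt
  have hf : flatWeight n δ ((k : ZMod n) + 1) = -δ := if_neg (succ_natCast_ne_zero hk)
  simp only [tropZ, initialCarrier]
  rw [natCast_wire j.isLt]
  set q := wire n k (j + 1)
  -- The wire `q = n` is the exception to `-q δ`: the weight at `n` brings the total pairing back to
  -- `0`. In either case all four arguments stay within `n` below the base point, hence on one
  -- affine branch.
  obtain ⟨s, hs, hs1, hs2⟩ : ∃ s : ℤ, pairing (flatWeight n δ) (eI q) = s * δ ∧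
      1 - (n : ℤ) ≤ s ∧ s ≤ 0 := by
    rcases w2.lt_or_eq with hq | hq
    · refine ⟨-q, ?_, by omega, by omega⟩
      rw [pairing_flatWeight_eI δ hq]
      push_cast; ring
    · refine ⟨0, ?_, by omega, le_rfl⟩
      rw [hq, pairing_eI_self, sum_flatWeight]
      simp
  have hp : pairing (flatWeight n δ) (eI (q - 1)) = ((1 - q : ℤ) : ℝ) * δ := by
    rw [pairing_flatWeight_eI δ (by omega), Nat.cast_sub w1]
    push_cast; ring
  rw [shiftTau_flatWeight hk δ L i t (s - 1), shiftTau_flatWeight hk δ L i t (1 - q),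
    shiftTau_flatWeight hk δ L i t s, shiftTau_flatWeight hk δ L i t (-q)]
  · set w := t - ((n : ℤ) - 1) * i with hw
    rcases h with h | h
    · have key : ∀ r : ℤ, -(n : ℤ) ≤ r → hinge δ L (w + r) = 0 := fun r hr =>
        hinge_of_nonneg (h.trans (affine_mono hδ L (by omega)))
      rw [key _ (by omega), key _ (by omega), key _ (by omega), key _ (by omega)]
      ring
    · have key : ∀ r : ℤ, r ≤ 0 → hinge δ L (w + r) = L + δ * ((w + r : ℤ) : ℝ) := fun r hr =>
        hinge_of_nonpos ((affine_mono hδ L (by omega)).trans h)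
      rw [key _ (by omega), key _ (by omega), key _ (by omega), key _ (by omega)]
      push_cast
      ring
  · simp only [map_add, pairing_e, hp, hf]; push_cast; ring
  · exact hs
  · exact hp
  · simp only [map_add, pairing_e, hs, hf]; push_cast; ring

end Flat

/-! ### The soliton `(x, …, x)` of the tropical system -/

section FlatSoliton

variable {n k : ℕ}

theorem exists_place_entry (hn : 2 ≤ n) (u : ℤ) :
    ∃ (i : ℤ) (j : Fin (n - 1)), u = (n - 1) * i + (j + 1) := by
  have hpos : (0 : ℤ) < n - 1 := by omega
  have h1 := Int.emod_nonneg (u - 1) hpos.ne'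
  have h2 := Int.emod_lt_of_pos (u - 1) hpos
  refine ⟨(u - 1) / (n - 1), ⟨((u - 1) % (n - 1)).toNat, by omega⟩, ?_⟩
  have := Int.mul_ediv_add_emod (u - 1) (n - 1)
  simp only [Int.toNat_of_nonneg h1]
  linarith

theorem placed_singleton (A : ZMod n → ℝ) (b : ℕ) (s : State n ℝ) (i : ℕ) :
    placed A b [s] i = if i = b then s else vacuum A := by
  rcases lt_trichotomy i b with h | h | h
  · rw [placed, if_pos h, if_neg h.ne]
  · subst h
    simp [placed]
  · obtain ⟨d, rfl⟩ : ∃ d, i = b + 1 + d := ⟨i - b - 1, by omega⟩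
    rw [placed, if_neg (by omega), if_neg (by omega), show b + 1 + d - b = d + 1 by omega]
    rfl

theorem vacuum_lt_const {A : ZMod n → ℝ} {δ : ℝ} (hk : k + 2 ≤ n) (hδ : 0 < δ) : vacuum A < fun _ => A 0 + δ := by
  rw [Pi.lt_def]
  exact ⟨fun j => by simp [vacuum, hδ.le], ⟨0, by omega⟩, by simp [vacuum, hδ]⟩

variable [NeZero n] {A : ZMod n → ℝ} {δ L : ℝ}

theorem tropY_ne_vacuum_iff (hk : k + 2 ≤ n) (i t : ℤ) :
    tropY k A (tropTau L (flatWeight n δ)) i t ≠ vacuum A ↔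
      ∃ j : Fin (n - 1), bump n δ L (t - ((n - 1) * i + (j + 1))) ≠ 0 := by
  rw [Function.ne_iff]
  refine exists_congr fun j => ?_
  rw [tropY_flatWeight hk, vacuum]
  simp

theorem finite_tropY_ne_vacuum (hδ : 0 < δ) (hk : k + 2 ≤ n) (t : ℤ) :
    {i : ℤ | tropY k A (tropTau L (flatWeight n δ)) i t ≠ vacuum A}.Finite := by
  have hsub : {i : ℤ | tropY k A (tropTau L (flatWeight n δ)) i t ≠ vacuum A} ⊆
      ⋃ j : Fin (n - 1), (fun i : ℤ => t - ((n - 1) * i + (j + 1))) ⁻¹'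
        {u | bump n δ L u ≠ 0} := by
    intro i hi
    obtain ⟨j, hj⟩ := (tropY_ne_vacuum_iff hk i t).1 hi
    exact Set.mem_iUnion.2 ⟨j, hj⟩
  refine (Set.finite_iUnion fun j => ?_).subset hsub
  refine (finite_bump_ne_zero hδ (by omega)).preimage ?_
  intro a _ b _ hab
  have hpos : ((n : ℤ) - 1) ≠ 0 := by omega
  have : ((n : ℤ) - 1) * a = (n - 1) * b := by simp only at hab; linarith
  exact mul_left_cancel₀ hpos this

theorem nonempty_tropY_ne_vacuum (hδ : 0 < δ) (hk : k + 2 ≤ n) (t : ℤ) :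
    {i : ℤ | tropY k A (tropTau L (flatWeight n δ)) i t ≠ vacuum A}.Nonempty := by
  obtain ⟨u, hu⟩ := exists_bump_ne_zero L hδ (show 2 ≤ n by omega)
  obtain ⟨i, j, hij⟩ := exists_place_entry (show 2 ≤ n by omega) (t - u)
  refine ⟨i, (tropY_ne_vacuum_iff hk i t).2 ⟨j, ?_⟩⟩
  rwa [← hij, sub_sub_cancel]

theorem finite_tropZ_ne_initialCarrier (hδ : 0 < δ) (hk : k + 2 ≤ n) (t : ℤ) :
    {i : ℤ | tropZ k A (tropTau L (flatWeight n δ)) i t ≠ initialCarrier k A}.Finite := by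
  refine ((Set.finite_Icc ⌊-L / δ⌋ (⌈-L / δ⌉ + n)).preimage
    (f := fun i : ℤ => t - (n - 1) * i) ?_).subset ?_
  · intro a _ b _ hab
    have hpos : ((n : ℤ) - 1) ≠ 0 := by omega
    have : ((n : ℤ) - 1) * a = (n - 1) * b := by simp only at hab; linarith
    exact mul_left_cancel₀ hpos this
  intro i hi
  by_contra hc
  refine hi (tropZ_flatWeight_eq hδ hk ?_)
  rw [Set.mem_preimage, Set.mem_Icc, not_and_or, not_le, not_le] at hc
  set w := t - ((n : ℤ) - 1) * i
  rcases hc with hc | hc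
  · right
    have : (w : ℝ) ≤ -L / δ := (by exact_mod_cast hc.le : (w : ℝ) ≤ (⌊-L / δ⌋ : ℝ)).trans
      (Int.floor_le _)
    rw [le_div_iff₀ hδ] at this
    linarith
  · left
    have : -L / δ ≤ ((w - n : ℤ) : ℝ) := (Int.le_ceil _).trans (by exact_mod_cast (by omega))
    rw [div_le_iff₀ hδ] at this
    linarith

theorem tropY_flatWeight_recurs (hk : k + 2 ≤ n) (i t : ℤ) :
    tropY k A (tropTau L (flatWeight n δ)) (i + 1) (t + (n - 1)) =
      tropY k A (tropTau L (flatWeight n δ)) i t := by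
  funext j
  rw [tropY_flatWeight hk, tropY_flatWeight hk]
  congr 2
  ring

/-- Such a coincidence makes `bump` invariant under translation by `s = a - (n-1) d`. A nonzero
function of finite support has no nonzero period, so `a = (n-1) d` with `d ≥ 1`. -/
theorem le_of_tropY_flatWeight_translate (hδ : 0 < δ) (hk : k + 2 ≤ n) {t a d : ℤ} (ha : 0 < a)
    (h : ∀ i : ℤ, tropY k A (tropTau L (flatWeight n δ)) (i + d) (t + a) =
      tropY k A (tropTau L (flatWeight n δ)) i t) : (n : ℤ) - 1 ≤ a := by
  have hper : ∀ u, bump n δ L (u + (a - (n - 1) * d)) = bump n δ L u := by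
    intro u
    obtain ⟨i, j, hij⟩ := exists_place_entry (show 2 ≤ n by omega) (t - u)
    have := congrFun (h i) j
    rw [tropY_flatWeight hk, tropY_flatWeight hk, add_right_inj, ← hij, sub_sub_cancel] at this
    rw [← this]
    congr 1
    linear_combination -hij
  set s := a - ((n : ℤ) - 1) * d with hs
  have hs0 : s = 0 := by
    by_contra hne
    obtain ⟨u, hu⟩ := exists_bump_ne_zero L hδ (show 2 ≤ n by omega)
    have hmul : ∀ r : ℕ, bump n δ L (u + r * s) = bump n δ L u := by
      intro r
      induction r with
      | zero => simp
      | succ r ih =>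
        rw [← ih, ← hper (u + r * s)]
        congr 1
        push_cast; ring
    refine Set.infinite_of_injective_forall_mem (f := fun r : ℕ => u + r * s) ?_
      (fun r => show bump n δ L _ ≠ 0 by rw [hmul]; exact hu)
      (finite_bump_ne_zero hδ (show 1 ≤ n by omega))
    intro r r' hr
    have : (r : ℤ) * s = r' * s := by simpa using hr
    exact_mod_cast mul_right_cancel₀ hne this
  have hd : a = (n - 1) * d := by omega
  have hpos : (0 : ℤ) < n - 1 := by omega
  have : 0 < d := by
    by_contra hc
    have := mul_nonpos_of_nonneg_of_nonpos hpos.le (not_lt.1 hc)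
    omega
  nlinarith

/-- At time `n - m + t` the raised block occupies the positions `t + 1, …, t + n - 1`; for `t = 0`
these are exactly the entries of place `0`. -/
theorem tropY_int_mul (hδ : 0 < δ) (hk : k + 2 ≤ n) (m i t : ℤ) (j : Fin (n - 1)) :
    tropY k A (tropTau (m * δ) (flatWeight n δ)) i (n - m + t) j =
      A 0 + if t < (n - 1) * i + (j + 1) ∧ (n - 1) * i + (j + 1) < n + t then δ else 0 := by
  rw [tropY_flatWeight hk, bump_int_mul hδ (by omega)]
  congr 1
  refine if_congr ?_ rfl rfl
  constructor <;> rintro ⟨h1, h2⟩ <;> constructor <;> linarith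

theorem tropY_int_mul_initial (hδ : 0 < δ) (hk : k + 2 ≤ n) (m i : ℤ) :
    tropY k A (tropTau (m * δ) (flatWeight n δ)) i (n - m) =
      if i = 0 then fun _ => A 0 + δ else vacuum A := by
  funext j
  have := tropY_int_mul (A := A) hδ hk m i 0 j
  rw [add_zero] at this
  have hj := j.isLt
  rw [this]
  have hpos : (0 : ℤ) < n - 1 := by omega
  split_ifs with h1 h2 h2
  · rfl
  · exfalso
    rcases lt_or_gt_of_ne h2 with h | h
    · have : ((n : ℤ) - 1) * i ≤ (n - 1) * (-1) := mul_le_mul_of_nonneg_left (by omega) hpos.le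
      omega
    · have : ((n : ℤ) - 1) * 1 ≤ (n - 1) * i := mul_le_mul_of_nonneg_left (by omega) hpos.le
      omega
  · subst h2
    omega
  · simp [vacuum]

theorem tropZ_int_mul_initial (hδ : 0 < δ) (hk : k + 2 ≤ n) (m : ℤ) (t : ℕ) :
    tropZ k A (tropTau (m * δ) (flatWeight n δ)) 0 (n - m + t) = initialCarrier k A := by
  refine tropZ_flatWeight_eq hδ hk (Or.inl ?_)
  have : (0 : ℝ) ≤ δ * t := mul_nonneg hδ.le (Nat.cast_nonneg t)
  push_cast
  linarith

/-- The flat weights give a solution of `Φ(n,k)`. -/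
theorem flatWeight_isSolution (hk : k + 2 ≤ n) (hδ : 0 < δ)
    (hA : ∀ p, p ≠ 0 → p ≠ (k : ZMod n) + 1 → A 0 + δ < A p) :
    IsSolution tropMove k (tropY k A (tropTau L (flatWeight n δ)))
      (tropZ k A (tropTau L (flatWeight n δ))) :=
  (flatWeight_isSolitonWeight hk hδ.le fun p h0 h1 => by linarith [hA p h0 h1]).isSolution hk L

theorem tropY_int_mul_eq_evolve (hδ : 0 < δ) (hk : k + 2 ≤ n)
    (hA : ∀ p, p ≠ 0 → p ≠ (k : ZMod n) + 1 → A 0 + δ < A p) (m : ℤ) (i t : ℕ) :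
    tropY k A (tropTau (m * δ) (flatWeight n δ)) i (n - m + t) =
      (evolve k A)^[t] (placed A 0 [fun _ => A 0 + δ]) i := by
  refine (evolve_iterate_eq_of_isSolution (flatWeight_isSolution hk hδ hA)
    (tropZ_int_mul_initial hδ hk m) (fun i => ?_) t i).symm
  rw [placed_singleton, tropY_int_mul_initial hδ hk]
  simp

theorem carrier_evolve_eq (hδ : 0 < δ) (hk : k + 2 ≤ n)
    (hA : ∀ p, p ≠ 0 → p ≠ (k : ZMod n) + 1 → A 0 + δ < A p) (i t : ℕ) :
    carrier k A ((evolve k A)^[t] (placed A 0 [fun _ => A 0 + δ])) i =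
      tropZ k A (tropTau (n * δ) (flatWeight n δ)) i t := by
  have h := fun i => (tropY_int_mul_eq_evolve hδ hk hA n i t).symm
  have hZ := tropZ_int_mul_initial (A := A) hδ hk n t
  simp only [sub_self, zero_add, Int.cast_natCast] at h hZ
  exact carrier_eq_of_isSolution (flatWeight_isSolution hk hδ hA) hZ h i

theorem evolve_eq_tropY (hδ : 0 < δ) (hk : k + 2 ≤ n)
    (hA : ∀ p, p ≠ 0 → p ≠ (k : ZMod n) + 1 → A 0 + δ < A p) (i t : ℕ) :
    (evolve k A)^[t] (placed A 0 [fun _ => A 0 + δ]) i =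
      tropY k A (tropTau (n * δ) (flatWeight n δ)) i t := by
  have h := tropY_int_mul_eq_evolve hδ hk hA n i t
  simp only [sub_self, zero_add, Int.cast_natCast] at h
  exact h.symm

theorem tropY_zero_eq_placed (hδ : 0 < δ) (hk : k + 2 ≤ n) (i : ℤ) :
    tropY k A (tropTau (n * δ) (flatWeight n δ)) i 0 =
      if i = 0 then fun _ => A 0 + δ else vacuum A := by
  have := tropY_int_mul_initial (A := A) hδ hk n i
  simpa using this

theorem tropY_eq_vacuum_of_neg (hδ : 0 < δ) (hk : k + 2 ≤ n) {i t : ℤ} (hi : i < 0) (ht : 0 ≤ t) :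
    tropY k A (tropTau (n * δ) (flatWeight n δ)) i t = vacuum A := by
  funext j
  have := tropY_int_mul (A := A) hδ hk n i t j
  rw [sub_self, zero_add, Int.cast_natCast] at this
  rw [this, if_neg, add_zero, vacuum]
  have hj := j.isLt
  have : ((n : ℤ) - 1) * i ≤ (n - 1) * (-1) :=
    mul_le_mul_of_nonneg_left (by omega) (by omega)
  omega

theorem recovers_flat (hδ : 0 < δ) (hk : k + 2 ≤ n)
    (hA : ∀ p, p ≠ 0 → p ≠ (k : ZMod n) + 1 → A 0 + δ < A p) :
    Recovers k A [fun _ => A 0 + δ] (n - 1) 1 := by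
  funext i
  have h := tropY_flatWeight_recurs (A := A) (δ := δ) (L := n * δ) hk (i - 1) 0
  rw [evolve_eq_tropY hδ hk hA, placed_singleton, Nat.cast_sub (by omega)]
  rw [sub_add_cancel, zero_add] at h
  push_cast
  rw [h, tropY_zero_eq_placed hδ hk]
  refine if_congr ?_ rfl rfl
  omega

theorem le_of_recovers_flat (hδ : 0 < δ) (hk : k + 2 ≤ n)
    (hA : ∀ p, p ≠ 0 → p ≠ (k : ZMod n) + 1 → A 0 + δ < A p) {a b : ℕ} (ha : 0 < a)
    (h : Recovers k A [fun _ => A 0 + δ] a b) : n - 1 ≤ a := by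
  have key := le_of_tropY_flatWeight_translate (A := A) (L := n * δ) (t := 0) (a := a) (d := b)
    hδ hk (by omega) fun i => by
      rw [zero_add, tropY_zero_eq_placed hδ hk]
      -- `Recovers` speaks only of places in `ℕ`. To the left of them both configurations are
      -- vacuum.
      rcases lt_or_ge (i + b) 0 with hi | hi
      · rw [tropY_eq_vacuum_of_neg hδ hk hi (by omega), if_neg (by omega)]
      · obtain ⟨r, hr⟩ := Int.eq_ofNat_of_zero_le hi
        have := congrFun h r
        rw [evolve_eq_tropY hδ hk hA, placed_singleton] at this
        rw [hr, this]
        refine if_congr ?_ rfl rfl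
        omega
  omega

theorem isOneSoliton_flat (hδ : 0 < δ) (hk : k + 2 ≤ n)
    (hA : ∀ p, p ≠ 0 → p ≠ (k : ZMod n) + 1 → A 0 + δ < A p) :
    IsOneSoliton k A [fun _ => A 0 + δ] where
  ne_nil := by simp
  ne_vacuum s hs := by
    rw [List.mem_singleton] at hs
    exact hs ▸ (vacuum_lt_const hk hδ).ne'
  moves := ⟨n - 1, 1, by omega, one_pos, recovers_flat hδ hk hA⟩
  final_carrier t := by
    have h := finite_tropZ_ne_initialCarrier (A := A) (L := n * δ) hδ hk t
    have h' := h.preimage (f := ((↑) : ℕ → ℤ)) Nat.cast_injective.injOn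
    have := h'.compl_mem_cofinite
    rw [Nat.cofinite_eq_atTop] at this
    filter_upwards [this] with i hi
    rw [carrier_evolve_eq hδ hk hA]
    simpa using hi

theorem hasMinimalLength_flat (hδ : 0 < δ) (hk : k + 2 ≤ n)
    (hA : ∀ p, p ≠ 0 → p ≠ (k : ZMod n) + 1 → A 0 + δ < A p) :
    HasMinimalLength k A [fun _ => A 0 + δ] 1 := by
  refine ⟨⟨0, 0, fun i hi => ?_⟩, ?_⟩
  · rw [Function.iterate_zero_apply, placed_singleton] at hi
    have : i = 0 := by
      by_contra hc
      exact hi (if_neg hc)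
    omega
  -- A window of length `0` would need an all-vacuum configuration. At every time some state is
  -- non-vacuum, and it lies at a nonnegative place because nothing moves left of the origin.
  · rintro m ⟨t, s, hs⟩
    obtain ⟨i, hi⟩ := nonempty_tropY_ne_vacuum (A := A) (L := n * δ) hδ hk t
    have hi0 : 0 ≤ i := by
      by_contra hc
      exact hi (tropY_eq_vacuum_of_neg hδ hk (not_le.1 hc) (by omega))
    obtain ⟨r, rfl⟩ := Int.eq_ofNat_of_zero_le hi0
    have := hs r (by rw [evolve_eq_tropY hδ hk hA]; exact hi)
    omega

theorem isMinimalForm_flat (hδ : 0 < δ) (hk : k + 2 ≤ n)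
    (hA : ∀ p, p ≠ 0 → p ≠ (k : ZMod n) + 1 → A 0 + δ < A p) :
    IsMinimalForm k A [fun _ => A 0 + δ] where
  soliton := isOneSoliton_flat hδ hk hA
  positive s hs := by
    rw [List.mem_singleton] at hs
    exact hs ▸ vacuum_lt_const hk hδ
  minimal := hasMinimalLength_flat hδ hk hA

theorem hasVelocity_flat (hδ : 0 < δ) (hk : k + 2 ≤ n)
    (hA : ∀ p, p ≠ 0 → p ≠ (k : ZMod n) + 1 → A 0 + δ < A p) :
    HasVelocity k A [fun _ => A 0 + δ] (1 / ((n : ℝ) - 1)) := by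
  refine ⟨n - 1, 1, by omega, recovers_flat hδ hk hA,
    fun a b ha h => le_of_recovers_flat hδ hk hA ha h, ?_⟩
  rw [Nat.cast_sub (by omega)]
  simp

end FlatSoliton

/-! ### The valuation on Puiseux series -/

section PuiseuxVal

theorem val_zero : val 0 = ⊤ := by
  simp [val]

theorem val_one : val 1 = 0 := by
  simp [val]

theorem val_mul (x y : puiseux) : val (x * y) = val x + val y := by
  unfold val
  rw [Subfield.coe_mul, HahnSeries.orderTop_mul]
  exact WithTop.map_add (Rat.castHom ℝ) _ _

theorem ratCast_withTop_strictMono :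
    StrictMono (WithTop.map fun q : ℚ => (q : ℝ)) :=
  WithTop.strictMono_map_iff.2 Rat.cast_strictMono

theorem min_val_le_val_add (x y : puiseux) : min (val x) (val y) ≤ val (x + y) := by
  unfold val
  rw [Subfield.coe_add, ← ratCast_withTop_strictMono.monotone.map_min]
  exact ratCast_withTop_strictMono.monotone HahnSeries.min_orderTop_le_orderTop_add

/-- The valuation of the Puiseux field as a bundled additive valuation. -/
noncomputable def puiseuxVal : AddValuation puiseux (WithTop ℝ) :=
  AddValuation.of val val_zero val_one min_val_le_val_add val_mul

theorem val_eq (x : puiseux) : val x = puiseuxVal x := rfl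

theorem val_eq_valR {x : puiseux} (hx : x ≠ 0) : val x = (valR x : WithTop ℝ) := by
  have : val x ≠ ⊤ := by
    rw [val_eq]; exact (AddValuation.ne_top_iff _).2 hx
  unfold valR
  obtain ⟨r, hr⟩ := WithTop.ne_top_iff_exists.1 this
  rw [← hr]
  rfl

theorem ne_zero_of_val_eq {x : puiseux} {r : ℝ} (h : val x = (r : WithTop ℝ)) : x ≠ 0 := by
  rintro rfl
  rw [val_zero] at h
  exact WithTop.top_ne_coe h

theorem valR_of_val_eq {x : puiseux} {r : ℝ} (h : val x = (r : WithTop ℝ)) : valR x = r := by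
  rw [valR, h]; rfl

theorem valR_mul {x y : puiseux} (hx : x ≠ 0) (hy : y ≠ 0) : valR (x * y) = valR x + valR y := by
  apply valR_of_val_eq
  rw [val_mul, val_eq_valR hx, val_eq_valR hy, WithTop.coe_add]

theorem valR_one : valR 1 = 0 := valR_of_val_eq val_one

theorem valR_inv {x : puiseux} (hx : x ≠ 0) : valR x⁻¹ = -valR x := by
  have := valR_mul hx (inv_ne_zero hx)
  rw [mul_inv_cancel₀ hx, valR_one] at this
  linarith

theorem valR_div {x y : puiseux} (hx : x ≠ 0) (hy : y ≠ 0) : valR (x / y) = valR x - valR y := by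
  rw [div_eq_mul_inv, valR_mul hx (inv_ne_zero hy), valR_inv hy, sub_eq_add_neg]

theorem valR_pow {x : puiseux} (hx : x ≠ 0) (m : ℕ) : valR (x ^ m) = m * valR x := by
  induction m with
  | zero => simp [valR_one]
  | succ m ih => rw [pow_succ, valR_mul (pow_ne_zero _ hx) hx, ih]; push_cast; ring

theorem valR_zpow {x : puiseux} (hx : x ≠ 0) (m : ℤ) : valR (x ^ m) = m * valR x := by
  obtain ⟨d, rfl | rfl⟩ := m.eq_nat_or_neg
  · rw [zpow_natCast, valR_pow hx]; simp
  · rw [zpow_neg, zpow_natCast, valR_inv (pow_ne_zero _ hx), valR_pow hx]; simp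

theorem valR_prod {ι : Type*} (s : Finset ι) (f : ι → puiseux) (hf : ∀ i ∈ s, f i ≠ 0) :
    valR (∏ i ∈ s, f i) = ∑ i ∈ s, valR (f i) := by
  classical
  induction s using Finset.induction_on with
  | empty => simp [valR_one]
  | insert a s ha ih =>
    rw [Finset.prod_insert ha, Finset.sum_insert ha,
      valR_mul (hf a (by simp)) (Finset.prod_ne_zero_iff.2 fun i hi => hf i (by simp [hi])),
      ih fun i hi => hf i (by simp [hi])]

theorem val_add_of_lt_left {x y : puiseux} (h : val x < val y) : val (x + y) = val x :=
  AddValuation.map_add_eq_of_lt_left puiseuxVal h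

theorem val_add_of_lt_right {x y : puiseux} (h : val y < val x) : val (x + y) = val y := by
  rw [add_comm, val_add_of_lt_left h]

theorem val_neg (x : puiseux) : val (-x) = val x := AddValuation.map_neg puiseuxVal x

theorem val_sub_of_lt_left {x y : puiseux} (h : val x < val y) : val (x - y) = val x := by
  rw [sub_eq_add_neg, val_add_of_lt_left (by rwa [val_neg])]

theorem val_sub_of_lt_right {x y : puiseux} (h : val y < val x) : val (x - y) = val y := by
  rw [sub_eq_add_neg, val_add_of_lt_right (by rwa [val_neg]), val_neg]

theorem min_val_le_val_sub (x y : puiseux) : min (val x) (val y) ≤ val (x - y) := by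
  have := min_val_le_val_add x (-y)
  rwa [val_neg, ← sub_eq_add_neg] at this

theorem val_one_add_of_pos {u : puiseux} (hu : u ≠ 0) (h : 0 < valR u) : val (1 + u) = 0 := by
  rw [val_add_of_lt_left, val_one]
  rw [val_one, val_eq_valR hu]
  exact_mod_cast h

theorem val_one_add_of_neg {u : puiseux} (hu : u ≠ 0) (h : valR u < 0) :
    val (1 + u) = (valR u : WithTop ℝ) := by
  rw [val_add_of_lt_right, val_eq_valR hu]
  rw [val_one, val_eq_valR hu]
  exact_mod_cast h

theorem val_cross_ratio {a x y z w : puiseux} {ra rx ry rz rw : ℝ}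
    (ha : val a = (ra : WithTop ℝ)) (hx : val x = (rx : WithTop ℝ)) (hy : val y = (ry : WithTop ℝ))
    (hz : val z = (rz : WithTop ℝ)) (hw : val w = (rw : WithTop ℝ)) :
    val (a * (x * y) / (z * w)) = ((ra + rx + ry - rz - rw : ℝ) : WithTop ℝ) := by
  have na := ne_zero_of_val_eq ha
  have nx := ne_zero_of_val_eq hx
  have ny := ne_zero_of_val_eq hy
  have nz := ne_zero_of_val_eq hz
  have nw := ne_zero_of_val_eq hw
  rw [val_eq_valR (div_ne_zero (mul_ne_zero na (mul_ne_zero nx ny)) (mul_ne_zero nz nw)),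
    valR_div (mul_ne_zero na (mul_ne_zero nx ny)) (mul_ne_zero nz nw),
    valR_mul na (mul_ne_zero nx ny), valR_mul nx ny, valR_mul nz nw, valR_of_val_eq ha,
    valR_of_val_eq hx, valR_of_val_eq hy, valR_of_val_eq hz, valR_of_val_eq hw]
  congr 1
  ring

theorem finite_int_affine_mem_Icc {a w : ℝ} (hw : w ≠ 0) (lo hi : ℝ) :
    {i : ℤ | lo ≤ a + i * w ∧ a + i * w ≤ hi}.Finite := by
  set Q := (|lo - a| + |hi - a|) / |w|
  refine (Set.finite_Icc ⌊-Q⌋ ⌈Q⌉).subset ?_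
  rintro i ⟨h1, h2⟩
  have hw' := abs_pos.2 hw
  have h3 : |(i : ℝ)| ≤ Q := by
    rw [le_div_iff₀ hw', ← abs_mul, abs_le]
    constructor
    · linarith [neg_abs_le (lo - a), abs_nonneg (hi - a)]
    · linarith [le_abs_self (hi - a), abs_nonneg (lo - a)]
  rw [abs_le] at h3
  exact ⟨by exact_mod_cast (Int.floor_le _).trans h3.1, by exact_mod_cast h3.2.trans (Int.le_ceil _)⟩

/-- A quotient of the kind `x_i C / ((1 + x_i D₁) (1 + x_i D₂))`, `x_i = X B^i`, tends to `0` as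
`i → ±∞` if `val B ≠ 0`. -/
theorem finite_val_le {κ X B C D₁ D₂ : puiseux} (hX : X ≠ 0) (hB : B ≠ 0) (hD₁ : D₁ ≠ 0)
    (hD₂ : D₂ ≠ 0) (hw : valR B ≠ 0) (M : ℝ) :
    {i : ℤ | val (κ * (X * B ^ i * C) / ((1 + X * B ^ i * D₁) * (1 + X * B ^ i * D₂))) ≤
      (M : WithTop ℝ)}.Finite := by
  -- If the numerator vanishes identically, the quotient has valuation `∞` and no `i` is
  -- exceptional; otherwise `C` has a finite valuation to work with.
  by_cases hκC : κ * C = 0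
  · convert Set.finite_empty
    rw [Set.eq_empty_iff_forall_notMem]
    intro i hi
    rw [Set.mem_ofPred_eq, show κ * (X * B ^ i * C) = X * B ^ i * (κ * C) by ring, hκC, mul_zero,
      zero_div, val_zero] at hi
    exact absurd hi (by simp)
  have hκ : κ ≠ 0 := left_ne_zero_of_mul hκC
  have hC : C ≠ 0 := right_ne_zero_of_mul hκC
  refine (finite_int_affine_mem_Icc (a := valR X) hw
    (-(|valR D₁| + |valR D₂| + |valR κ + valR C| + |M|))
    (|valR D₁| + |valR D₂| + |valR κ + valR C| + |M|)).subset ?_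
  intro i hi
  by_contra hc
  refine absurd hi ?_
  rw [Set.mem_ofPred_eq, not_le]
  have hXB : X * B ^ i ≠ 0 := mul_ne_zero hX (zpow_ne_zero _ hB)
  have hr : valR (X * B ^ i) = valR X + i * valR B := by
    rw [valR_mul hX (zpow_ne_zero _ hB), valR_zpow hB]
  rw [Set.mem_ofPred_eq, ← hr, not_and_or, not_le, not_le] at hc
  generalize X * B ^ i = x at *
  have v1 := valR_mul hXB hD₁
  have v2 := valR_mul hXB hD₂
  have n1 : x * D₁ ≠ 0 := mul_ne_zero hXB hD₁
  have n2 : x * D₂ ≠ 0 := mul_ne_zero hXB hD₂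
  have b1 := abs_le.1 (le_refl |valR D₁|)
  have b2 := abs_le.1 (le_refl |valR D₂|)
  have b3 := abs_le.1 (le_refl |valR κ + valR C|)
  have b4 := abs_le.1 (le_refl |M|)
  have p1 := abs_nonneg (valR D₁)
  have p2 := abs_nonneg (valR D₂)
  have p3 := abs_nonneg (valR κ + valR C)
  have p4 := abs_nonneg M
  -- For very negative `val x` both denominators are dominated by `x D`, and the quotient has
  -- valuation `-val x` plus a constant. For very positive `val x` they are dominated by `1`, and it
  -- has `val x` plus a constant. The bound absorbs both constants and `M`.
  rcases hc with hc | hc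
  · rw [val_cross_ratio (val_eq_valR hκ) (val_eq_valR hXB) (val_eq_valR hC)
      (val_one_add_of_neg n1 (by linarith)) (val_one_add_of_neg n2 (by linarith)), v1, v2,
      WithTop.coe_lt_coe]
    linarith
  · rw [val_cross_ratio (val_eq_valR hκ) (val_eq_valR hXB) (val_eq_valR hC)
      (rz := 0) (val_one_add_of_pos n1 (by linarith)) (rw := 0)
      (val_one_add_of_pos n2 (by linarith)), WithTop.coe_lt_coe]
    linarith

end PuiseuxVal

/-! ### Laurent monomials and the geometric bilinear identity -/

section Monomial

variable {n k : ℕ} [NeZero n] {K : Type*} [Field K]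

/-- The Laurent monomial `B^S`. -/
def monomial (B : ZMod n → K) (S : ZMod n → ℤ) : K := ∏ j, B j ^ S j

theorem solitonTau_eq (α : ZMod n → K) (b c ℓ : K) (S : ZMod n → ℤ) :
    solitonTau α b c ℓ S = 1 + ℓ * monomial (solitonB α b c) S := rfl

variable {B : ZMod n → K}

theorem monomial_ne_zero (hB : ∀ j, B j ≠ 0) (S : ZMod n → ℤ) : monomial B S ≠ 0 :=
  Finset.prod_ne_zero_iff.2 fun j _ => zpow_ne_zero _ (hB j)

theorem monomial_add (hB : ∀ j, B j ≠ 0) (S S' : ZMod n → ℤ) :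
    monomial B (S + S') = monomial B S * monomial B S' := by
  simp only [monomial, ← Finset.prod_mul_distrib, Pi.add_apply, zpow_add₀ (hB _)]

theorem monomial_e (p : ZMod n) : monomial B (e p) = B p := by
  unfold monomial e
  rw [Finset.prod_eq_single p]
  · simp
  · intro j _ hj
    simp [hj]
  · simp

theorem monomial_zsmul (S : ZMod n → ℤ) (m : ℤ) : monomial B (m • S) = monomial B S ^ m := by
  simp only [monomial, ← Finset.prod_zpow, Pi.smul_apply, smul_eq_mul]
  exact Finset.prod_congr rfl fun j _ => by rw [mul_comm, zpow_mul]

theorem monomial_sub (hB : ∀ j, B j ≠ 0) (S S' : ZMod n → ℤ) :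
    monomial B (S - S') = monomial B S * (monomial B S')⁻¹ := by
  have := monomial_zsmul (B := B) S' (-1)
  rw [sub_eq_add_neg, monomial_add hB, ← this.trans (zpow_neg_one _), neg_one_smul]

theorem monomial_eI_self : monomial B (eI n) = ∏ j, B j := by
  simp [monomial, eI_self]

/-- In degrees `0` and `2` in `ℓ` it reduces to `(α_p - α_f) + (α_o - α_p) = α_o - α_f`, since every
quadratic term carries the same monomial. Degree `1` is the rational identity `h1` in `b` and `c`.
The curve equation plays no part here. -/
theorem solitonTau_bilinear {α : ZMod n → K} {b c ℓ : K} (hb : ∀ j, b - α j ≠ 0)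
    (hc : ∀ j, c - α j ≠ 0) (S : ZMod n → ℤ) (o f p : ZMod n) :
    (α p - α f) * solitonTau α b c ℓ (S + e o) * solitonTau α b c ℓ (S + e f + e p) +
      (α o - α p) * solitonTau α b c ℓ (S + e f) * solitonTau α b c ℓ (S + e o + e p) =
    (α o - α f) * solitonTau α b c ℓ (S + e p) * solitonTau α b c ℓ (S + e o + e f) := by
  have hB : ∀ j, solitonB α b c j ≠ 0 := fun j => div_ne_zero (hb j) (hc j)
  simp only [solitonTau_eq, monomial_add hB, monomial_e]
  generalize ℓ * monomial _ S = X
  simp only [← mul_assoc]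
  have h1 : (α p - α f) * (solitonB α b c o + solitonB α b c f * solitonB α b c p) +
      (α o - α p) * (solitonB α b c f + solitonB α b c o * solitonB α b c p) =
      (α o - α f) * (solitonB α b c p + solitonB α b c o * solitonB α b c f) := by
    have := hc o; have := hc f; have := hc p
    unfold solitonB
    field_simp
    ring
  generalize monomial (solitonB α b c) S = m
  linear_combination ℓ * m * h1

end Monomial

/-! ### Valuations of the factors `B_j` -/

section SolitonData

variable {n k : ℕ} [NeZero n] {A : ZMod n → ℝ} {α : ZMod n → puiseux} {b c ℓ : puiseux}

theorem valR_monomial {B : ZMod n → puiseux} (hB : ∀ j, B j ≠ 0) (S : ZMod n → ℤ) :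
    valR (monomial B S) = pairing (fun j => valR (B j)) S := by
  rw [monomial, valR_prod _ _ fun j _ => zpow_ne_zero _ (hB j)]
  exact Finset.sum_congr rfl fun j _ => valR_zpow (hB j) _

theorem tropSolitonTau_eq (S : ZMod n → ℤ) :
    tropSolitonTau α b c ℓ S = min 0 (valR ℓ + pairing (fun j => valR (solitonB α b c j)) S) := rfl

namespace IsSolitonData

theorem b_ne_zero (h : IsSolitonData k A α b c ℓ) : b ≠ 0 := by
  rintro rfl
  have := h.b_lt_c
  rw [val_zero] at this
  exact not_top_lt this

theorem c_ne_zero (h : IsSolitonData k A α b c ℓ) : c ≠ 0 := by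
  rintro rfl
  have := h.upper
  rw [val_zero] at this
  exact not_top_lt this

theorem valR_lt (h : IsSolitonData k A α b c ℓ) : valR b < valR c := by
  have := h.b_lt_c
  rw [val_eq_valR h.b_ne_zero, val_eq_valR h.c_ne_zero] at this
  exact_mod_cast this

theorem le_valR_b (h : IsSolitonData k A α b c ℓ) : A 0 ≤ valR b := by
  have := h.lower
  rw [val_eq_valR h.b_ne_zero] at this
  exact_mod_cast this

theorem valR_c_lt (h : IsSolitonData k A α b c ℓ) : valR c < A ((k : ZMod n) + 1) := by
  have := h.upper
  rw [val_eq_valR h.c_ne_zero] at this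
  exact_mod_cast this

theorem gap_valR (h : IsSolitonData k A α b c ℓ) (i : ZMod n) : A i ≤ valR b ∨ valR c < A i := by
  have := h.gap i
  rw [val_eq_valR h.b_ne_zero, val_eq_valR h.c_ne_zero] at this
  exact_mod_cast this

theorem val_c_sub_of_le (h : IsSolitonData k A α b c ℓ) {j : ZMod n} (hj : A j ≤ valR b) :
    val (c - α j) = (A j : WithTop ℝ) := by
  rw [val_sub_of_lt_right, h.val_α]
  rw [h.val_α, val_eq_valR h.c_ne_zero]
  exact_mod_cast hj.trans_lt h.valR_lt

theorem val_c_sub_of_lt (h : IsSolitonData k A α b c ℓ) {j : ZMod n} (hj : valR c < A j) :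
    val (c - α j) = (valR c : WithTop ℝ) := by
  rw [val_sub_of_lt_left, val_eq_valR h.c_ne_zero]
  rw [h.val_α, val_eq_valR h.c_ne_zero]
  exact_mod_cast hj

theorem c_sub_ne_zero (h : IsSolitonData k A α b c ℓ) (j : ZMod n) : c - α j ≠ 0 := by
  rcases h.gap_valR j with hj | hj
  · exact ne_zero_of_val_eq (h.val_c_sub_of_le hj)
  · exact ne_zero_of_val_eq (h.val_c_sub_of_lt hj)

/-- Valuations cannot exclude `b = α_j` when `val b = A j`; the curve equation does, because the
product over `c - α_i` is nonzero. -/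
theorem b_sub_ne_zero (h : IsSolitonData k A α b c ℓ) (j : ZMod n) : b - α j ≠ 0 := by
  have h1 : ∏ i, (c - α i) ≠ 0 := Finset.prod_ne_zero_iff.2 fun i _ => h.c_sub_ne_zero i
  rw [← h.curve] at h1
  exact Finset.prod_ne_zero_iff.1 h1 j (Finset.mem_univ j)

theorem solitonB_ne_zero (h : IsSolitonData k A α b c ℓ) (j : ZMod n) : solitonB α b c j ≠ 0 :=
  div_ne_zero (h.b_sub_ne_zero j) (h.c_sub_ne_zero j)

theorem prod_solitonB (h : IsSolitonData k A α b c ℓ) : ∏ j, solitonB α b c j = 1 := by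
  simp only [solitonB, Finset.prod_div_distrib, h.curve]
  exact div_self (Finset.prod_ne_zero_iff.2 fun i _ => h.c_sub_ne_zero i)

theorem sum_valR_solitonB (h : IsSolitonData k A α b c ℓ) : ∑ j, valR (solitonB α b c j) = 0 := by
  rw [← valR_prod _ _ fun j _ => h.solitonB_ne_zero j, h.prod_solitonB, valR_one]

theorem valR_solitonB (h : IsSolitonData k A α b c ℓ) (j : ZMod n) :
    valR (solitonB α b c j) = valR (b - α j) - valR (c - α j) :=
  valR_div (h.b_sub_ne_zero j) (h.c_sub_ne_zero j)

theorem valR_solitonB_of_c_lt (h : IsSolitonData k A α b c ℓ) {j : ZMod n} (hj : valR c < A j) :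
    valR (solitonB α b c j) = valR b - valR c := by
  rw [h.valR_solitonB, valR_of_val_eq (h.val_c_sub_of_lt hj)]
  congr 1
  apply valR_of_val_eq
  rw [val_sub_of_lt_left, val_eq_valR h.b_ne_zero]
  rw [h.val_α, val_eq_valR h.b_ne_zero]
  exact_mod_cast h.valR_lt.trans hj

theorem valR_solitonB_of_lt_b (h : IsSolitonData k A α b c ℓ) {j : ZMod n} (hj : A j < valR b) :
    valR (solitonB α b c j) = 0 := by
  rw [h.valR_solitonB, valR_of_val_eq (h.val_c_sub_of_le hj.le), sub_eq_zero]
  apply valR_of_val_eq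
  rw [val_sub_of_lt_right, h.val_α]
  rw [h.val_α, val_eq_valR h.b_ne_zero]
  exact_mod_cast hj

/-- Only an inequality is available: for `A j = val b` the leading terms of `b` and `α_j` may
cancel. -/
theorem valR_solitonB_nonneg (h : IsSolitonData k A α b c ℓ) {j : ZMod n} (hj : A j ≤ valR b) :
    0 ≤ valR (solitonB α b c j) := by
  rw [h.valR_solitonB, valR_of_val_eq (h.val_c_sub_of_le hj), sub_nonneg]
  have := min_val_le_val_sub b (α j)
  rw [h.val_α, val_eq_valR h.b_ne_zero, val_eq_valR (h.b_sub_ne_zero j), ← WithTop.coe_min,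
    WithTop.coe_le_coe, min_eq_right hj] at this
  exact this

theorem isSolitonWeight (h : IsSolitonData k A α b c ℓ)
    (hA : ∀ i : ZMod n, i ≠ 0 → i ≠ (k : ZMod n) + 1 → A 0 < A i ∧ A i < A ((k : ZMod n) + 1)) :
    IsSolitonWeight k A (fun j => valR (solitonB α b c j)) (valR c - valR b) where
  sum_eq_zero := h.sum_valR_solitonB
  nonneg := sub_nonneg.2 h.valR_lt.le
  top := by simp only [h.valR_solitonB_of_c_lt h.valR_c_lt, neg_sub]
  inner p h0 hf := by
    rcases h.gap_valR p with hp | hp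
    · have := (hA p h0 hf).1
      exact Or.inr ⟨h.valR_solitonB_of_lt_b (this.trans_le hp), h.valR_solitonB_nonneg hp, this.le⟩
    · refine Or.inl ⟨?_, h.valR_solitonB_nonneg h.le_valR_b, ?_⟩
      · simp only [h.valR_solitonB_of_c_lt hp, neg_sub]
      · linarith [h.le_valR_b]

/-- The weights off `n` are all `val b - val c`, so zero sum makes `W_n` positive. If `val b`
exceeded `A_n`, then `W_n` would vanish; hence `val b = A_n`. -/
theorem valR_b_and_weights (h : IsSolitonData k A α b c ℓ) (hn : 2 ≤ n)
    (hx : ∀ i : ZMod n, i ≠ 0 → valR c < A i) :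
    valR b = A 0 ∧ (fun j => valR (solitonB α b c j)) = flatWeight n (valR c - A 0) := by
  have hW : ∀ j, j ≠ 0 → valR (solitonB α b c j) = -(valR c - valR b) := fun j hj => by
    rw [h.valR_solitonB_of_c_lt (hx j hj), neg_sub]
  have hW0 : valR (solitonB α b c 0) = (n - 1) * (valR c - valR b) := by
    have h1 := h.sum_valR_solitonB
    have h2 := sum_flatWeight (n := n) (valR c - valR b)
    rw [← Finset.add_sum_erase _ _ (Finset.mem_univ (0 : ZMod n))] at h1 h2
    have h3 : ∑ j ∈ Finset.univ.erase (0 : ZMod n), valR (solitonB α b c j) =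
        ∑ j ∈ Finset.univ.erase (0 : ZMod n), flatWeight n (valR c - valR b) j :=
      Finset.sum_congr rfl fun j hj => by
        rw [hW j (Finset.ne_of_mem_erase hj), flatWeight, if_neg (Finset.ne_of_mem_erase hj)]
    rw [flatWeight, if_pos rfl] at h2
    linarith
  have hb : valR b = A 0 := by
    refine le_antisymm (not_lt.1 fun hlt => ?_) h.le_valR_b
    rw [h.valR_solitonB_of_lt_b hlt] at hW0
    have : (2 : ℝ) ≤ n := by exact_mod_cast hn
    have := mul_pos (by linarith : (0 : ℝ) < n - 1) (sub_pos.2 h.valR_lt)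
    linarith
  refine ⟨hb, funext fun j => ?_⟩
  rw [flatWeight]
  split_ifs with hj
  · rw [hj, hW0, hb]
  · rw [hW j hj, hb]

theorem solitonTau_periodic (h : IsSolitonData k A α b c ℓ) (S : ZMod n → ℤ) :
    solitonTau α b c ℓ (S + eI n) = solitonTau α b c ℓ S := by
  rw [solitonTau_eq, solitonTau_eq, monomial_add h.solitonB_ne_zero, monomial_eI_self,
    h.prod_solitonB, mul_one]

theorem val_α_zero_sub (h : IsSolitonData k A α b c ℓ) {p : ZMod n} (hp : A 0 < A p) :
    val (α 0 - α p) = (A 0 : WithTop ℝ) := by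
  rw [val_sub_of_lt_left, h.val_α]
  rw [h.val_α, h.val_α]
  exact_mod_cast hp

theorem val_α_sub_top (h : IsSolitonData k A α b c ℓ) {q : ZMod n}
    (hq : A q < A ((k : ZMod n) + 1)) :
    val (α q - α ((k : ZMod n) + 1)) = (A q : WithTop ℝ) := by
  rw [val_sub_of_lt_left, h.val_α]
  rw [h.val_α, h.val_α]
  exact_mod_cast hq

end IsSolitonData

end SolitonData

/-! ### Consequences of the ordering of the `A_i` -/

section Parameters

variable {n k : ℕ} {A : ZMod n → ℝ}

theorem exists_inner (hn : 3 ≤ n) : ∃ p : ZMod n, p ≠ 0 ∧ p ≠ (k : ZMod n) + 1 := by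
  have : NeZero n := ⟨by omega⟩
  have hcard : ({0, (k : ZMod n) + 1} : Finset (ZMod n)).card < Fintype.card (ZMod n) := by
    rw [ZMod.card]
    exact (Finset.card_le_two).trans_lt (by omega)
  obtain ⟨p, hp⟩ := Finset.exists_mem_notMem_of_card_lt_card
    (s := {0, (k : ZMod n) + 1}) (t := Finset.univ) hcard
  exact ⟨p, by simp at hp; tauto⟩

theorem lt_of_ne_zero (hn : 3 ≤ n)
    (hA : ∀ i : ZMod n, i ≠ 0 → i ≠ (k : ZMod n) + 1 → A 0 < A i ∧ A i < A ((k : ZMod n) + 1))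
    {p : ZMod n} (hp : p ≠ 0) : A 0 < A p := by
  by_cases hf : p = (k : ZMod n) + 1
  · obtain ⟨q, h0, h1⟩ := exists_inner (k := k) hn
    rw [hf]
    exact (hA q h0 h1).1.trans (hA q h0 h1).2
  · exact (hA p hp hf).1

theorem lt_of_ne_top (hn : 3 ≤ n)
    (hA : ∀ i : ZMod n, i ≠ 0 → i ≠ (k : ZMod n) + 1 → A 0 < A i ∧ A i < A ((k : ZMod n) + 1))
    {p : ZMod n} (hp : p ≠ (k : ZMod n) + 1) : A p < A ((k : ZMod n) + 1) := by
  by_cases h0 : p = 0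
  · obtain ⟨q, h1, h2⟩ := exists_inner (k := k) hn
    rw [h0]
    exact (hA q h1 h2).1.trans (hA q h1 h2).2
  · exact (hA p h0 hp).2

theorem natCast_fin_succ_ne_zero (j : Fin (n - 1)) : (((j : ℕ) + 1 : ℕ) : ZMod n) ≠ 0 :=
  natCast_ne_zero_of_lt (by omega) (by have := j.isLt; omega)

theorem natCast_wire_ne_top (j : Fin (n - 1)) :
    ((wire n k (j + 1) : ℕ) : ZMod n) ≠ (k : ZMod n) + 1 := by
  rw [natCast_wire j.isLt]
  intro h
  refine natCast_fin_succ_ne_zero j ?_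
  push_cast
  linear_combination -h

end Parameters

/-! ### The geometric solution, its valuations and its boundary behaviour -/

namespace IsSolitonData

variable {n k : ℕ} [NeZero n] {A : ZMod n → ℝ} {α : ZMod n → puiseux} {b c ℓ : puiseux}

theorem isSolution_geomMove (h : IsSolitonData k A α b c ℓ) (hn : 3 ≤ n) (hk : k + 2 ≤ n)
    (hA : ∀ i : ZMod n, i ≠ 0 → i ≠ (k : ZMod n) + 1 → A 0 < A i ∧ A i < A ((k : ZMod n) + 1))
    (hτ : ∀ S, solitonTau α b c ℓ S ≠ 0) :
    IsSolution geomMove k (solY k α b c ℓ) (solZ k α b c ℓ) := by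
  refine SolitonCA.isSolution_geomMove hk hτ h.solitonTau_periodic ?_ fun S p =>
    solitonTau_bilinear h.b_sub_ne_zero h.c_sub_ne_zero S 0 _ p
  exact sub_ne_zero.1 (ne_zero_of_val_eq
    (h.val_α_zero_sub (lt_of_ne_zero hn hA (succ_natCast_ne_zero hk))))

theorem sol_ne_zero (h : IsSolitonData k A α b c ℓ) (hn : 3 ≤ n)
    (hA : ∀ i : ZMod n, i ≠ 0 → i ≠ (k : ZMod n) + 1 → A 0 < A i ∧ A i < A ((k : ZMod n) + 1))
    (hτ : ∀ S, solitonTau α b c ℓ S ≠ 0) (i t : ℤ) (j : Fin (n - 1)) :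
    solY k α b c ℓ i t j ≠ 0 ∧ solZ k α b c ℓ i t j ≠ 0 := by
  have h1 := ne_zero_of_val_eq
    (h.val_α_zero_sub (lt_of_ne_zero hn hA (natCast_fin_succ_ne_zero j)))
  have h2 := ne_zero_of_val_eq (h.val_α_sub_top (lt_of_ne_top hn hA (natCast_wire_ne_top j)))
  exact ⟨div_ne_zero (mul_ne_zero h1 (mul_ne_zero (hτ _) (hτ _))) (mul_ne_zero (hτ _) (hτ _)),
    div_ne_zero (mul_ne_zero h2 (mul_ne_zero (hτ _) (hτ _))) (mul_ne_zero (hτ _) (hτ _))⟩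

theorem val_sol (h : IsSolitonData k A α b c ℓ) (hn : 3 ≤ n)
    (hA : ∀ i : ZMod n, i ≠ 0 → i ≠ (k : ZMod n) + 1 → A 0 < A i ∧ A i < A ((k : ZMod n) + 1))
    (hτ : ∀ S, val (solitonTau α b c ℓ S) = (tropSolitonTau α b c ℓ S : WithTop ℝ))
    (i t : ℤ) (j : Fin (n - 1)) :
    val (solY k α b c ℓ i t j) = (tropSolY k A α b c ℓ i t j : WithTop ℝ) ∧
      val (solZ k α b c ℓ i t j) = (tropSolZ k A α b c ℓ i t j : WithTop ℝ) :=
  ⟨val_cross_ratio (h.val_α_zero_sub (lt_of_ne_zero hn hA (natCast_fin_succ_ne_zero j)))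
      (hτ _) (hτ _) (hτ _) (hτ _),
    val_cross_ratio (h.val_α_sub_top (lt_of_ne_top hn hA (natCast_wire_ne_top j)))
      (hτ _) (hτ _) (hτ _) (hτ _)⟩

/-- Each tau value is `1 + x D` with `x` a constant times `B_n^{-i}`. Because `S₁ + S₂ = S₃ + S₄`,
the terms `1` and `x²` agree above and below, so the deviation from `κ` is linear in `x` over the
denominator and `finite_val_le` applies. -/
theorem finite_val_cross_sub_le (h : IsSolitonData k A α b c ℓ)
    (hw : valR (solitonB α b c 0) ≠ 0) (hτ : ∀ S, solitonTau α b c ℓ S ≠ 0)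
    (κ : puiseux) {S₁ S₂ S₃ S₄ : ZMod n → ℤ} (hS : S₁ + S₂ = S₃ + S₄) (t : ℤ) (M : ℝ) :
    {i : ℤ | val (κ * (shiftTau k (solitonTau α b c ℓ) i t S₁ *
        shiftTau k (solitonTau α b c ℓ) i t S₂) / (shiftTau k (solitonTau α b c ℓ) i t S₃ *
        shiftTau k (solitonTau α b c ℓ) i t S₄) - κ) ≤ (M : WithTop ℝ)}.Finite := by
  have hB := h.solitonB_ne_zero
  set B := solitonB α b c with hBdef
  have hshift : ∀ (i : ℤ) S, shiftTau k (solitonTau α b c ℓ) i t S =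
      1 + ℓ * (B ((k : ZMod n) + 1) ^ t)⁻¹ * (B 0)⁻¹ ^ i * monomial B S := by
    intro i S
    rw [shiftTau, solitonTau_eq, ← hBdef, monomial_sub hB, monomial_sub hB, monomial_zsmul,
      monomial_zsmul, monomial_e, monomial_e, inv_zpow]
    ring
  have hfin := finite_val_le (κ := κ)
    (C := monomial B S₁ + monomial B S₂ - monomial B S₃ - monomial B S₄)
    (mul_ne_zero h.ℓ_ne_zero (inv_ne_zero (zpow_ne_zero t (hB ((k : ZMod n) + 1)))))
    (inv_ne_zero (hB 0)) (monomial_ne_zero hB S₃) (monomial_ne_zero hB S₄)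
    (by rw [valR_inv (hB 0)]; exact neg_ne_zero.2 hw) M
  refine hfin.subset fun i hi => ?_
  have n3 : shiftTau k (solitonTau α b c ℓ) i t S₃ ≠ 0 := hτ _
  have n4 : shiftTau k (solitonTau α b c ℓ) i t S₄ ≠ 0 := hτ _
  rw [Set.mem_ofPred_eq] at hi ⊢
  convert hi using 2
  rw [hshift] at n3 n4
  simp only [hshift]
  have hm : monomial B S₁ * monomial B S₂ = monomial B S₃ * monomial B S₄ := by
    rw [← monomial_add hB, hS, monomial_add hB]
  generalize ℓ * (B ((k : ZMod n) + 1) ^ t)⁻¹ * (B 0)⁻¹ ^ i = x at *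
  rw [eq_sub_iff_add_eq, div_add' _ _ _ (mul_ne_zero n3 n4)]
  congr 1
  linear_combination -κ * x ^ 2 * hm

theorem finite_boundary (h : IsSolitonData k A α b c ℓ)
    (hw : valR (solitonB α b c 0) ≠ 0) (hτ : ∀ S, solitonTau α b c ℓ S ≠ 0)
    (t : ℤ) (j : Fin (n - 1)) (M : ℝ) :
    {i : ℤ | val (solY k α b c ℓ i t j - geomVacuum α j) ≤ (M : WithTop ℝ)}.Finite ∧
      {i : ℤ | val (solZ k α b c ℓ i t j - geomCarrier k α j) ≤ (M : WithTop ℝ)}.Finite := by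
  constructor
  · refine h.finite_val_cross_sub_le hw hτ _ ?_ t M
    abel
  · have := h.finite_val_cross_sub_le (k := k) hw hτ
      (α ((wire n k (j + 1) : ℕ) : ZMod n) - α ((k : ZMod n) + 1))
      (S₁ := e ((k : ZMod n) + 1) + eI (wire n k (j + 1))) (S₂ := eI (wire n k (j + 1) - 1))
      (S₃ := eI (wire n k (j + 1))) (S₄ := e ((k : ZMod n) + 1) + eI (wire n k (j + 1) - 1))
      (by abel) t M
    simp only [geomCarrier, ← natCast_wire (k := k) j.isLt]
    exact this

theorem isSolution_tropMove (h : IsSolitonData k A α b c ℓ) (hk : k + 2 ≤ n)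
    (hA : ∀ i : ZMod n, i ≠ 0 → i ≠ (k : ZMod n) + 1 → A 0 < A i ∧ A i < A ((k : ZMod n) + 1)) :
    IsSolution tropMove k (tropSolY k A α b c ℓ) (tropSolZ k A α b c ℓ) :=
  (h.isSolitonWeight hA).isSolution hk (valR ℓ)

theorem tropSolY_eq_vacuum (h : IsSolitonData k A α b c ℓ) (hn : 3 ≤ n)
    (hA : ∀ i : ZMod n, i ≠ 0 → i ≠ (k : ZMod n) + 1 → A 0 < A i ∧ A i < A ((k : ZMod n) + 1))
    {p : ZMod n} (hp : p ≠ 0) (hpb : (A p : WithTop ℝ) ≤ val b) (i t : ℤ) :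
    tropSolY k A α b c ℓ i t = vacuum A := by
  refine tropY_eq_vacuum_of_weight_eq_zero ?_ (valR ℓ) i t
  rw [val_eq_valR h.b_ne_zero, WithTop.coe_le_coe] at hpb
  exact h.valR_solitonB_of_lt_b ((lt_of_ne_zero hn hA hp).trans_le hpb)

end IsSolitonData

/-! ### Hensel's lemma by contraction on power series -/

section FixedPoint

/-- An `X`-adically contracting self-map of the power series has a fixed point. -/
theorem exists_fixedPoint_of_contracting {R : Type*} [CommRing R]
    (φ : PowerSeries R → PowerSeries R)
    (h : ∀ (m : ℕ) (a b : PowerSeries R), PowerSeries.X ^ m ∣ a - b →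
      PowerSeries.X ^ (m + 1) ∣ φ a - φ b) : ∃ a, φ a = a := by
  have hstep : ∀ m : ℕ, (PowerSeries.X : PowerSeries R) ^ m ∣ φ^[m + 1] 0 - φ^[m] 0 := by
    intro m
    induction m with
    | zero => simp
    | succ m ih =>
      rw [Function.iterate_succ_apply', Function.iterate_succ_apply' φ m]
      exact h m _ _ (by simpa only [Function.iterate_succ_apply'] using ih)
  have hle : ∀ m r : ℕ, (PowerSeries.X : PowerSeries R) ^ m ∣ φ^[m + r] 0 - φ^[m] 0 := by
    intro m r
    induction r with
    | zero => simp
    | succ r ih =>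
      have := dvd_add ((pow_dvd_pow _ (Nat.le_add_right m r)).trans (hstep (m + r))) ih
      rwa [sub_add_sub_cancel] at this
  -- Diagonal limit: the coefficient of degree `m` no longer changes after `m + 1` iterations.
  set a : PowerSeries R := PowerSeries.mk fun m => PowerSeries.coeff m (φ^[m + 1] 0) with ha
  have hlim : ∀ m, (PowerSeries.X : PowerSeries R) ^ m ∣ a - φ^[m] 0 := by
    intro m
    rw [PowerSeries.X_pow_dvd_iff]
    intro d hd
    rw [map_sub, ha, PowerSeries.coeff_mk, sub_eq_zero]
    obtain ⟨r, rfl⟩ : ∃ r, m = d + 1 + r := ⟨m - d - 1, by omega⟩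
    have := PowerSeries.X_pow_dvd_iff.1 (hle (d + 1) r) d (by omega)
    rw [map_sub, sub_eq_zero] at this
    exact this.symm
  refine ⟨a, ?_⟩
  ext m
  have h1 := h m _ _ (hlim m)
  have h2 := hlim (m + 1)
  rw [Function.iterate_succ_apply'] at h2
  have h3 := PowerSeries.X_pow_dvd_iff.1 (dvd_sub h1 h2) m (by omega)
  rw [sub_sub_sub_cancel_right, map_sub, sub_eq_zero] at h3
  exact h3

/-- A special case of Hensel's lemma for power series. -/
theorem exists_powerSeries_root {F ι : Type*} [Field F] (s : Finset ι) (β : ι → PowerSeries F)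
    (hβ : ∀ i ∈ s, PowerSeries.constantCoeff (β i) = 0) {D : PowerSeries F}
    (hD : PowerSeries.constantCoeff D = 0) :
    ∃ ε : PowerSeries F, PowerSeries.constantCoeff ε = 0 ∧ ε * ∏ i ∈ s, (1 + ε - β i) = D := by
  obtain ⟨D', rfl⟩ := PowerSeries.X_dvd_iff.2 hD
  set P : PowerSeries F → PowerSeries F :=
    fun η => ∏ i ∈ s, (1 + PowerSeries.X * η - β i) with hP
  have hP0 : ∀ η, PowerSeries.constantCoeff (P η) ≠ 0 := by
    intro η
    rw [hP, map_prod]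
    refine Finset.prod_ne_zero_iff.2 fun i hi => ?_
    simp [hβ i hi]
  have hsub : ∀ a b : PowerSeries F, PowerSeries.X * (a - b) ∣ P a - P b := by
    intro a b
    -- `P` is a polynomial evaluated at `X η`, so the difference of two values is divisible by `X (a
    -- - b)`; the extra `X` is what makes the map contract.
    have := Polynomial.sub_dvd_eval_sub (PowerSeries.X * a) (PowerSeries.X * b)
      (∏ i ∈ s, (1 + Polynomial.X - Polynomial.C (β i)))
    simpa [Polynomial.eval_prod, hP, mul_sub] using this
  -- Writing `D = X D'` and `ε = X η` turns the equation into `η = D' / P η`, where `P η` is a unit.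
  obtain ⟨η, hη⟩ := exists_fixedPoint_of_contracting (fun η => D' * (P η)⁻¹) (by
    intro m a b hab
    have e : D' * (P a)⁻¹ - D' * (P b)⁻¹ = (P b - P a) * (D' * (P a)⁻¹ * (P b)⁻¹) := by
      have e1 := PowerSeries.mul_inv_cancel (P a) (hP0 a)
      have e2 := PowerSeries.mul_inv_cancel (P b) (hP0 b)
      linear_combination D' * (P b)⁻¹ * e1 - D' * (P a)⁻¹ * e2
    have h1 : (PowerSeries.X : PowerSeries F) ^ (m + 1) ∣ PowerSeries.X * (b - a) := by
      rw [pow_succ', ← neg_sub a b]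
      exact mul_dvd_mul_left _ ((dvd_neg).2 hab)
    simp only [e]
    exact (h1.trans (hsub b a)).mul_right _)
  refine ⟨PowerSeries.X * η, by simp, ?_⟩
  change PowerSeries.X * η * P η = _
  rw [mul_assoc]
  congr 1
  calc η * P η = D' * (P η)⁻¹ * P η := by rw [hη]
    _ = D' := by rw [mul_assoc, PowerSeries.inv_mul_cancel _ (hP0 η), mul_one]

end FixedPoint

/-! ### Transfer from power series to Puiseux series -/

section RootHom

/-- The exponents `m ↦ m / N` of power series in `t^{1/N}`. -/
def rootExpNat (N : ℕ+) : ℕ →+ ℚ := (rootExp N).comp (Nat.castAddMonoidHom ℤ)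

theorem rootExpNat_apply (N : ℕ+) (m : ℕ) : rootExpNat N m = (m : ℚ) / (N : ℕ) := by
  change ((m : ℤ) : ℚ) / _ = _
  simp

theorem rootExpNat_le_iff (N : ℕ+) (a b : ℕ) : rootExpNat N a ≤ rootExpNat N b ↔ a ≤ b :=
  (rootExp_le_iff N a b).trans Int.ofNat_le

theorem rootExpNat_injective (N : ℕ+) : Function.Injective (rootExpNat N) :=
  (rootExp_injective N).comp Nat.cast_injective

/-- The substitution `X ↦ t^{1/N}`. -/
noncomputable def rootHom (N : ℕ+) : PowerSeries ℂ →+* HahnSeries ℚ ℂ :=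
  (HahnSeries.embDomainRingHom (R := ℂ) (rootExpNat N) (rootExpNat_injective N)
    (rootExpNat_le_iff N)).comp HahnSeries.toPowerSeries.symm.toRingHom

theorem coeff_rootHom (N : ℕ+) (f : PowerSeries ℂ) (m : ℕ) :
    (rootHom N f).coeff ((m : ℚ) / (N : ℕ)) = PowerSeries.coeff m f := by
  rw [← rootExpNat_apply, ← HahnSeries.coeff_toPowerSeries_symm]
  exact HahnSeries.embDomain_coeff
    (f := ⟨⟨rootExpNat N, rootExpNat_injective N⟩, rootExpNat_le_iff N _ _⟩)

theorem coeff_rootHom_of_notMem (N : ℕ+) (f : PowerSeries ℂ) {q : ℚ}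
    (hq : ∀ m : ℕ, q ≠ (m : ℚ) / (N : ℕ)) : (rootHom N f).coeff q = 0 := by
  refine HahnSeries.embDomain_of_notMem_range
    (f := ⟨⟨rootExpNat N, rootExpNat_injective N⟩, rootExpNat_le_iff N _ _⟩) ?_
  rintro ⟨m, rfl⟩
  exact hq m (rootExpNat_apply N m)

theorem rootHom_mem_laurentRoot (N : ℕ+) (f : PowerSeries ℂ) : rootHom N f ∈ laurentRoot N := by
  rw [mem_laurentRoot]
  intro q hq
  by_contra hc
  push Not at hc
  exact hq (coeff_rootHom_of_notMem N f fun m => by simpa using hc m)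

theorem rootHom_mem_puiseux (N : ℕ+) (f : PowerSeries ℂ) : rootHom N f ∈ puiseux :=
  mem_puiseux.2 ⟨N, rootHom_mem_laurentRoot N f⟩

theorem orderTop_rootHom_pos (N : ℕ+) {f : PowerSeries ℂ} (hf : PowerSeries.constantCoeff f = 0) :
    0 < (rootHom N f).orderTop := by
  by_contra hc
  rw [not_lt] at hc
  obtain ⟨q, hq⟩ := WithTop.ne_top_iff_exists.1 (hc.trans_lt (WithTop.coe_lt_top (0 : ℚ))).ne
  rw [← hq] at hc
  have hq0 : q ≤ 0 := by exact_mod_cast hc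
  refine HahnSeries.coeff_orderTop_ne hq.symm ?_
  have hN : (0 : ℚ) < (N : ℕ) := by exact_mod_cast N.pos
  by_cases h : ∃ m : ℕ, q = (m : ℚ) / (N : ℕ)
  · obtain ⟨m, rfl⟩ := h
    rw [coeff_rootHom]
    have : (m : ℚ) ≤ 0 := by
      by_contra hm
      exact absurd hq0 (not_le.2 (div_pos (not_le.1 hm) hN))
    have : m = 0 := by
      have : m ≤ 0 := by exact_mod_cast this
      omega
    rw [this]
    simpa using hf
  · push Not at h
    exact coeff_rootHom_of_notMem N f h

theorem exists_rootHom_eq {N : ℕ+} {y : HahnSeries ℚ ℂ} (hy : y ∈ laurentRoot N)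
    (hpos : 0 < y.orderTop) :
    ∃ f : PowerSeries ℂ, PowerSeries.constantCoeff f = 0 ∧ rootHom N f = y := by
  have hneg : ∀ q : ℚ, q ≤ 0 → y.coeff q = 0 := fun q hq =>
    HahnSeries.coeff_eq_zero_of_lt_orderTop
      (lt_of_le_of_lt (by exact_mod_cast hq : (q : WithTop ℚ) ≤ 0) hpos)
  refine ⟨PowerSeries.mk fun m => y.coeff ((m : ℚ) / (N : ℕ)), ?_, ?_⟩
  · rw [← PowerSeries.coeff_zero_eq_constantCoeff_apply, PowerSeries.coeff_mk]
    exact hneg _ (by simp)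
  · ext q
    by_cases h : ∃ m : ℕ, q = (m : ℚ) / (N : ℕ)
    · obtain ⟨m, rfl⟩ := h
      rw [coeff_rootHom, PowerSeries.coeff_mk]
    · push Not at h
      rw [coeff_rootHom_of_notMem N _ h]
      by_contra hc
      obtain ⟨z, hz⟩ := mem_laurentRoot.1 hy q (Ne.symm hc)
      have hN : (0 : ℚ) < (N : ℕ) := by exact_mod_cast N.pos
      have hz0 : 0 ≤ z := by
        by_contra hz0
        refine Ne.symm hc (hneg q ?_)
        rw [hz]
        exact div_nonpos_of_nonpos_of_nonneg (by exact_mod_cast (not_le.1 hz0).le) hN.le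
      obtain ⟨m, rfl⟩ := Int.eq_ofNat_of_zero_le hz0
      exact h m (by simpa using hz)

theorem laurentRoot_le_of_dvd {N M : ℕ+} (h : N ∣ M) : laurentRoot N ≤ laurentRoot M := by
  obtain ⟨d, rfl⟩ := h
  intro x hx
  rw [mem_laurentRoot] at hx ⊢
  intro q hq
  obtain ⟨m, rfl⟩ := hx q hq
  refine ⟨m * (d : ℕ), ?_⟩
  have hd : ((d : ℕ) : ℚ) ≠ 0 := by exact_mod_cast d.pos.ne'
  have hN : ((N : ℕ) : ℚ) ≠ 0 := by exact_mod_cast N.pos.ne'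
  push_cast
  field_simp

theorem val_pos_iff {x : puiseux} : 0 < val x ↔ 0 < (x : HahnSeries ℚ ℂ).orderTop := by
  have : (0 : WithTop ℝ) = WithTop.map (fun q : ℚ => (q : ℝ)) 0 := by simp
  rw [val, this, ratCast_withTop_strictMono.lt_iff_lt]

/-- A special case of Hensel's lemma for Puiseux series. -/
theorem exists_puiseux_root {ι : Type*} (s : Finset ι) (β : ι → puiseux)
    (hβ : ∀ i ∈ s, 0 < val (β i)) {D : puiseux} (hD : 0 < val D) :
    ∃ ε : puiseux, 0 < val ε ∧ ε * ∏ i ∈ s, (1 + ε - β i) = D := by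
  choose N hN using fun i => mem_puiseux.1 (β i).2
  obtain ⟨M, hM⟩ := mem_puiseux.1 D.2
  -- A common denominator of all exponents places the whole equation inside power series in
  -- `t^{1/Q}`.
  set Q : ℕ+ := M * ∏ i ∈ s, N i
  have hDQ := laurentRoot_le_of_dvd (Dvd.intro _ rfl : M ∣ Q) hM
  have hβQ : ∀ i ∈ s, (β i : HahnSeries ℚ ℂ) ∈ laurentRoot Q := fun i hi =>
    laurentRoot_le_of_dvd ((Finset.dvd_prod_of_mem N hi).trans (Dvd.intro_left _ rfl)) (hN i)
  obtain ⟨D', hD0, hD'⟩ := exists_rootHom_eq hDQ (val_pos_iff.1 hD)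
  have hex : ∀ i, ∃ f : PowerSeries ℂ, i ∈ s →
      PowerSeries.constantCoeff f = 0 ∧ rootHom Q f = β i := fun i => by
    by_cases hi : i ∈ s
    · obtain ⟨f, hf⟩ := exists_rootHom_eq (hβQ i hi) (val_pos_iff.1 (hβ i hi))
      exact ⟨f, fun _ => hf⟩
    · exact ⟨0, fun h => absurd h hi⟩
  choose β' hβ' using hex
  obtain ⟨ε, hε0, hε⟩ := exists_powerSeries_root s β' (fun i hi => (hβ' i hi).1) hD0
  refine ⟨⟨rootHom Q ε, rootHom_mem_puiseux Q ε⟩, val_pos_iff.2 (orderTop_rootHom_pos Q hε0), ?_⟩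
  apply Subtype.ext
  have := congrArg (rootHom Q) hε
  rw [map_mul, map_prod, hD'] at this
  rw [← this, Subfield.coe_mul, SubmonoidClass.coe_finsetProd]
  congr 1
  refine Finset.prod_congr rfl fun i hi => ?_
  rw [map_sub, map_add, map_one, (hβ' i hi).2]
  rfl

end RootHom

/-! ### Leading coefficients and absence of cancellation -/

section LeadingCoeff

/-- The leading coefficient of Puiseux series as a multiplicative map. -/
noncomputable def leadCoeff : puiseux →*₀ ℂ where
  toFun x := (x : HahnSeries ℚ ℂ).leadingCoeff
  map_zero' := HahnSeries.leadingCoeff_zero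
  map_one' := HahnSeries.leadingCoeff_one
  map_mul' x y := HahnSeries.leadingCoeff_mul (x : HahnSeries ℚ ℂ) y

theorem orderTop_lt_of_val_lt {x y : puiseux} (h : val x < val y) :
    (x : HahnSeries ℚ ℂ).orderTop < (y : HahnSeries ℚ ℂ).orderTop :=
  ratCast_withTop_strictMono.lt_iff_lt.1 h

theorem leadCoeff_add_of_lt {x y : puiseux} (h : val x < val y) :
    leadCoeff (x + y) = leadCoeff x :=
  HahnSeries.leadingCoeff_add_eq_left (orderTop_lt_of_val_lt h)

theorem leadCoeff_sub_of_lt {x y : puiseux} (h : val x < val y) :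
    leadCoeff (x - y) = leadCoeff x :=
  HahnSeries.leadingCoeff_sub (orderTop_lt_of_val_lt h)

theorem leadCoeff_ne_zero {x : puiseux} (hx : x ≠ 0) : leadCoeff x ≠ 0 :=
  (map_ne_zero leadCoeff).2 hx

theorem leadCoeff_neg_one : leadCoeff (-1) = -1 := by
  change (-(1 : HahnSeries ℚ ℂ)).leadingCoeff = -1
  rw [HahnSeries.leadingCoeff_neg, HahnSeries.leadingCoeff_one]

/-- Cancellation in `1 + u` would require `u` to have valuation `0` and leading coefficient `-1`. -/
theorem val_one_add_of_leadCoeff {u : puiseux} (hu : u ≠ 0)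
    (h : valR u = 0 → leadCoeff u = 1) : val (1 + u) = ((min 0 (valR u) : ℝ) : WithTop ℝ) := by
  rcases lt_trichotomy (valR u) 0 with h0 | h0 | h0
  · rw [val_one_add_of_neg hu h0, min_eq_right h0.le]
  · have hv : val u = 0 := by rw [val_eq_valR hu, h0]; rfl
    rw [h0, min_self]
    have hge := min_val_le_val_add 1 u
    rw [val_one, hv, min_self] at hge
    refine le_antisymm (not_lt.1 fun hlt => ?_) hge
    have := leadCoeff_add_of_lt (x := -1) (y := 1 + u) (by
      rw [val_neg, val_one]
      exact hlt)
    rw [neg_add_cancel_left, h h0, leadCoeff_neg_one] at this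
    norm_num at this
  · rw [val_one_add_of_pos hu h0, min_eq_left h0.le]
    rfl

/-- The Puiseux series `t^x`. -/
noncomputable def tPow (x : ℚ) : puiseux :=
  ⟨HahnSeries.single x 1, mem_puiseux.2 ⟨⟨x.den, x.pos⟩, mem_laurentRoot.2 fun q hq => by
    have := HahnSeries.support_single_subset hq
    rw [Set.mem_singleton_iff] at this
    exact ⟨x.num, by rw [this]; exact (Rat.num_div_den x).symm⟩⟩⟩

theorem val_tPow (x : ℚ) : val (tPow x) = ((x : ℝ) : WithTop ℝ) := by
  unfold val tPow
  rw [HahnSeries.orderTop_single one_ne_zero, WithTop.map_coe]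

theorem leadCoeff_tPow (x : ℚ) : leadCoeff (tPow x) = 1 := HahnSeries.leadingCoeff_of_single

end LeadingCoeff

/-! ### Construction of `b`, `c` and `ℓ` -/

section Existence

theorem zpow_sum₀_eq_prod {K ι : Type*} [Field K] {a : K} (ha : a ≠ 0) (s : Finset ι) (f : ι → ℤ) :
    a ^ (∑ i ∈ s, f i) = ∏ i ∈ s, a ^ f i := by
  classical
  induction s using Finset.induction_on with
  | empty => simp
  | insert i s hi ih => rw [Finset.sum_insert hi, Finset.prod_insert hi, zpow_add₀ ha, ih]

variable {n k : ℕ} [NeZero n] {A : ZMod n → ℝ} {α : ZMod n → puiseux}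

/-- For every `c` with `A_n < val c < A_i` there is a second point `b ≠ c` with
`∏ (b - α_i) = ∏ (c - α_i)` and `val b = A_n`. -/
theorem exists_curve_point (hn : 2 ≤ n) (hα : ∀ i, val (α i) = (A i : WithTop ℝ)) {c : puiseux}
    {x : ℝ} (hc : val c = (x : WithTop ℝ)) (h0 : A 0 < x) (hx : ∀ i : ZMod n, i ≠ 0 → x < A i) :
    ∃ b : puiseux, val b = (A 0 : WithTop ℝ) ∧ ∏ i, (b - α i) = ∏ i, (c - α i) := by
  have hα0 : α 0 ≠ 0 := ne_zero_of_val_eq (hα 0)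
  set s := (Finset.univ : Finset (ZMod n)).erase 0 with hs
  have hc0 : val (c - α 0) = (A 0 : WithTop ℝ) := by
    rw [val_sub_of_lt_right, hα]
    rw [hα, hc]
    exact_mod_cast h0
  have hci : ∀ i ∈ s, val (c - α i) = (x : WithTop ℝ) := fun i hi => by
    rw [val_sub_of_lt_left, hc]
    rw [hα, hc]
    exact_mod_cast hx i (Finset.ne_of_mem_erase hi)
  -- Dividing the curve equation by `α_n^n` and putting `b = α_n (1 + ε)` turns it into `ε ∏ (1 + ε
  -- - α_i/α_n) = D`, with `val D = (n-1)(x - A_n) > 0`.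
  set D : puiseux := (c - α 0) / α 0 * ∏ i ∈ s, ((c - α i) / α 0) with hD
  have hD0 : 0 < val D := by
    have hne : ∀ i ∈ s, (c - α i) / α 0 ≠ 0 := fun i hi =>
      div_ne_zero (ne_zero_of_val_eq (hci i hi)) hα0
    have h1 := div_ne_zero (ne_zero_of_val_eq hc0) hα0
    have hv : valR D = ∑ _i ∈ s, (x - A 0) := by
      rw [hD, valR_mul h1 (Finset.prod_ne_zero_iff.2 hne), valR_prod _ _ hne,
        valR_div (ne_zero_of_val_eq hc0) hα0, valR_of_val_eq hc0, valR_of_val_eq (hα 0), sub_self,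
        zero_add]
      refine Finset.sum_congr rfl fun i hi => ?_
      rw [valR_div (ne_zero_of_val_eq (hci i hi)) hα0, valR_of_val_eq (hci i hi),
        valR_of_val_eq (hα 0)]
    rw [val_eq_valR (mul_ne_zero h1 (Finset.prod_ne_zero_iff.2 hne)), ← WithTop.coe_zero,
      WithTop.coe_lt_coe, hv]
    refine Finset.sum_pos (fun _ _ => sub_pos.2 h0) (Finset.card_pos.1 ?_)
    rw [hs, Finset.card_erase_of_mem (Finset.mem_univ _), Finset.card_univ, ZMod.card]
    omega
  obtain ⟨ε, hε, hroot⟩ := exists_puiseux_root s (fun i => α i / α 0) (fun i hi => by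
    have hαi : α i ≠ 0 := ne_zero_of_val_eq (hα i)
    have := h0.trans (hx i (Finset.ne_of_mem_erase hi))
    rw [val_eq_valR (div_ne_zero hαi hα0), valR_div hαi hα0, valR_of_val_eq (hα i),
      valR_of_val_eq (hα 0), ← WithTop.coe_zero, WithTop.coe_lt_coe]
    linarith) hD0
  refine ⟨α 0 * (1 + ε), ?_, ?_⟩
  · rw [val_mul, val_add_of_lt_left (by rwa [val_one]), val_one, hα, add_zero]
  · have hscale : ∀ f : ZMod n → puiseux,
        ∏ i, f i = α 0 ^ (s.card + 1) * (f 0 / α 0 * ∏ i ∈ s, (f i / α 0)) := fun f => by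
      rw [← Finset.mul_prod_erase _ _ (Finset.mem_univ (0 : ZMod n)), Finset.prod_div_distrib,
        Finset.prod_const, ← hs]
      field_simp
      ring
    rw [hscale fun i => α 0 * (1 + ε) - α i, hscale fun i => c - α i, ← hD, ← hroot]
    congr 2
    · field_simp
      ring
    · exact Finset.prod_congr rfl fun i _ => by field_simp

theorem leadCoeff_solitonB {b c ℓ : puiseux} (h : IsSolitonData k A α b c ℓ)
    (hx : ∀ i : ZMod n, i ≠ 0 → valR c < A i) (hc : leadCoeff c = 1) {j : ZMod n} (hj : j ≠ 0) :
    leadCoeff (solitonB α b c j) = leadCoeff b := by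
  rw [solitonB, map_div₀, leadCoeff_sub_of_lt, leadCoeff_sub_of_lt, hc, div_one]
  · rw [h.val_α, val_eq_valR h.c_ne_zero]
    exact_mod_cast hx j hj
  · rw [h.val_α, val_eq_valR h.b_ne_zero]
    exact_mod_cast h.valR_lt.trans (hx j hj)

/-- With `ℓ = (c / b)^n` nothing cancels in the tau function. -/
theorem val_solitonTau_of_quotient {b c : puiseux} (hn : 2 ≤ n)
    (h : IsSolitonData k A α b c ((c / b) ^ n)) (hx : ∀ i : ZMod n, i ≠ 0 → valR c < A i)
    (hc : leadCoeff c = 1) (S : ZMod n → ℤ) :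
    val (solitonTau α b c ((c / b) ^ n) S) =
      (tropSolitonTau α b c ((c / b) ^ n) S : WithTop ℝ) := by
  have hB := h.solitonB_ne_zero
  have hb := h.b_ne_zero
  have hβ := leadCoeff_ne_zero hb
  obtain ⟨hbA, hW⟩ := h.valR_b_and_weights hn hx
  have hu : (c / b) ^ n * monomial (solitonB α b c) S ≠ 0 :=
    mul_ne_zero h.ℓ_ne_zero (monomial_ne_zero hB S)
  have hlead0 : leadCoeff (solitonB α b c 0) = leadCoeff b ^ (1 - n : ℤ) := by
    have h1 := congrArg leadCoeff h.prod_solitonB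
    rw [map_prod, map_one, ← Finset.mul_prod_erase _ _ (Finset.mem_univ (0 : ZMod n)),
      Finset.prod_congr rfl fun j hj => leadCoeff_solitonB h hx hc (Finset.ne_of_mem_erase hj),
      Finset.prod_const, Finset.card_erase_of_mem (Finset.mem_univ _), Finset.card_univ,
      ZMod.card] at h1
    rw [eq_inv_of_mul_eq_one_left h1, ← zpow_natCast, ← zpow_neg, Nat.cast_sub (by omega)]
    congr 1
    push_cast
    ring
  -- One integer `N = ∑ w_j s_j - n` controls everything: `ℓ B^S` has leading coefficient `leadCoeff
  -- b ^ N` and valuation `-(val c - A_n) N`. Valuation `0` therefore means `N = 0` and leading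
  -- coefficient `1`; the shift by `n` comes from the choice of `ℓ`.
  set w : ZMod n → ℤ := fun j => if j = 0 then 1 - n else 1 with hw
  have hleadj : ∀ j, leadCoeff (solitonB α b c j) = leadCoeff b ^ w j := fun j => by
    by_cases hj : j = 0
    · rw [hj, hlead0, hw]; simp
    · rw [leadCoeff_solitonB h hx hc hj, hw]; simp [hj]
  have hlead : leadCoeff ((c / b) ^ n * monomial (solitonB α b c) S) =
      leadCoeff b ^ (∑ j, w j * S j - n) := by
    rw [map_mul, map_pow, map_div₀, hc, monomial, map_prod, zpow_sub₀ hβ, zpow_natCast,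
      zpow_sum₀_eq_prod hβ]
    simp only [map_zpow₀, hleadj, ← zpow_mul, div_pow, one_pow]
    field_simp
  have hval : valR ((c / b) ^ n * monomial (solitonB α b c) S) =
      -(valR c - A 0) * ((∑ j, w j * S j - n : ℤ) : ℝ) := by
    rw [valR_mul h.ℓ_ne_zero (monomial_ne_zero hB S), valR_pow (div_ne_zero h.c_ne_zero hb),
      valR_div h.c_ne_zero hb, hbA, valR_monomial hB, hW]
    have : pairing (flatWeight n (valR c - A 0)) S = -(valR c - A 0) * ∑ j, (w j : ℝ) * S j := by
      rw [Finset.mul_sum]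
      refine Finset.sum_congr rfl fun j _ => ?_
      rw [flatWeight, hw]
      by_cases hj : j = 0
      · simp only [hj, if_true]; push_cast; ring
      · simp only [hj, if_false]; push_cast; ring
    rw [this]
    push_cast
    ring
  rw [solitonTau_eq, val_one_add_of_leadCoeff hu, tropSolitonTau_eq, ← valR_monomial hB,
    ← valR_mul h.ℓ_ne_zero (monomial_ne_zero hB S)]
  intro h0
  rw [hval, mul_eq_zero, neg_eq_zero, sub_eq_zero] at h0
  rcases h0 with h0 | h0
  · have := h.valR_lt
    linarith
  · have h0' : ∑ j, w j * S j - (n : ℤ) = 0 := by exact_mod_cast h0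
    rw [hlead, h0', zpow_zero]

theorem exists_solitonData (hn : 2 ≤ n) (hk : k + 2 ≤ n)
    (hα : ∀ i, val (α i) = (A i : WithTop ℝ)) {x : ℚ} (h0 : A 0 < x)
    (hx : ∀ i : ZMod n, i ≠ 0 → (x : ℝ) < A i) :
    ∃ b c ℓ : puiseux, IsSolitonData k A α b c ℓ ∧ val c = ((x : ℝ) : WithTop ℝ) ∧
      val ℓ = ((n * (x - A 0) : ℝ) : WithTop ℝ) ∧
      ∀ S, val (solitonTau α b c ℓ S) = (tropSolitonTau α b c ℓ S : WithTop ℝ) := by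
  have hc := val_tPow x
  obtain ⟨b, hb, hcurve⟩ := exists_curve_point hn hα hc h0 hx
  have hb0 := ne_zero_of_val_eq hb
  have hc0 := ne_zero_of_val_eq hc
  have hdata : IsSolitonData k A α b (tPow x) ((tPow x / b) ^ n) :=
    { val_α := hα
      curve := hcurve
      ℓ_ne_zero := pow_ne_zero _ (div_ne_zero hc0 hb0)
      b_lt_c := by rw [hb, hc]; exact_mod_cast h0
      lower := hb.ge
      upper := by rw [hc]; exact_mod_cast hx _ (succ_natCast_ne_zero hk)
      gap := fun i => by
        by_cases hi : i = 0
        · rw [hi]; exact Or.inl hb.ge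
        · right; rw [hc]; exact_mod_cast hx i hi }
  refine ⟨b, tPow x, (tPow x / b) ^ n, hdata, hc, ?_, fun S => ?_⟩
  · rw [val_eq_valR hdata.ℓ_ne_zero, valR_pow (div_ne_zero hc0 hb0), valR_div hc0 hb0,
      valR_of_val_eq hb, valR_of_val_eq hc]
  · refine val_solitonTau_of_quotient hn hdata (fun i hi => ?_) (leadCoeff_tPow x) S
    rw [valR_of_val_eq hc]
    exact hx i hi

end Existence

/-! ### Identification of the tropicalization with the flat soliton -/

namespace IsSolitonData

variable {n k : ℕ} [NeZero n] {A : ZMod n → ℝ} {α : ZMod n → puiseux} {b c ℓ : puiseux}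

theorem tropSolitonTau_eq_flat (h : IsSolitonData k A α b c ℓ) (hn : 2 ≤ n) {x : ℝ}
    (hc : val c = (x : WithTop ℝ)) (hx : ∀ i : ZMod n, i ≠ 0 → x < A i) :
    tropSolitonTau α b c ℓ = tropTau (valR ℓ) (flatWeight n (x - A 0)) := by
  have hcx := valR_of_val_eq hc
  rw [tropSolitonTau, (h.valR_b_and_weights hn (by rwa [hcx])).2, hcx]

theorem zero_lt_sub (h : IsSolitonData k A α b c ℓ) {x : ℝ} (hc : val c = (x : WithTop ℝ)) :
    0 < x - A 0 := by
  rw [← valR_of_val_eq hc]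
  exact sub_pos.2 (h.le_valR_b.trans_lt h.valR_lt)

theorem valR_solitonB_zero_ne_zero (h : IsSolitonData k A α b c ℓ) (hn : 2 ≤ n) {x : ℝ}
    (hc : val c = (x : WithTop ℝ)) (hx : ∀ i : ZMod n, i ≠ 0 → x < A i) :
    valR (solitonB α b c 0) ≠ 0 := by
  have hcx := valR_of_val_eq hc
  have := congrFun (h.valR_b_and_weights hn (by rwa [hcx])).2 0
  simp only [flatWeight, if_true] at this
  rw [this, hcx]
  have h2 : (2 : ℝ) ≤ n := by exact_mod_cast hn
  exact (mul_pos (by linarith) (h.zero_lt_sub hc)).ne'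

/-- The tropicalized soliton with `val ℓ = m (x - A_n)` is the evolution of `(x, …, x)`. -/
theorem tropSolY_eq_evolve (h : IsSolitonData k A α b c ℓ) (hk : k + 2 ≤ n) {x : ℝ}
    (hc : val c = (x : WithTop ℝ)) (hx : ∀ i : ZMod n, i ≠ 0 → x < A i) {m : ℤ}
    (hm : val ℓ = ((m * (x - A 0) : ℝ) : WithTop ℝ)) :
    (∀ i : ℤ, i < 0 → tropSolY k A α b c ℓ i (n - m) = vacuum A) ∧
      ∀ i t : ℕ, tropSolY k A α b c ℓ i (n - m + t) =
        (evolve k A)^[t] (placed A 0 [fun _ => x]) i := by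
  have hδ := h.zero_lt_sub hc
  rw [tropSolY, h.tropSolitonTau_eq_flat (by omega) hc hx, valR_of_val_eq hm]
  refine ⟨fun i hi => ?_, fun i t => ?_⟩
  · rw [tropY_int_mul_initial hδ hk, if_neg hi.ne]
  · have := tropY_int_mul_eq_evolve (A := A) hδ hk
      (fun p h0 _ => by linarith [hx p h0]) m i t
    rwa [add_sub_cancel] at this

end IsSolitonData

end SolitonCA

/-! ### The main theorem -/

open SolitonCA in
theorem theorem5p1 (n k : ℕ) [NeZero n] (hn : 3 ≤ n) (hk : k + 2 ≤ n) (A : ZMod n → ℝ)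
    (hA : ∀ i : ZMod n, i ≠ 0 → i ≠ (k : ZMod n) + 1 → A 0 < A i ∧ A i < A ((k : ZMod n) + 1)) :
    -- every geometric soliton solution, and its tropicalization
    (∀ (α : ZMod n → puiseux) (b c ℓ : puiseux), IsSolitonData k A α b c ℓ →
      -- `τ` gives a solution of `φ(n,k)`
      ((∀ S, solitonTau α b c ℓ S ≠ 0) →
        IsSolution geomMove k (solY k α b c ℓ) (solZ k α b c ℓ) ∧
        ∀ (i t : ℤ) (j), solY k α b c ℓ i t j ≠ 0 ∧ solZ k α b c ℓ i t j ≠ 0) ∧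
      -- the tropicalization consists of its valuations when nothing cancels in `τ`
      ((∀ S, val (solitonTau α b c ℓ S) = (tropSolitonTau α b c ℓ S : WithTop ℝ)) →
        ∀ (i t : ℤ) (j),
          val (solY k α b c ℓ i t j) = (tropSolY k A α b c ℓ i t j : WithTop ℝ) ∧
          val (solZ k α b c ℓ i t j) = (tropSolZ k A α b c ℓ i t j : WithTop ℝ)) ∧
      -- the tropicalization solves `Φ(n,k)`
      IsSolution tropMove k (tropSolY k A α b c ℓ) (tropSolZ k A α b c ℓ) ∧
      -- the case `x = val c < min A_i`
      (∀ x : ℝ, val c = (x : WithTop ℝ) → (∀ i : ZMod n, i ≠ 0 → x < A i) →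
        -- boundary behaviour of the geometric solution
        ((∀ S, solitonTau α b c ℓ S ≠ 0) → ∀ (t : ℤ) (j) (M : ℝ),
          {i : ℤ | val (solY k α b c ℓ i t j - geomVacuum α j) ≤ (M : WithTop ℝ)}.Finite ∧
          {i : ℤ | val (solZ k α b c ℓ i t j - geomCarrier k α j) ≤ (M : WithTop ℝ)}.Finite) ∧
        -- boundary behaviour of the tropicalization
        (∀ t : ℤ, {i : ℤ | tropSolY k A α b c ℓ i t ≠ vacuum A}.Finite ∧
          {i : ℤ | tropSolY k A α b c ℓ i t ≠ vacuum A}.Nonempty ∧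
          {i : ℤ | tropSolZ k A α b c ℓ i t ≠ initialCarrier k A}.Finite) ∧
        -- it moves by one place in `n - 1` time steps, and does not reappear earlier
        (∀ i t : ℤ, tropSolY k A α b c ℓ (i + 1) (t + (n - 1)) = tropSolY k A α b c ℓ i t) ∧
        (∀ t a d : ℤ, 0 < a →
          (∀ i : ℤ, tropSolY k A α b c ℓ (i + d) (t + a) = tropSolY k A α b c ℓ i t) →
          (n : ℤ) - 1 ≤ a) ∧
        -- it is the soliton `(x,…,x)` if `val ℓ` is an integer multiple of `x - A_n`
        (∀ m : ℤ, val ℓ = ((m * (x - A 0) : ℝ) : WithTop ℝ) →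
          (∀ i : ℤ, i < 0 → tropSolY k A α b c ℓ i (n - m) = vacuum A) ∧
          (∀ i t : ℕ, tropSolY k A α b c ℓ i (n - m + t) =
            (evolve k A)^[t] (placed A 0 [fun _ => x]) i))) ∧
      -- otherwise all states of the tropicalization are the vacuum
      ((∃ i : ZMod n, i ≠ 0 ∧ (A i : WithTop ℝ) ≤ val b) →
        ∀ i t : ℤ, tropSolY k A α b c ℓ i t = vacuum A)) ∧
    -- all rational `x` in the range arise, for every choice of the `α_i`
    (∀ α : ZMod n → puiseux, (∀ i, val (α i) = (A i : WithTop ℝ)) →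
      ∀ x : ℚ, A 0 < x → (∀ i : ZMod n, i ≠ 0 → i ≠ (k : ZMod n) + 1 → (x : ℝ) < A i) →
        ∃ b c ℓ : puiseux, IsSolitonData k A α b c ℓ ∧ val c = ((x : ℝ) : WithTop ℝ) ∧
          (∀ S, val (solitonTau α b c ℓ S) = (tropSolitonTau α b c ℓ S : WithTop ℝ)) ∧
          (∀ i : ℤ, i < 0 → ∀ j, val (solY k α b c ℓ i 0 j) = (A 0 : WithTop ℝ)) ∧
          (∀ (i t : ℕ) (j), val (solY k α b c ℓ i t j) =
            ((evolve k A)^[t] (placed A 0 [fun _ => (x : ℝ)]) i j : WithTop ℝ))) ∧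
    -- for all real `x` in the range, `(x,…,x)` is a soliton in minimal form of velocity `1/(n-1)`,
    -- given by the tropical tau function `min[0, L + S · W(x)]`
    (∀ x : ℝ, A 0 < x → (∀ i : ZMod n, i ≠ 0 → i ≠ (k : ZMod n) + 1 → x < A i) →
      IsMinimalForm k A [fun _ => x] ∧ HasVelocity k A [fun _ => x] (1 / ((n : ℝ) - 1)) ∧
      ∀ i t : ℕ, (evolve k A)^[t] (placed A 0 [fun _ => x]) i =
        tropY k A (tropTau (n * (x - A 0))
          fun j => if j = 0 then (n - 1) * (x - A 0) else -(x - A 0)) i t) := by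
  -- The bound extends to the index `k + 1`: as `n ≥ 3`, some other index `q ≠ n` exists, and `x <
  -- A_q < A_{k+1}`.
  have hinner : ∀ x : ℝ, (∀ i : ZMod n, i ≠ 0 → i ≠ (k : ZMod n) + 1 → x < A i) →
      ∀ i : ZMod n, i ≠ 0 → x < A i := fun x hx i hi => by
    by_cases hf : i = (k : ZMod n) + 1
    · obtain ⟨q, h0, h1⟩ := exists_inner (k := k) hn
      rw [hf]
      exact (hx q h0 h1).trans (hA q h0 h1).2
    · exact hx i hi hf
  have hn2 : 2 ≤ n := by omega
  refine ⟨fun α b c ℓ h => ⟨fun hτ => ⟨h.isSolution_geomMove hn hk hA hτ,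
    h.sol_ne_zero hn hA hτ⟩, h.val_sol hn hA, h.isSolution_tropMove hk hA, ?_, ?_⟩, ?_, ?_⟩
  · intro x hc hx
    have hδ := h.zero_lt_sub hc
    refine ⟨fun hτ t j M => h.finite_boundary (h.valR_solitonB_zero_ne_zero hn2 hc hx) hτ t j M,
      ?_, ?_, ?_, fun m hm => h.tropSolY_eq_evolve hk hc hx hm⟩
    all_goals simp only [tropSolY, tropSolZ, h.tropSolitonTau_eq_flat hn2 hc hx]
    · exact fun t => ⟨finite_tropY_ne_vacuum hδ hk t, nonempty_tropY_ne_vacuum hδ hk t,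
        finite_tropZ_ne_initialCarrier hδ hk t⟩
    · exact tropY_flatWeight_recurs hk
    · exact fun t a d ha heq => le_of_tropY_flatWeight_translate hδ hk ha heq
  · rintro ⟨p, hp, hpb⟩ i t
    exact h.tropSolY_eq_vacuum hn hA hp hpb i t
  · intro α hα x h0 hx
    obtain ⟨b, c, ℓ, h, hc, hℓ, hτ⟩ := exists_solitonData hn2 hk hα h0 (hinner x hx)
    -- The power `n` in `ℓ` gives `m = n`, so the state `(x, …, x)` appears at time `n - m = 0`.
    obtain ⟨hneg, hev⟩ := h.tropSolY_eq_evolve hk hc (hinner x hx) (m := n) (by exact_mod_cast hℓ)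
    rw [sub_self] at hneg hev
    refine ⟨b, c, ℓ, h, hc, hτ, fun i hi j => ?_, fun i t j => ?_⟩
    · rw [(h.val_sol hn hA hτ i 0 j).1, hneg i hi, vacuum]
    · rw [(h.val_sol hn hA hτ i t j).1, ← hev, zero_add]
  · intro x h0 hx
    have hδ : 0 < x - A 0 := sub_pos.2 h0
    have hAδ : ∀ p, p ≠ 0 → p ≠ (k : ZMod n) + 1 → A 0 + (x - A 0) < A p := fun p h1 h2 => by
      linarith [hx p h1 h2]
    have h1 := isMinimalForm_flat hδ hk hAδ
    have h2 := hasVelocity_flat hδ hk hAδ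
    have h3 := evolve_eq_tropY hδ hk hAδ
    rw [add_sub_cancel] at h1 h2 h3
    exact ⟨h1, h2, h3⟩
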